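/- Let $N$ be a free abelian group of rank $d$, $M=\mathrm{Hom}(N,\mathbf Z)$, and let $\Sigma$ be a complete rational simplicial fan in $N_{\mathbf R}$, with one-dimensional cones $\rho_1,\dots,\rho_n$ and primitive integral generators $e_1,\dots,e_n\in N$. Let $S=\mathbf C[z_1,\dots,z_n]$, graded by $Cl(\Sigma)=\mathbf Z^n/\alpha(M)$, where $\alpha(m)=(\langle m,e_1\rangle,\dots,\langle m,e_n\rangle)$ and $\deg z_i$ is the class of the $i$-th basis vector; let $Z(\Sigma)\subset\mathbf A^n=\mathbf C^n$ be the common zero set of the monomials $\prod_{\rho_i\not\subset\sigma}z_i$ $(\sigma\in\Sigma)$, $U(\Sigma)=\mathbf A^n\setminus Z(\Sigma)$, $\mathbf D(\Sigma)=\mathrm{Hom}(Cl(\Sigma),\mathbf C^*)\subset(\mathbf C^*)^n$, and $\mathbf P_\Sigma=U(\Sigma)/\mathbf D(\Sigma)$ the toric variety of $\Sigma$. Let $f\in S$ be $\mathbf D(\Sigma)$-homogeneous, i.e. homogeneous of some degree $\beta\in Cl(\Sigma)$, let $\mathbf V(f)\subset\mathbf A^n$ be its zero set (with its reduced structure), and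 let $X\subset\mathbf P_\Sigma$ be the hypersurface defined by $f$, i.e. the image of $\mathbf V(f)\cap U(\Sigma)$. Call $X$ quasi-smooth if $\mathbf V(f)$ is smooth at each of its points outside $Z(\Sigma)$. A finite subgroup $G\subset GL(d,\mathbf C)$ is small if no element of $G$ has $1$ as an eigenvalue of multiplicity exactly $d-1$; a local model of $\mathbf P_\Sigma$ at $p$ is an isomorphism of analytic germs $(\mathbf C^d/G,0)\cong(\mathbf P_\Sigma,p)$ with $G\subset GL(d,\mathbf C)$ finite and small; $\mathbf P_\Sigma$ is a $V$-manifold if it has a local model at every point; and $X$ is a $V$-submanifold of the $V$-manifold $\mathbf P_\Sigma$ if for every $p\in X$ there is a local model of $\mathbf P_\Sigma$ at $p$ for which the inverse image of $X$ in $\mathbf C^d$ is smooth at $0$. Then: 1. $X$ is quasi-smooth if and only if $X$ is a $V$-submanifold of $\mathbf P_\Sigma$ (in particular $\mathbf P_\Sigma$ is then a $V$-manifold). 2. Suppose moreover that $f$ is squarefree. Let $\sigma\in\Sigma$ be a $d$-dimensional cone and let $t\in\mathbf V(f)$ satisfy $t_j=1$ for every $j$ with $e_j$ not a generator of $\sigma$.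 Then $\mathbf V(f)$ is smooth at $t$ if and only if $\frac{\partial f}{\partial z_i}(t)\neq0$ for some $i$ such that $e_i$ is a generator of $\sigma$. -/

import Mathlib

open scoped Topology TensorProduct

noncomputable section

namespace ToricHyp

/-- The cone in `N_ℝ = ℝ ⊗ N` spanned by a finite set `s` of elements of `N`. -/
def cone {N : Type*} [AddCommGroup N] (s : Finset N) : Set (ℝ ⊗[ℤ] N) :=
  {x | ∃ μ : N → ℝ, (∀ e ∈ s, 0 ≤ μ e) ∧ x = ∑ e ∈ s, μ e • ((1 : ℝ) ⊗ₜ[ℤ] e)}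

/-- `s` is the set of integral generators of a rational simplicial cone: its elements are
linearly independent, and a nonnegative rational multiple `(a / b) • e` of one of them lies in
`N` (that is, `b • v = a • e` for some `v : N`) only if `a / b` is an integer. -/
def IsIntegralGenerators {N : Type*} [AddCommGroup N] (s : Finset N) : Prop :=
  LinearIndepOn ℤ id (s : Set N) ∧
    ∀ e ∈ s, ∀ a b : ℕ, 0 < b → (∃ v : N, b • v = a • e) → b ∣ a

/-- A complete rational simplicial fan in `N_ℝ`. A rational simplicial cone is recorded by its
finite set of integral generators, which determines it and is determined by it; the faces of
the cone are the cones spanned by the subsets. -/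
structure Fan (N : Type*) [AddCommGroup N] where
  cones : Set (Finset N)
  finite_cones : cones.Finite
  generators : ∀ s ∈ cones, IsIntegralGenerators s
  face_mem : ∀ s ∈ cones, ∀ t ⊆ s, t ∈ cones
  inter_face : ∀ s ∈ cones, ∀ t ∈ cones, ∃ u, u ⊆ s ∧ u ⊆ t ∧ cone s ∩ cone t = cone u
  complete : (⋃ s ∈ cones, cone s) = Set.univ

section Toric

variable {N : Type*} [AddCommGroup N] (F : Fan N)

/-- The index set of the one-dimensional cones `ρ₁, …, ρₙ`; a ray is given by its integral
generator. -/
def Ray : Type _ := {e : N // {e} ∈ F.cones}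

/-- The integral generator of a ray. -/
def Ray.gen {F : Fan N} (i : Ray F) : N := i.1

instance : Finite (Ray F) :=
  have : Finite F.cones := F.finite_cones
  Finite.of_injective (fun i : Ray F => (⟨{i.1}, i.2⟩ : F.cones))
    (fun i j h => Subtype.ext (by simpa using h))

instance : Fintype (Ray F) := Fintype.ofFinite _

open Classical in
/-- The monomial `∏_{ρᵢ ⊄ σ} zᵢ`; the rays contained in `σ` are those spanned by its
integral generators. -/
def zHat (s : Finset N) : MvPolynomial (Ray F) ℂ :=
  ∏ i with i.gen ∉ s, MvPolynomial.X i

/-- The ideal `B(Σ)`. -/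
def irrelevantIdeal : Ideal (MvPolynomial (Ray F) ℂ) :=
  Ideal.span (zHat F '' F.cones)

/-- The zero set `Z(Σ)` of `B(Σ)` in the affine space `𝔸ⁿ`. -/
def exceptionalSet : Set (Ray F → ℂ) :=
  {z | ∀ b ∈ irrelevantIdeal F, MvPolynomial.eval z b = 0}

/-- `U(Σ) = 𝔸ⁿ \ Z(Σ)`. -/
def stableSet : Set (Ray F → ℂ) := (exceptionalSet F)ᶜ

/-- `α : M → ℤⁿ`, `m ↦ (⟨m, e₁⟩, …, ⟨m, eₙ⟩)`. -/
def alpha : Module.Dual ℤ N →ₗ[ℤ] (Ray F → ℤ) :=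
  LinearMap.pi fun i => LinearMap.applyₗ i.gen

/-- The class group `Cl(Σ) = ℤⁿ / α(M)`. -/
abbrev ClassGp : Type _ := (Ray F → ℤ) ⧸ LinearMap.range (alpha F)

open Classical in
/-- The degree of the variable `zᵢ` in `Cl(Σ)`. -/
def varDegree (i : Ray F) : ClassGp F :=
  Submodule.Quotient.mk (Pi.single i 1)

/-- `f` is `𝐃`-homogeneous of degree `β`: all its monomials have degree `β` in `Cl(Σ)`. -/
def IsDHomogeneous (f : MvPolynomial (Ray F) ℂ) (β : ClassGp F) : Prop :=
  MvPolynomial.IsWeightedHomogeneous (varDegree F) f β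

/-- The group `𝐃(Σ) = Spec ℂ[Cl(Σ)]` as a subgroup of `(ℂ*)ⁿ`: those points whose associated
character of `ℤⁿ` is trivial on `α(M)`. -/
def groupD : Subgroup (Ray F → ℂˣ) where
  carrier := {c | ∀ m : Module.Dual ℤ N, ∏ i, c i ^ alpha F m i = 1}
  one_mem' := by intro m; simp
  mul_mem' := by
    intro a b ha hb m
    simp only [Pi.mul_apply, mul_zpow, Finset.prod_mul_distrib]
    rw [ha m, hb m, one_mul]
  inv_mem' := by
    intro a ha m
    simp only [Pi.inv_apply, inv_zpow, Finset.prod_inv_distrib]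
    rw [ha m, inv_one]

/-- The orbit relation of `𝐃(Σ)` on `U(Σ)`. -/
def orbitSetoid : Setoid (stableSet F) where
  r z w := ∃ c ∈ groupD F, ∀ i, w.1 i = (c i : ℂ) * z.1 i
  iseqv :=
    { refl := fun z => ⟨1, one_mem _, fun i => by simp⟩
      symm := by
        rintro z w ⟨c, hc, h⟩
        exact ⟨c⁻¹, inv_mem hc, fun i => by simp [h i]⟩
      trans := by
        rintro z w v ⟨c, hc, h⟩ ⟨c', hc', h'⟩
        exact ⟨c' * c, mul_mem hc' hc, fun i => by simp [h i, h' i, mul_assoc]⟩ }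

/-- The toric variety `𝐏 = U(Σ)/𝐃(Σ)` (its complex points, with the quotient of the Euclidean
topology). -/
def ToricVariety : Type _ := Quotient (orbitSetoid F)

instance : TopologicalSpace (ToricVariety F) :=
  inferInstanceAs (TopologicalSpace (Quotient (orbitSetoid F)))

/-- The quotient map `U(Σ) → 𝐏`. -/
def toricMk (z : stableSet F) : ToricVariety F := Quotient.mk (orbitSetoid F) z

/-- The zero set `𝐕(f) ⊆ 𝔸ⁿ`. -/
def zeroSet (f : MvPolynomial (Ray F) ℂ) : Set (Ray F → ℂ) :=
  {z | MvPolynomial.eval z f = 0}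

/-- The hypersurface `X ⊆ 𝐏` defined by `f`: the image of `𝐕(f) ∩ U(Σ)`. -/
def hypersurface (f : MvPolynomial (Ray F) ℂ) : Set (ToricVariety F) :=
  toricMk F '' {z | z.1 ∈ zeroSet F f}

end Toric

/-- The orbit relation of a linear group `G` on `ℂᵈ`. -/
def linearSetoid {d : ℕ} (G : Subgroup (Matrix.GeneralLinearGroup (Fin d) ℂ)) :
    Setoid (Fin d → ℂ) where
  r v w := ∃ g ∈ G, w = Matrix.mulVec (g : Matrix (Fin d) (Fin d) ℂ) v
  iseqv :=
    { refl := fun v => ⟨1, one_mem _, by simp⟩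
      symm := by
        rintro v w ⟨g, hg, rfl⟩
        exact ⟨g⁻¹, inv_mem hg, by
          rw [Matrix.mulVec_mulVec, ← Units.val_mul, inv_mul_cancel]; simp⟩
      trans := by
        rintro v w u ⟨g, hg, rfl⟩ ⟨g', hg', rfl⟩
        exact ⟨g' * g, mul_mem hg' hg, by simp [Matrix.mulVec_mulVec]⟩ }

/-- The quotient `ℂᵈ/G`, with the quotient topology. -/
def LinearQuotient {d : ℕ} (G : Subgroup (Matrix.GeneralLinearGroup (Fin d) ℂ)) : Type :=
  Quotient (linearSetoid G)

instance {d : ℕ} (G : Subgroup (Matrix.GeneralLinearGroup (Fin d) ℂ)) :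
    TopologicalSpace (LinearQuotient G) :=
  inferInstanceAs (TopologicalSpace (Quotient (linearSetoid G)))

/-- The quotient map `ℂᵈ → ℂᵈ/G`. -/
def linearMk {d : ℕ} (G : Subgroup (Matrix.GeneralLinearGroup (Fin d) ℂ)) (v : Fin d → ℂ) :
    LinearQuotient G := Quotient.mk (linearSetoid G) v

/-- The structure sheaf of `ℂᵈ/G`: `h` is holomorphic near `x` if its pullback to `ℂᵈ` is
holomorphic near the points over `x`. -/
def LinearQuotient.HolAt {d : ℕ} (G : Subgroup (Matrix.GeneralLinearGroup (Fin d) ℂ))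
    (h : LinearQuotient G → ℂ) (x : LinearQuotient G) : Prop :=
  ∀ v : Fin d → ℂ, linearMk G v = x → AnalyticAt ℂ (fun w => h (linearMk G w)) v

/-- The (analytic) structure sheaf of `𝐏 = U(Σ)/𝐃(Σ)`: `h` is holomorphic near `x` if its
pullback to the open set `U(Σ)` is holomorphic near the points over `x`. -/
def ToricVariety.HolAt {N : Type*} [AddCommGroup N] (F : Fan N)
    (h : ToricVariety F → ℂ) (x : ToricVariety F) : Prop :=
  ∀ z : stableSet F, toricMk F z = x →
    ∃ H : (Ray F → ℂ) → ℂ, AnalyticAt ℂ H z ∧ ∀ᶠ w in 𝓝 z, H w.1 = h (toricMk F w)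

/-- A finite small subgroup of `GL(d, ℂ)`: no element has `1` as an eigenvalue of multiplicity
`d - 1` (elements of a finite group are diagonalizable, so that the multiplicity is the
dimension of the eigenspace). -/
def IsFiniteSmall {d : ℕ} (G : Subgroup (Matrix.GeneralLinearGroup (Fin d) ℂ)) : Prop :=
  Finite G ∧ ∀ g ∈ G, Module.finrank ℂ
    (Module.End.eigenspace (Matrix.toLin' (g : Matrix (Fin d) (Fin d) ℂ)) 1) + 1 ≠ d

/-- `φ` is an analytic isomorphism of germs `(ℂᵈ/G, 0) ≅ (𝐏, p)`: a homeomorphism from an open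
neighbourhood of the origin to an open neighbourhood of `p` that identifies the
holomorphic functions. -/
def IsGermIso {N : Type*} [AddCommGroup N] (F : Fan N) {d : ℕ}
    (G : Subgroup (Matrix.GeneralLinearGroup (Fin d) ℂ)) (p : ToricVariety F)
    (φ : OpenPartialHomeomorph (LinearQuotient G) (ToricVariety F)) : Prop :=
  linearMk G 0 ∈ φ.source ∧ φ (linearMk G 0) = p ∧
    ∀ x ∈ φ.source, ∀ h : ToricVariety F → ℂ,
      ToricVariety.HolAt F h (φ x) ↔ LinearQuotient.HolAt G (fun y => h (φ y)) x

/-- The subset `S` of `ℂᵏ` is smooth (a complex submanifold) at its point `p`: near `p` it is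
the zero set of finitely many holomorphic functions with linearly independent differentials
at `p`. -/
def IsSmoothAt {ι : Type*} [Fintype ι] (S : Set (ι → ℂ)) (p : ι → ℂ) : Prop :=
  ∃ (r : ℕ) (H : (ι → ℂ) → (Fin r → ℂ)), AnalyticAt ℂ H p ∧
    Function.Surjective (fderiv ℂ H p) ∧ ∀ᶠ z in 𝓝 p, z ∈ S ↔ H z = 0

/-- `𝐏` is a `V`-manifold of dimension `d`: it has a local model at every point. -/
def IsVManifold {N : Type*} [AddCommGroup N] (F : Fan N) (d : ℕ) : Prop :=
  ∀ p : ToricVariety F, ∃ G : Subgroup (Matrix.GeneralLinearGroup (Fin d) ℂ),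
    IsFiniteSmall G ∧ ∃ φ, IsGermIso F G p φ

/-- `X` is a `V`-submanifold of the `d`-dimensional `V`-manifold `𝐏`: at every point of `X` there
is a local model in which the inverse image of `X` in `ℂᵈ` is smooth at the origin. -/
def IsVSubmanifold {N : Type*} [AddCommGroup N] (F : Fan N) (d : ℕ)
    (X : Set (ToricVariety F)) : Prop :=
  IsVManifold F d ∧ ∀ p ∈ X, ∃ G : Subgroup (Matrix.GeneralLinearGroup (Fin d) ℂ),
    IsFiniteSmall G ∧ ∃ φ, IsGermIso F G p φ ∧
      IsSmoothAt {v | linearMk G v ∈ φ.source ∧ φ (linearMk G v) ∈ X} 0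

/-- The hypersurface defined by `f` is quasi-smooth: `𝐕(f)` is smooth outside `Z(Σ)`. -/
def IsQuasiSmooth {N : Type*} [AddCommGroup N] (F : Fan N)
    (f : MvPolynomial (Ray F) ℂ) : Prop :=
  ∀ z ∈ zeroSet F f, z ∉ exceptionalSet F → IsSmoothAt (zeroSet F f) z

end ToricHyp

end

/-! The proof works on slices. For a cone σ of dimension d, the slice {z_j = 1 for all e_j not in σ}
is a copy of ℂ^d. By completeness every point of U(Σ) lies in the 𝐃(Σ)-orbit of a point t of such a
slice. The stabilizer of t is finite, acts diagonally on the slice, and is small because the e_i are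
primitive; the slice modulo this stabilizer is a local model of 𝐏 (`Slice.exists_isGermIso`). Near
an orbit, U(Σ) projects submersively to the slice along the orbits, and slice directions and orbit
directions together span. Hence 𝐕(f) is smooth at a point if and only if its trace on the slice is
(`Slice.isSmoothAt_zeroSet`, `Slice.isSmoothAt_slice`). Quasi-smoothness thus gives a V-submanifold
at once.

For the converse, the given local model ℂ^d/G must be compared with the slice model: an isomorphism
of germs of quotients by small groups lifts to a biholomorphic germ
(`IsHolIso.exists_biholomorphic`). The stabilizer is diagonal of exponent dividing k, so each v_i^k
descends to the quotient and pulls back to a holomorphic function h_i on the other side. Off the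
fixed locus of G the isomorphism lifts locally, so h_i is locally a k-th power. The fixed locus has
codimension at least 2, so generic lines miss it; roots on discs in these lines, recovered as means
over circles, give a holomorphic root of h_i at the origin (`exists_pow_eq_of_generic_lines`). The
Jacobian of the map formed by the roots can vanish only on the fixed locus, hence not at the origin
(`ne_zero_of_generic_lines`). Finally f is semi-invariant, so f^k descends as well, and the identity
theorem matches the zero sets.

For the second assertion, suppose 𝐕(f) is smooth at t with f squarefree. Some coordinate lines meet
𝐕(f) at most once near t. A nonzero combination of f and its derivative along these lines that is
free of the corresponding variable shows that on generic lines the zero is simple. A lower bound for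
|f| uniform in the line then forces a nonzero partial derivative at t itself
(`exists_pderiv_ne_zero_of_isSmoothAt`). Since f vanishes along orbits, the derivatives in the
directions of σ already detect this. -/

noncomputable section

namespace ToricHyp

/-! ### Holomorphic roots and the minimum principle on a disc. -/

section OneVariable

open Metric

/-- A nonvanishing holomorphic function on a disc has a holomorphic `k`-th root. -/
lemma exists_differentiableOn_pow_eq_of_ne_zero {g : ℂ → ℂ} {c : ℂ} {r : ℝ} {k : ℕ} (hk : k ≠ 0)
    (hg : DifferentiableOn ℂ g (ball c r)) (h0 : ∀ z ∈ ball c r, g z ≠ 0) :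
    ∃ f : ℂ → ℂ, DifferentiableOn ℂ f (ball c r) ∧ ∀ z ∈ ball c r, f z ^ k = g z := by
  rcases le_or_gt r 0 with hr | hr
  · exact ⟨0, by simp [ball_eq_empty.2 hr], by simp [ball_eq_empty.2 hr]⟩
  have hc : c ∈ ball c r := mem_ball_self hr
  -- `l` is a primitive of g'/g, that is, a logarithm of `g` up to a constant.
  obtain ⟨l, hl⟩ := ((hg.deriv isOpen_ball).div hg h0).isExactOn_ball
  have hdl : DifferentiableOn ℂ l (ball c r) := fun z hz =>
    (hl z hz).differentiableAt.differentiableWithinAt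
  have hconst : ∀ z ∈ ball c r, g z * Complex.exp (-l z) = g c * Complex.exp (-l c) := by
    intro z hz
    refine (convex_ball c r).is_const_of_fderivWithin_eq_zero (𝕜 := ℂ)
      (f := fun z => g z * Complex.exp (-l z)) (hg.mul hdl.neg.cexp) ?_ hz hc
    intro w hw
    have h1 : HasDerivAt (fun z => g z * Complex.exp (-l z)) 0 w := by
      have hgw := (hg.differentiableAt (isOpen_ball.mem_nhds hw)).hasDerivAt
      refine (hgw.mul (hl w hw).neg.cexp).congr_deriv ?_
      simp only [Pi.neg_apply, Pi.div_apply]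
      field_simp [h0 w hw]
      ring
    rw [fderivWithin_of_isOpen isOpen_ball hw, h1.hasFDerivAt.fderiv]
    ext; simp
  obtain ⟨a, ha⟩ := IsAlgClosed.exists_pow_nat_eq (g c * Complex.exp (-l c)) (Nat.pos_of_ne_zero hk)
  refine ⟨fun z => a * Complex.exp (l z / k), (hdl.div_const _).cexp.const_mul _, fun z hz => ?_⟩
  have hk' : (k : ℂ) ≠ 0 := by exact_mod_cast hk
  rw [mul_pow, ha, ← Complex.exp_nat_mul, mul_div_cancel₀ _ hk', ← hconst z hz, mul_assoc,
    ← Complex.exp_add]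
  simp

/-- A holomorphic function on a disc that is locally a `k`-th power is a `k`-th power. -/
lemma exists_differentiableOn_pow_eq {q : ℂ → ℂ} {c : ℂ} {r : ℝ} {k : ℕ} (hk : k ≠ 0)
    (hq : AnalyticOnNhd ℂ q (closedBall c r)) (hne : ∃ z ∈ closedBall c r, q z ≠ 0)
    (hloc : ∀ z ∈ closedBall c r, ∃ β : ℂ → ℂ, AnalyticAt ℂ β z ∧ q =ᶠ[𝓝 z] β ^ k) :
    ∃ f : ℂ → ℂ, DifferentiableOn ℂ f (ball c r) ∧ ∀ z ∈ ball c r, f z ^ k = q z := by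
  set U := closedBall c r
  have hm : MeromorphicOn q U := fun z hz => (hq z hz).meromorphicAt
  have htop : ∀ z ∈ U, meromorphicOrderAt q z ≠ ⊤ := by
    obtain ⟨z₀, hz₀, hqz₀⟩ := hne
    intro z hz
    refine hm.meromorphicOrderAt_ne_top_of_isPreconnected
      (convex_closedBall c r).isPreconnected hz₀ hz ?_
    rw [(hq z₀ hz₀).meromorphicOrderAt_eq, (hq z₀ hz₀).analyticOrderAt_eq_zero.2 hqz₀]
    simp
  have hfin : (MeromorphicOn.divisor q U).support.Finite :=
    Function.locallyFinsuppWithin.finiteSupport _ (isCompact_closedBall c r)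
  obtain ⟨g, hga, hg0, hqg⟩ := hm.extract_zeros_poles (fun u => htop u u.2) hfin
  set D := MeromorphicOn.divisor q U
  -- The order of β^k is k times that of β, so every multiplicity of a zero of `q` is divisible by
  -- `k` and the zeros split off as Q^k.
  have hD : ∀ z, ∃ e : ℤ, 0 ≤ e ∧ D z = e * k := by
    intro z
    by_cases hz : z ∈ U
    · obtain ⟨β, hβ, hqβ⟩ := hloc z hz
      have h1 : meromorphicOrderAt q z = k * meromorphicOrderAt β z := by
        rw [meromorphicOrderAt_congr (hqβ.filter_mono nhdsWithin_le_nhds),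
          meromorphicOrderAt_pow hβ.meromorphicAt]
      have h2 : D z = (meromorphicOrderAt q z).untop₀ := MeromorphicOn.divisor_apply hm hz
      refine ⟨(meromorphicOrderAt β z).untop₀, ?_, ?_⟩
      · rw [hβ.meromorphicOrderAt_eq]
        cases analyticOrderAt β z <;> simp
      · have hb : meromorphicOrderAt β z ≠ ⊤ := by
          intro hb
          apply htop z hz
          rw [h1, hb, WithTop.mul_top]
          simpa using hk
        obtain ⟨b, hb⟩ := WithTop.ne_top_iff_exists.1 hb
        rw [h2, h1, ← hb]
        have : ((k : WithTop ℤ)) * (b : WithTop ℤ) = ((k * b : ℤ) : WithTop ℤ) := by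
          push_cast; rfl
        rw [this]
        simp [mul_comm]
    · exact ⟨0, le_rfl, by simpa using D.apply_eq_zero_of_notMem hz⟩
  choose e he0 hek using hD
  have hk' : (k : ℤ) ≠ 0 := by exact_mod_cast hk
  have hefin : (Function.support e).Finite := by
    refine hfin.subset fun z hz => ?_
    simp only [Function.mem_support] at hz ⊢
    rw [hek]; exact mul_ne_zero hz hk'
  set Q : ℂ → ℂ := ∏ᶠ u, (· - u) ^ e u
  have hQ : (∏ᶠ u, (fun x : ℂ => x - u) ^ D u) = Q ^ k := by
    have h3 : Function.HasFiniteMulSupport fun u : ℂ => (fun x : ℂ => x - u) ^ e u := by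
      refine hefin.subset fun u hu => ?_
      contrapose! hu
      simp only [Function.mem_support, not_not] at hu
      simp [hu]
    rw [finprod_pow h3]
    refine finprod_congr fun u => ?_
    rw [hek, zpow_mul, zpow_natCast]
  have hQa : ∀ z, AnalyticAt ℂ Q z := fun z => Function.FactorizedRational.analyticAt (he0 z)
  obtain ⟨f, hfd, hfk⟩ := exists_differentiableOn_pow_eq_of_ne_zero (c := c) (r := r) hk
    (g := g) (fun z hz => (hga z (ball_subset_closedBall hz)).differentiableAt.differentiableWithinAt)
    (fun z hz => hg0 ⟨z, ball_subset_closedBall hz⟩)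
  refine ⟨fun z => Q z * f z, fun z hz => ((hQa z).differentiableAt.differentiableWithinAt).mul
    (hfd z hz), fun z hz => ?_⟩
  have hzU : z ∈ U := ball_subset_closedBall hz
  rw [mul_pow, hfk z hz]
  -- The factorization is only known off a discrete set; analyticity extends it to `z`.
  have h4 : ∀ᶠ w in 𝓝[≠] z, q w = (Q w) ^ k * g w := by
    have h5 := mem_codiscreteWithin.1 hqg z hzU
    rw [Filter.disjoint_principal_right] at h5
    have h6 : ∀ᶠ w in 𝓝[≠] z, w ∈ U := nhdsWithin_le_nhds
      (Filter.mem_of_superset (isOpen_ball.mem_nhds hz) ball_subset_closedBall)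
    filter_upwards [h5, h6] with w hw hwU
    have hw' : w ∈ {x | q x = ((∏ᶠ u, (fun x : ℂ => x - u) ^ D u) • g) x} := by
      by_contra hcon
      exact hw ⟨hwU, hcon⟩
    have h7 : q w = ((∏ᶠ u, (fun x : ℂ => x - u) ^ D u) • g) w := hw'
    rw [h7, hQ]
    simp
  have h5 : ∀ᶠ w in 𝓝 z, q w = (Q w) ^ k * g w :=
    ((hq z hzU).frequently_eq_iff_eventually_eq (((hQa z).pow k).mul (hga z hzU))).1 h4.frequently
  exact h5.self_of_nhds.symm

/-- The minimum principle on a disc. -/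
lemma le_norm_of_forall_sphere {q : ℂ → ℂ} {c : ℂ} {r m : ℝ} (hr : 0 < r) (hm : 0 < m)
    (hq : DifferentiableOn ℂ q (closedBall c r)) (h0 : ∀ z ∈ closedBall c r, q z ≠ 0)
    (hs : ∀ z ∈ sphere c r, m ≤ ‖q z‖) : ∀ z ∈ closedBall c r, m ≤ ‖q z‖ := by
  intro z hz
  have hd : DiffContOnCl ℂ (fun z => (q z)⁻¹) (ball c r) := by
    apply DifferentiableOn.diffContOnCl
    rw [closure_ball c hr.ne']
    exact hq.inv h0
  have h1 := Complex.norm_le_of_forall_mem_frontier_norm_le (f := fun z => (q z)⁻¹) isBounded_ball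
    hd (C := m⁻¹) (by
      intro w hw
      rw [frontier_ball c hr.ne'] at hw
      rw [norm_inv]
      exact inv_anti₀ hm (hs w hw)) (z := z) (by rwa [closure_ball c hr.ne'])
  rw [norm_inv] at h1
  exact (inv_le_inv₀ (norm_pos_iff.2 (h0 z hz)) hm).1 h1

end OneVariable

/-! ### Composition operators on spaces of continuous functions. -/

section Nemytskii

variable {𝕜 E F K : Type*} [NontriviallyNormedField 𝕜] [NormedAddCommGroup E] [NormedSpace 𝕜 E]
  [NormedAddCommGroup F] [NormedSpace 𝕜 F] [TopologicalSpace K] [CompactSpace K]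

/-- A continuous multilinear map, applied pointwise to continuous functions. -/
def pointwiseMultilinear (K : Type*) [TopologicalSpace K] [CompactSpace K] {n : ℕ}
    (p : ContinuousMultilinearMap 𝕜 (fun _ : Fin n => E) F) :
    ContinuousMultilinearMap 𝕜 (fun _ : Fin n => C(K, E)) C(K, F) :=
  MultilinearMap.mkContinuous
    { toFun := fun Φ => ⟨fun s => p fun i => Φ i s, by fun_prop⟩
      map_update_add' := by
        intro _ Φ i x y
        ext s
        have h : ∀ z : C(K, E), (fun j => (Function.update Φ i z) j s) =
            Function.update (fun j => Φ j s) i (z s) := by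
          intro z
          ext j
          rcases eq_or_ne j i with rfl | hj
          · simp
          · simp [hj]
        simp [h]
      map_update_smul' := by
        intro _ Φ i c x
        ext s
        have h : ∀ z : C(K, E), (fun j => (Function.update Φ i z) j s) =
            Function.update (fun j => Φ j s) i (z s) := by
          intro z
          ext j
          rcases eq_or_ne j i with rfl | hj
          · simp
          · simp [hj]
        simp [h] }
    ‖p‖ (by
      intro Φ
      rw [ContinuousMap.norm_le _ (by positivity)]
      intro s
      refine (p.le_opNorm _).trans ?_
      gcongr with i
      exact (Φ i).norm_coe_le_norm s)

/-- Composition with an analytic function is an analytic operation on the continuous functions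
on a compact space. -/
lemma exists_analytic_postcomp [CompleteSpace F] {f : E → F} {x : E} (hf : AnalyticAt 𝕜 f x) :
    ∃ ρ > 0, ∀ (K : Type) [TopologicalSpace K] [CompactSpace K], ∃ A : C(K, E) → C(K, F),
      ∀ Φ, ‖Φ - ContinuousMap.const K x‖ < ρ →
        AnalyticAt 𝕜 A Φ ∧ ∀ s, A Φ s = f (Φ s) := by
  obtain ⟨p, R, hp⟩ := hf
  obtain ⟨ρ, hρ0, hρ⟩ : ∃ ρ : ℝ, 0 < ρ ∧ ENNReal.ofReal ρ ≤ R := by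
    rcases eq_or_ne R ⊤ with rfl | hR
    · exact ⟨1, one_pos, le_top⟩
    · exact ⟨R.toReal, ENNReal.toReal_pos hp.r_pos.ne' hR, ENNReal.ofReal_toReal_le⟩
  refine ⟨ρ, hρ0, fun K _ _ => ?_⟩
  let P : FormalMultilinearSeries 𝕜 C(K, E) C(K, F) := fun n => pointwiseMultilinear K (p n)
  -- Acting pointwise does not increase the norms of the Taylor coefficients.
  have hPr : p.radius ≤ P.radius := FormalMultilinearSeries.radius_le_of_le fun n =>
    MultilinearMap.mkContinuous_norm_le _ (norm_nonneg _) _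
  have hP := P.hasFPowerSeriesOnBall (hp.r_pos.trans_le (hp.r_le.trans hPr))
  refine ⟨fun Φ => P.sum (Φ - ContinuousMap.const K x), fun Φ hΦ => ?_⟩
  have hmem : ∀ {G : Type _} [NormedAddCommGroup G] (v : G), ‖v‖ < ρ →
      v ∈ Metric.eball (0 : G) R := by
    intro G _ v hv
    rw [Metric.mem_eball, edist_zero_right]
    refine lt_of_lt_of_le ?_ hρ
    rwa [← ofReal_norm, ENNReal.ofReal_lt_ofReal_iff hρ0]
  have hΦR : Φ - ContinuousMap.const K x ∈ Metric.eball (0 : C(K, E)) P.radius :=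
    Metric.eball_subset_eball (hp.r_le.trans hPr) (hmem _ hΦ)
  refine ⟨?_, fun s => ?_⟩
  · have h1 : AnalyticAt 𝕜 P.sum (Φ - ContinuousMap.const K x) := hP.analyticAt_of_mem hΦR
    exact h1.comp_of_eq (analyticAt_id.sub analyticAt_const) rfl
  · have h1 := P.hasSum hΦR
    have h2 := h1.mapL (ContinuousMap.evalCLM 𝕜 s)
    have h3 := hp.hasSum (y := Φ s - x) (hmem _ (lt_of_le_of_lt
      ((Φ - ContinuousMap.const K x).norm_coe_le_norm s) hΦ))
    rw [add_sub_cancel] at h3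
    exact h2.unique h3

end Nemytskii

/-! ### Extension across sets avoided by generic lines. -/

section Lines

open Metric Filter

variable {E : Type*} [NormedAddCommGroup E] [NormedSpace ℂ E]

/-- Compactness of the circle gives a positive minimum over `p`, and half of it survives on all
circles with centre near `p`. -/
lemma exists_forall_sphere_le {J : E → ℂ} {p u : E} {r : ℝ}
    (hJ : ∀ s ∈ sphere (0 : ℂ) r, ContinuousAt J (p + s • u))
    (h0 : ∀ s ∈ sphere (0 : ℂ) r, J (p + s • u) ≠ 0) :
    ∃ m > 0, ∀ᶠ y in 𝓝 p, ∀ s ∈ sphere (0 : ℂ) r, m ≤ ‖J (y + s • u)‖ := by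
  have hc : ContinuousOn (fun s : ℂ => ‖J (p + s • u)‖) (sphere 0 r) := fun s hs =>
    ((hJ s hs).comp (f := fun s : ℂ => p + s • u) (by fun_prop)).norm.continuousWithinAt
  obtain ⟨m, hm0, hm⟩ : ∃ m > 0, ∀ s ∈ sphere (0 : ℂ) r, m < ‖J (p + s • u)‖ := by
    rcases (sphere (0 : ℂ) r).eq_empty_or_nonempty with he | hne
    · exact ⟨1, one_pos, by simp [he]⟩
    · obtain ⟨s₀, hs₀, hmin⟩ := (isCompact_sphere (0 : ℂ) r).exists_isMinOn hne hc
      refine ⟨‖J (p + s₀ • u)‖ / 2, half_pos (norm_pos_iff.2 (h0 s₀ hs₀)), fun s hs => ?_⟩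
      exact (half_lt_self (norm_pos_iff.2 (h0 s₀ hs₀))).trans_le (hmin hs)
  refine ⟨m, hm0, ?_⟩
  refine (isCompact_sphere (0 : ℂ) r).eventually_forall_of_forall_eventually fun s hs => ?_
  have h1 : ContinuousAt (fun q : E × ℂ => ‖J (q.1 + q.2 • u)‖) (p, s) :=
    (ContinuousAt.comp (g := J) (f := fun q : E × ℂ => q.1 + q.2 • u) (x := (p, s)) (hJ s hs)
      (by fun_prop)).norm
  exact (h1.eventually_const_lt (hm s hs)).mono fun q hq => hq.le

/-- The restriction of `J` to the line through `p` has isolated zeros, so a small punctured disc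
contains none. Parallel discs with centres near `p` stay in `W`. -/
lemma exists_radius {J : E → ℂ} {p u : E} (hJ : AnalyticAt ℂ J p)
    (hu : ∃ᶠ s in 𝓝 (0 : ℂ), J (p + s • u) ≠ 0) {W : Set E} (hW : W ∈ 𝓝 p) :
    ∃ r > 0, (∀ s : ℂ, ‖s‖ ≤ r → s ≠ 0 → J (p + s • u) ≠ 0) ∧
      ∀ᶠ y in 𝓝 p, ∀ s : ℂ, ‖s‖ ≤ r → y + s • u ∈ W := by
  have h1 : AnalyticAt ℂ (fun s : ℂ => J (p + s • u)) 0 := by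
    refine AnalyticAt.comp_of_eq hJ (g := J) (f := fun s : ℂ => p + s • u) ?_ (by simp)
    fun_prop
  have h2 : ∀ᶠ s in 𝓝[≠] (0 : ℂ), J (p + s • u) ≠ 0 := by
    rcases h1.eventually_eq_zero_or_eventually_ne_zero with h | h
    · obtain ⟨s, hs, hs'⟩ := (hu.and_eventually h).exists
      exact absurd hs' hs
    · exact h
  have h3 : ∀ᶠ q : E × ℂ in 𝓝 (p, 0), q.1 + q.2 • u ∈ W := by
    have : ContinuousAt (fun q : E × ℂ => q.1 + q.2 • u) (p, 0) := by fun_prop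
    exact this.preimage_mem_nhds (by simpa using hW)
  rw [nhds_prod_eq] at h3
  obtain ⟨a, ha, b, hb, hab⟩ := eventually_prod_iff.1 h3
  obtain ⟨ε, hε, h4⟩ := Metric.eventually_nhds_iff.1 (hb.and (eventually_nhdsWithin_iff.1 h2))
  refine ⟨ε / 2, half_pos hε, fun s hs hs0 => ?_, ha.mono fun y hy s hs => ?_⟩
  · exact (h4 (by rw [dist_zero_right]; linarith)).2 hs0
  · exact hab hy (h4 (by rw [dist_zero_right]; linarith)).1

/-- A function that vanishes at most on a set that generic lines in some direction avoid
vanishes nowhere. -/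
lemma ne_zero_of_generic_lines {J : E → ℂ} {p u : E} {S : Set E} (hJ : AnalyticAt ℂ J p)
    (hu : ∃ᶠ s in 𝓝 (0 : ℂ), J (p + s • u) ≠ 0)
    (hgen : ∃ᶠ y in 𝓝 p, ∀ s : ℂ, y + s • u ∉ S)
    (hS : ∀ᶠ x in 𝓝 p, x ∉ S → J x ≠ 0) : J p ≠ 0 := by
  obtain ⟨r, hr, hr0, hrW⟩ := exists_radius hJ hu (W := {x | AnalyticAt ℂ J x ∧ (x ∉ S → J x ≠ 0)})
    (hJ.eventually_analyticAt.and hS)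
  have hp := hrW.self_of_nhds
  have hn : ∀ s ∈ sphere (0 : ℂ) r, ‖s‖ ≤ r ∧ s ≠ 0 := by
    intro s hs
    rw [mem_sphere_zero_iff_norm] at hs
    exact ⟨hs.le, by rintro rfl; simp at hs; exact hr.ne hs⟩
  obtain ⟨m, hm, hmy⟩ := exists_forall_sphere_le
    (fun s hs => (hp s (hn s hs).1).1.continuousAt) (fun s hs => hr0 s (hn s hs).1 (hn s hs).2)
  -- On the disc over a generic centre `y` the function has no zeros, so the bound on the circle
  -- passes to `y`; letting `y` tend to `p` keeps it.
  have hfr : ∃ᶠ y in 𝓝 p, m ≤ ‖J y‖ := by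
    refine (hgen.and_eventually (hrW.and hmy)).mono ?_
    rintro y ⟨hy, hyW, hym⟩
    have := le_norm_of_forall_sphere (q := fun s => J (y + s • u)) hr hm ?_ ?_ hym 0
      (mem_closedBall_self hr.le)
    · simpa using this
    · intro s hs
      rw [mem_closedBall_zero_iff] at hs
      refine DifferentiableAt.differentiableWithinAt ?_
      exact DifferentiableAt.comp s (g := J) (hyW s hs).1.differentiableAt (by fun_prop)
    · intro s hs
      rw [mem_closedBall_zero_iff] at hs
      exact (hyW s hs).2 (hy s)
  have hle : m ≤ ‖J p‖ := by
    by_contra hlt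
    push Not at hlt
    exact hfr ((hJ.continuousAt.norm.eventually_lt_const hlt).mono fun y hy => not_le.2 hy)
  exact norm_pos_iff.1 (hm.trans_le hle)

/-- The mean over the circle of radius `r`, as a functional on the continuous functions. -/
lemma exists_circle_mean {r : ℝ} (hr : 0 < r) :
    ∃ Λ : C(sphere (0 : ℂ) r, ℂ) →L[ℂ] ℂ, ∀ (f : ℂ → ℂ) (Φ : C(sphere (0 : ℂ) r, ℂ)),
      DiffContOnCl ℂ f (ball 0 r) → (∀ s, Φ s = f s) → Λ Φ = f 0 := by
  let γ : ℝ → sphere (0 : ℂ) r := fun θ => ⟨circleMap 0 r θ, circleMap_mem_sphere 0 hr.le θ⟩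
  have hγ : Continuous γ := by
    apply Continuous.subtype_mk
    fun_prop
  let l : C(sphere (0 : ℂ) r, ℂ) →ₗ[ℂ] ℂ :=
    { toFun := fun Φ => ((2 * Real.pi)⁻¹ : ℂ) * ∫ θ in (0)..(2 * Real.pi), Φ (γ θ)
      map_add' := fun Φ Ψ => by
        rw [← mul_add, ← intervalIntegral.integral_add]
        · rfl
        · exact (Φ.continuous.comp hγ).intervalIntegrable _ _
        · exact (Ψ.continuous.comp hγ).intervalIntegrable _ _
      map_smul' := fun c Φ => by
        simp only [ContinuousMap.smul_apply, smul_eq_mul, intervalIntegral.integral_const_mul,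
          RingHom.id_apply]
        ring }
  refine ⟨l.mkContinuous 1 fun Φ => ?_, fun f Φ hf hΦ => ?_⟩
  · change ‖((2 * Real.pi)⁻¹ : ℂ) * ∫ θ in (0)..(2 * Real.pi), Φ (γ θ)‖ ≤ 1 * ‖Φ‖
    have h1 := intervalIntegral.norm_integral_le_of_norm_le_const (a := 0) (b := 2 * Real.pi)
      (f := fun θ => Φ (γ θ)) (C := ‖Φ‖) (fun θ _ => Φ.norm_coe_le_norm _)
    rw [sub_zero, abs_of_pos Real.two_pi_pos] at h1
    rw [norm_mul, norm_inv, one_mul]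
    have h2 : ‖(2 * Real.pi : ℂ)‖ = 2 * Real.pi := by
      rw [← Complex.ofReal_ofNat, ← Complex.ofReal_mul, Complex.norm_real, Real.norm_eq_abs,
        abs_of_pos Real.two_pi_pos]
    rw [h2, inv_mul_le_iff₀ Real.two_pi_pos]
    linarith
  · have h1 := DiffContOnCl.circleAverage (f := f) (R := r) (c := 0) (by rwa [abs_of_pos hr])
    rw [← h1, Real.circleAverage]
    change ((2 * Real.pi)⁻¹ : ℂ) * ∫ θ in (0)..(2 * Real.pi), Φ (γ θ) = _
    rw [Complex.real_smul]
    push_cast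
    congr 1
    exact intervalIntegral.integral_congr fun θ _ => hΦ _

/-- A holomorphic function that is locally a `k`-th power outside a set that generic lines in some
direction avoid is locally a `k`-th power. -/
lemma exists_pow_eq_of_generic_lines {h : E → ℂ} {p u : E} {S : Set E} {k : ℕ} (hk : k ≠ 0)
    (hh : AnalyticAt ℂ h p) (hu : ∃ᶠ s in 𝓝 (0 : ℂ), h (p + s • u) ≠ 0)
    (hgen : Dense {y | ∀ s : ℂ, y + s • u ∉ S})
    (hS : ∀ᶠ x in 𝓝 p, x ∉ S → ∃ β : E → ℂ, AnalyticAt ℂ β x ∧ h =ᶠ[𝓝 x] β ^ k) :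
    ∃ g : E → ℂ, AnalyticAt ℂ g p ∧ ∀ᶠ y in 𝓝 p, g y ^ k = h y := by
  have hk0 : (k : ℂ) ≠ 0 := by exact_mod_cast hk
  -- The radius `ρ` is independent of the compact space, so the circle may be chosen afterwards,
  -- small enough for `ρ`.
  obtain ⟨ρ, hρ, hA⟩ := exists_analytic_postcomp hh
  obtain ⟨ρ', hρ', hB⟩ := exists_analytic_postcomp (𝕜 := ℂ) (f := fun z : ℂ => z ^ ((k : ℂ)⁻¹))
    (x := 1) (analyticAt_id.cpow analyticAt_const (by simp))
  obtain ⟨R, hR, hR0, hRW⟩ := exists_radius hh hu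
    (W := ball p ρ ∩ {x | AnalyticAt ℂ h x ∧
      (x ∉ S → ∃ β : E → ℂ, AnalyticAt ℂ β x ∧ h =ᶠ[𝓝 x] β ^ k)})
    (inter_mem (ball_mem_nhds p hρ) (hh.eventually_analyticAt.and hS))
  -- Roots will be found on the open disc of radius `R`; a smaller circle keeps them continuous up
  -- to the boundary.
  set r := R / 2 with hr_def
  have hr : 0 < r := half_pos hR
  have hrR : r < R := half_lt_self hR
  set K := sphere (0 : ℂ) r
  have hnK : ∀ s : K, ‖(s : ℂ)‖ = r := fun s => mem_sphere_zero_iff_norm.1 s.2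
  obtain ⟨A, hA⟩ := hA K
  obtain ⟨B, hB⟩ := hB K
  obtain ⟨Λ, hΛ⟩ := exists_circle_mean hr
  let cst : E →L[ℂ] C(K, E) := LinearMap.mkContinuous
    { toFun := fun y => ContinuousMap.const K y
      map_add' := fun _ _ => rfl
      map_smul' := fun _ _ => rfl } 1 (fun y => by
        rw [one_mul, ContinuousMap.norm_le _ (norm_nonneg _)]; intro s; exact le_rfl)
  let e : E → C(K, E) := fun y => cst y + ⟨fun s => (s : ℂ) • u, by fun_prop⟩
  have he : ∀ y s, e y s = y + (s : ℂ) • u := fun _ _ => rfl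
  have hea : AnalyticAt ℂ e p := (cst.analyticAt p).add analyticAt_const
  have hep : ‖e p - ContinuousMap.const K p‖ < ρ := by
    rw [ContinuousMap.norm_lt_iff _ hρ]
    intro s
    have := (hRW.self_of_nhds s ((hnK s).trans_le hrR.le)).1
    rw [mem_ball, dist_eq_norm] at this
    exact this
  have heρ : ∀ᶠ y in 𝓝 p, ‖e y - ContinuousMap.const K p‖ < ρ :=
    (hea.continuousAt.sub continuousAt_const).norm.eventually_lt_const hep
  let V : E → C(K, ℂ) := fun y => A (e y)
  have hVa : AnalyticAt ℂ V p := (hA _ hep).1.comp hea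
  have hV : ∀ᶠ y in 𝓝 p, ∀ s : K, V y s = h (y + (s : ℂ) • u) :=
    heρ.mono fun y hy s => (hA _ hy).2 s
  have hVp0 : ∀ s : K, V p s ≠ 0 := fun s => by
    rw [hV.self_of_nhds s]
    refine hR0 s ((hnK s).trans_le hrR.le) ?_
    intro hs
    have := hnK s
    rw [hs, norm_zero] at this
    exact hr.ne this
  -- Dividing by the values over `p` brings the boundary function near 1, where the principal `k`-th
  -- root is analytic; `T y` is that root.
  let Vi : C(K, ℂ) := ⟨fun s => (V p s)⁻¹, (V p).continuous.inv₀ hVp0⟩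
  let W : E → C(K, ℂ) := fun y => V y * Vi
  have hWa : AnalyticAt ℂ W p := hVa.mul analyticAt_const
  have hWp : W p = ContinuousMap.const K 1 := by
    ext s
    exact mul_inv_cancel₀ (hVp0 s)
  have hWpn : ‖W p - ContinuousMap.const K 1‖ < ρ' := by rw [hWp, sub_self, norm_zero]; exact hρ'
  have hWρ : ∀ᶠ y in 𝓝 p, ‖W y - ContinuousMap.const K 1‖ < ρ' :=
    (hWa.continuousAt.sub continuousAt_const).norm.eventually_lt_const hWpn
  let T : E → C(K, ℂ) := fun y => B (W y)
  have hTa : AnalyticAt ℂ T p := (hB _ hWpn).1.comp hWa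
  have hT : ∀ᶠ y in 𝓝 p, ∀ s : K, T y s ^ k * V p s = h (y + (s : ℂ) • u) := by
    filter_upwards [hV, hWρ] with y hy hyW s
    have h1 : T y s = (W y s) ^ ((k : ℂ)⁻¹) := (hB _ hyW).2 s
    rw [h1, Complex.cpow_nat_inv_pow _ hk, ← hy]
    change V y s * (V p s)⁻¹ * V p s = V y s
    rw [mul_assoc, inv_mul_cancel₀ (hVp0 s), mul_one]
  have hT0 : ∀ᶠ y in 𝓝 p, ∀ s : K, T y s ≠ 0 := by
    obtain ⟨m, hm, hmy⟩ := exists_forall_sphere_le (J := h) (p := p) (u := u) (r := r)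
      (fun s hs => ((hRW.self_of_nhds s ((hnK ⟨s, hs⟩).trans_le hrR.le)).2.1).continuousAt)
      (fun s hs => by
        have := hVp0 ⟨s, hs⟩
        rwa [hV.self_of_nhds] at this)
    filter_upwards [hT, hmy] with y hy hym s hs
    have h1 := hym s s.2
    rw [← hy s, hs, zero_pow hk, zero_mul, norm_zero] at h1
    exact absurd h1 (not_le.2 hm)
  -- roots on the discs over generic points
  have hroot : ∀ᶠ y in 𝓝 p, (∀ s : ℂ, y + s • u ∉ S) → ∃ f : ℂ → ℂ,
      DiffContOnCl ℂ f (ball 0 r) ∧ f 0 ^ k = h y ∧ ContinuousOn f (sphere 0 r) ∧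
        ∀ s : K, f s ^ k = h (y + (s : ℂ) • u) := by
    filter_upwards [hRW, hT, hT0] with y hy hyT hyT0 hgy
    have hq1 : AnalyticOnNhd ℂ (fun s : ℂ => h (y + s • u)) (closedBall 0 R) := fun s hs => by
      rw [mem_closedBall_zero_iff] at hs
      exact AnalyticAt.comp_of_eq (g := h) (f := fun s : ℂ => y + s • u) (hy s hs).2.1
        (by fun_prop) rfl
    have hq2 : ∃ s ∈ closedBall (0 : ℂ) R, h (y + s • u) ≠ 0 := by
      have hs : ‖(r : ℂ)‖ = r := by rw [Complex.norm_real, Real.norm_eq_abs, abs_of_pos hr]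
      refine ⟨(r : ℂ), ?_, ?_⟩
      · rw [mem_closedBall_zero_iff, hs]
        exact hrR.le
      · rw [← hyT ⟨r, mem_sphere_zero_iff_norm.2 hs⟩]
        exact mul_ne_zero (pow_ne_zero _ (hyT0 _)) (hVp0 _)
    obtain ⟨f, hfd, hfk⟩ := exists_differentiableOn_pow_eq hk hq1 hq2 fun s hs => by
      rw [mem_closedBall_zero_iff] at hs
      obtain ⟨β, hβ, hhβ⟩ := (hy s hs).2.2 (hgy s)
      refine ⟨fun s => β (y + s • u), AnalyticAt.comp_of_eq (g := β) (f := fun s : ℂ => y + s • u)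
        hβ (by fun_prop) rfl, ?_⟩
      have hcont : ContinuousAt (fun s : ℂ => y + s • u) s := by fun_prop
      exact hcont.eventually hhβ
    have hsub : closedBall (0 : ℂ) r ⊆ ball 0 R := closedBall_subset_ball hrR
    refine ⟨f, ?_, ?_, (hfd.continuousOn.mono hsub).mono sphere_subset_closedBall, fun s => ?_⟩
    · apply DifferentiableOn.diffContOnCl
      rw [closure_ball _ hr.ne']
      exact hfd.mono hsub
    · have := hfk 0 (mem_ball_self hR)
      simpa using this
    · exact hfk s (hsub (sphere_subset_closedBall s.2))
  obtain ⟨y₀, hgy₀, hry₀, hTy₀, hTy₀0⟩ : ∃ y₀, (∀ s : ℂ, y₀ + s • u ∉ S) ∧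
      ((∀ s : ℂ, y₀ + s • u ∉ S) → ∃ f : ℂ → ℂ,
      DiffContOnCl ℂ f (ball 0 r) ∧ f 0 ^ k = h y₀ ∧ ContinuousOn f (sphere 0 r) ∧
        ∀ s : K, f s ^ k = h (y₀ + (s : ℂ) • u)) ∧
      (∀ s : K, T y₀ s ^ k * V p s = h (y₀ + (s : ℂ) • u)) ∧ ∀ s : K, T y₀ s ≠ 0 := by
    have hfr : ∃ᶠ y in 𝓝 p, ∀ s : ℂ, y + s • u ∉ S := mem_closure_iff_frequently.1 (hgen p)
    exact (hfr.and_eventually (hroot.and (hT.and hT0))).exists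
  obtain ⟨f₀, -, -, hf₀c, hf₀⟩ := hry₀ hgy₀
  -- A continuous `k`-th root of `V p` need not exist for an arbitrary function on a circle. Here
  -- one is obtained from the root on the disc over a single generic `y₀`.
  let c : C(K, ℂ) := ⟨fun s => f₀ s * (T y₀ s)⁻¹,
    (hf₀c.comp_continuous continuous_subtype_val fun s => s.2).mul
      ((T y₀).continuous.inv₀ hTy₀0)⟩
  have hc : ∀ s : K, c s ^ k = V p s := fun s => by
    change (f₀ s * (T y₀ s)⁻¹) ^ k = V p s
    rw [mul_pow, hf₀ s, ← hTy₀ s, inv_pow, mul_comm (T y₀ s ^ k), mul_assoc,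
      mul_inv_cancel₀ (pow_ne_zero _ (hTy₀0 s)), mul_one]
  have hc0 : ∀ s : K, c s ≠ 0 := fun s hs => by
    have := hc s
    rw [hs, zero_pow hk] at this
    exact hVp0 s this.symm
  -- `c * T y` is a `k`-th root on the circle that depends analytically on `y`. When it extends
  -- holomorphically to the disc, its mean is the root at the centre.
  let g : E → ℂ := fun y => Λ (c * T y)
  have hga : AnalyticAt ℂ g p := (Λ.analyticAt _).comp (analyticAt_const.mul hTa)
  refine ⟨g, hga, ?_⟩
  have hKne : (sphere (0 : ℂ) r).Nonempty := NormedSpace.sphere_nonempty.2 hr.le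
  have hKc : PreconnectedSpace K := isPreconnected_iff_preconnectedSpace.1
    (isPreconnected_sphere (by rw [Complex.rank_real_complex]; norm_num) _ _)
  have hgood : ∀ᶠ y in 𝓝 p, (∀ s : ℂ, y + s • u ∉ S) → g y ^ k = h y := by
    filter_upwards [hroot, hT, hT0] with y hyr hyT hyT0 hgy
    obtain ⟨f, hfd, hf0, hfc, hf⟩ := hyr hgy
    -- The quotient of two continuous roots takes values in the `k`-th roots of unity, hence is
    -- constant on the connected circle.
    let w : K → ℂ := fun s => f s / (c s * T y s)
    have hw : Continuous w := (hfc.comp_continuous continuous_subtype_val fun s => s.2).div₀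
      (c.continuous.mul (T y).continuous) fun s => mul_ne_zero (hc0 s) (hyT0 s)
    have hwk : ∀ s, w s ^ k = 1 := fun s => by
      change (f s / (c s * T y s)) ^ k = 1
      rw [div_pow, hf, mul_pow, hc, mul_comm, hyT, div_self]
      rw [← hyT]
      exact mul_ne_zero (pow_ne_zero _ (hyT0 s)) (hVp0 s)
    obtain ⟨s₀⟩ : Nonempty K := hKne.to_subtype
    have hconst : ∀ s, w s = w s₀ := by
      intro s
      have hfin : (Set.range w).Finite := by
        refine ((Polynomial.nthRootsFinset k (1 : ℂ)).finite_toSet).subset ?_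
        rintro _ ⟨s, rfl⟩
        rw [Finset.mem_coe, Polynomial.mem_nthRootsFinset (Nat.pos_of_ne_zero hk)]
        exact hwk s
      exact hfin.countable.isTotallyDisconnected _ subset_rfl (isPreconnected_range hw)
        ⟨s, rfl⟩ ⟨s₀, rfl⟩
    have h1 : Λ (w s₀ • (c * T y)) = f 0 := by
      refine hΛ f _ hfd fun s => ?_
      change w s₀ * (c s * T y s) = f s
      rw [← hconst s]
      exact div_mul_cancel₀ _ (mul_ne_zero (hc0 s) (hyT0 s))
    rw [map_smul, smul_eq_mul] at h1
    have h2 : (w s₀ * g y) ^ k = h y := by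
      rw [← hf0, ← h1]
    rw [mul_pow, hwk, one_mul] at h2
    exact h2
  filter_upwards [hgood.eventually_nhds, hga.eventually_analyticAt, hh.eventually_analyticAt]
    with y hy hgy hhy
  have hfr : ∃ᶠ x in 𝓝 y, ∀ s : ℂ, x + s • u ∉ S := mem_closure_iff_frequently.1 (hgen y)
  have hfr' : ∃ᶠ x in 𝓝 y, g x ^ k - h x = 0 := (hfr.and_eventually hy).mono fun x hx =>
    sub_eq_zero.2 (hx.2 hx.1)
  have hcl : IsClosed ({0} : Set ℂ) := isClosed_singleton
  have hct : ContinuousAt (fun x => g x ^ k - h x) y :=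
    (hgy.continuousAt.pow k).sub hhy.continuousAt
  exact sub_eq_zero.1 (hcl.mem_of_frequently_of_tendsto hfr' hct)

end Lines

/-! ### Germs of analytic functions and generic lines. -/

section Germs

open Metric Filter

variable {E : Type*} [NormedAddCommGroup E] [NormedSpace ℂ E]

/-- The direction points from `p` to a nearby point where `h` is nonzero. The part of this line in a
ball is convex, so vanishing near `p` would spread to that point. -/
lemma exists_direction {h : E → ℂ} {p : E} (hh : AnalyticAt ℂ h p)
    (h0 : ∃ᶠ x in 𝓝 p, h x ≠ 0) : ∃ u : E, ∃ᶠ s in 𝓝 (0 : ℂ), h (p + s • u) ≠ 0 := by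
  obtain ⟨ε, hε, hball⟩ := Metric.eventually_nhds_iff_ball.1 hh.eventually_analyticAt
  obtain ⟨x, hx0, hx⟩ := (h0.and_eventually (ball_mem_nhds p hε)).exists
  refine ⟨x - p, fun hev => hx0 ?_⟩
  set ℓ : ℂ → E := fun s => p + s • (x - p)
  have hℓ : ∀ s, AnalyticAt ℂ ℓ s := fun s => by fun_prop
  have hconv : Convex ℝ (ℓ ⁻¹' ball p ε) := by
    intro s hs t ht a b ha hb hab
    have := convex_ball p ε hs ht ha hb hab
    simp only [Set.mem_preimage]
    convert this using 1
    simp only [ℓ, smul_add, smul_smul, add_smul, ← Complex.coe_smul]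
    have h1 : p = (a : ℂ) • p + (b : ℂ) • p := by
      rw [← add_smul, ← Complex.ofReal_add, hab, Complex.ofReal_one, one_smul]
    nth_rw 1 [h1]
    abel
  have han : AnalyticOnNhd ℂ (fun s => h (ℓ s)) (ℓ ⁻¹' ball p ε) := fun s hs =>
    (hball _ hs).comp (hℓ s)
  have h0mem : (0 : ℂ) ∈ ℓ ⁻¹' ball p ε := by simp [ℓ, hε]
  have h1mem : (1 : ℂ) ∈ ℓ ⁻¹' ball p ε := by simpa [ℓ] using hx
  have := han.eqOn_zero_of_preconnected_of_eventuallyEq_zero hconv.isPreconnected h0mem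
    (hev.mono fun s hs => by simpa using hs) h1mem
  simpa [ℓ] using this

/-- Analytic germs form an integral domain: if `f` is nonzero at a nearby point, `g` vanishes around
it, hence on the whole ball. -/
lemma eventually_eq_zero_or_of_mul {f g : E → ℂ} {p : E} (hf : AnalyticAt ℂ f p)
    (hg : AnalyticAt ℂ g p) (hfg : ∀ᶠ x in 𝓝 p, f x * g x = 0) :
    (∀ᶠ x in 𝓝 p, f x = 0) ∨ ∀ᶠ x in 𝓝 p, g x = 0 := by
  by_contra! hcon
  obtain ⟨hf0, hg0⟩ := hcon
  obtain ⟨ε, hε, hball⟩ := Metric.eventually_nhds_iff_ball.1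
    (hf.eventually_analyticAt.and (hg.eventually_analyticAt.and hfg))
  obtain ⟨x, hx0, hx⟩ := (hf0.and_eventually (ball_mem_nhds p hε)).exists
  have hgx : g =ᶠ[𝓝 x] 0 := by
    filter_upwards [(hball x hx).1.continuousAt.eventually_ne hx0, isOpen_ball.mem_nhds hx]
      with y hy hyb
    exact (mul_eq_zero.1 (hball y hyb).2.2).resolve_left hy
  have hgan : AnalyticOnNhd ℂ g (ball p ε) := fun y hy => (hball y hy).2.1
  have h1 := hgan.eqOn_zero_of_preconnected_of_eventuallyEq_zero (convex_ball p ε).isPreconnected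
    hx hgx
  exact hg0 ((eventually_mem_nhds_iff.2 (ball_mem_nhds p hε)).mono
    fun y hy => not_not.2 (h1 (mem_of_mem_nhds hy)))

lemma exists_eventually_eq_zero_of_prod {ι : Type*} (s : Finset ι) {f : ι → E → ℂ} {p : E}
    (hf : ∀ i ∈ s, AnalyticAt ℂ (f i) p) (hprod : ∀ᶠ x in 𝓝 p, ∏ i ∈ s, f i x = 0) :
    ∃ i ∈ s, ∀ᶠ x in 𝓝 p, f i x = 0 := by
  classical
  induction s using Finset.induction_on with
  | empty => simpa using hprod.self_of_nhds
  | insert i s hi ih =>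
    simp only [Finset.prod_insert hi] at hprod
    rcases eventually_eq_zero_or_of_mul (hf i (by simp))
      (Finset.analyticAt_fun_prod s fun j hj => hf j (by simp [hj])) hprod with h | h
    · exact ⟨i, by simp, h⟩
    · obtain ⟨j, hj, hj'⟩ := ih (fun j hj => hf j (by simp [hj])) h
      exact ⟨j, by simp [hj], hj'⟩

/-- Two holomorphic germs with the same `k`-th power differ by a root of unity. -/
lemma exists_root_of_unity_mul {f g : E → ℂ} {p : E} {k : ℕ} (hk : k ≠ 0) (hf : AnalyticAt ℂ f p)
    (hg : AnalyticAt ℂ g p) (hfg : ∀ᶠ x in 𝓝 p, f x ^ k = g x ^ k) :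
    ∃ ζ : ℂ, ζ ^ k = 1 ∧ ∀ᶠ x in 𝓝 p, f x = ζ * g x := by
  have hpos := Nat.pos_of_ne_zero hk
  have hprod : ∀ᶠ x in 𝓝 p, ∏ ζ ∈ Polynomial.nthRootsFinset k (1 : ℂ), (f x - ζ * g x) = 0 := by
    filter_upwards [hfg] with x hx
    rw [← (Complex.isPrimitiveRoot_exp k hk).pow_sub_pow_eq_prod_sub_mul _ _ hpos, hx, sub_self]
  obtain ⟨ζ, hζ, h⟩ := exists_eventually_eq_zero_of_prod _
    (f := fun ζ x => f x - ζ * g x)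
    (fun ζ _ => hf.sub (analyticAt_const.mul hg)) hprod
  exact ⟨ζ, (Polynomial.mem_nthRootsFinset hpos _).1 hζ, h.mono fun x hx => sub_eq_zero.1 hx⟩

variable [FiniteDimensional ℂ E]

/-- A line with direction `u` meets `V i` only if it lies in `V i + ℂ u`, which is still a proper
subspace because `V i` has codimension at least 2. -/
lemma dense_generic_lines {ι : Type*} [Finite ι] (V : ι → Submodule ℂ E)
    (hV : ∀ i, Module.finrank ℂ (V i) + 1 < Module.finrank ℂ E) (u : E) :
    Dense {y | ∀ s : ℂ, y + s • u ∉ ⋃ i, (V i : Set E)} := by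
  have : CompleteSpace E := FiniteDimensional.complete ℂ E
  let W : ι → Submodule ℂ E := fun i => V i ⊔ ℂ ∙ u
  have hW : ∀ i, W i ≠ ⊤ := by
    intro i hi
    have h1 := Submodule.finrank_add_le_finrank_add_finrank (V i) (ℂ ∙ u)
    have h2 : Module.finrank ℂ (ℂ ∙ u) ≤ 1 := by
      simpa using finrank_span_le_card (R := ℂ) ({u} : Set E)
    have h3 : Module.finrank ℂ (W i) = Module.finrank ℂ E := by rw [hi, finrank_top]
    have h4 := hV i
    change Module.finrank ℂ (W i) ≤ _ at h1
    omega
  have hd : Dense (⋂ i, ((W i : Set E))ᶜ) := by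
    refine dense_iInter_of_isOpen (fun i => (W i).closed_of_finiteDimensional.isOpen_compl)
      fun i => ?_
    rw [← interior_eq_empty_iff_dense_compl]
    by_contra hne
    exact hW i ((W i).eq_top_of_nonempty_interior' (Set.nonempty_iff_ne_empty.2 hne))
  refine hd.mono fun y hy s hs => ?_
  obtain ⟨i, hi⟩ := Set.mem_iUnion.1 hs
  refine Set.mem_iInter.1 hy i ?_
  have h1 : y = (y + s • u) + (-s) • u := by module
  rw [h1]
  exact Submodule.add_mem_sup hi (Submodule.smul_mem _ _ (Submodule.mem_span_singleton_self u))

end Germs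

/-! ### Jacobian determinants and local inverses. -/

section Jacobian

variable {n : Type*} [Fintype n]

/-- The Jacobian determinant. -/
def jac (f : (n → ℂ) → (n → ℂ)) (x : n → ℂ) : ℂ :=
  LinearMap.det (fderiv ℂ f x : (n → ℂ) →ₗ[ℂ] (n → ℂ))

lemma analyticAt_jac {f : (n → ℂ) → (n → ℂ)} {x : n → ℂ} (hf : AnalyticAt ℂ f x) :
    AnalyticAt ℂ (jac f) x := by
  classical
  have h1 : jac f = fun y => ∑ σ : Equiv.Perm n, ((Equiv.Perm.sign σ : ℤ) : ℂ) *
      ∏ i, fderiv ℂ f y (Pi.single i 1) (σ i) := by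
    ext y
    rw [jac, ← LinearMap.det_toMatrix', Matrix.det_apply']
    simp [LinearMap.toMatrix'_apply]
  rw [h1]
  refine Finset.analyticAt_fun_sum _ fun σ _ => analyticAt_const.mul
    (Finset.analyticAt_fun_prod _ fun i _ => ?_)
  let L : ((n → ℂ) →L[ℂ] (n → ℂ)) →L[ℂ] (n → ℂ) := ContinuousLinearMap.apply ℂ _ (Pi.single i 1)
  have h2 : AnalyticAt ℂ (fun y => fderiv ℂ f y (Pi.single i 1)) x :=
    (L.analyticAt _).comp hf.fderiv
  exact (analyticAt_pi_iff.1 h2) (σ i)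

lemma jac_ne_zero_of_leftInverse {f g : (n → ℂ) → (n → ℂ)} {x : n → ℂ} (hf : AnalyticAt ℂ f x)
    (hg : AnalyticAt ℂ g (f x)) (hgf : ∀ᶠ y in 𝓝 x, g (f y) = y) : jac f x ≠ 0 := by
  have h1 : fderiv ℂ (fun y => g (f y)) x = ContinuousLinearMap.id ℂ _ := by
    rw [Filter.EventuallyEq.fderiv_eq (f := fun y => y) hgf]
    exact fderiv_id
  have h2 : fderiv ℂ (fun y => g (f y)) x = (fderiv ℂ g (f x)).comp (fderiv ℂ f x) :=
    fderiv_comp x hg.differentiableAt hf.differentiableAt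
  have h3 : LinearMap.det ((fderiv ℂ g (f x)).comp (fderiv ℂ f x) : (n → ℂ) →ₗ[ℂ] (n → ℂ)) = 1 := by
    rw [← h2, h1]
    simp
  have h4 : LinearMap.det (fderiv ℂ g (f x) : (n → ℂ) →ₗ[ℂ] (n → ℂ)) * jac f x = 1 := by
    rw [jac, ← LinearMap.det_comp]
    exact h3
  exact right_ne_zero_of_mul_eq_one h4

/-- The inverse function theorem. -/
lemma exists_local_inverse {f : (n → ℂ) → (n → ℂ)} {x : n → ℂ} (hf : AnalyticAt ℂ f x)
    (h0 : jac f x ≠ 0) : ∃ e : OpenPartialHomeomorph (n → ℂ) (n → ℂ),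
      x ∈ e.source ∧ ⇑e = f ∧ AnalyticAt ℂ e.symm (f x) ∧
        ∃ i : (n → ℂ) ≃L[ℂ] (n → ℂ), fderiv ℂ f x = i := by
  let i := (fderiv ℂ f x).toContinuousLinearEquivOfDetNeZero h0
  have hi : fderiv ℂ f x = (i : (n → ℂ) →L[ℂ] (n → ℂ)) :=
    ((fderiv ℂ f x).coe_toContinuousLinearEquivOfDetNeZero h0).symm
  have hs : HasStrictFDerivAt f (i : (n → ℂ) →L[ℂ] (n → ℂ)) x := hi ▸ hf.hasStrictFDerivAt
  refine ⟨hs.toOpenPartialHomeomorph f, hs.mem_toOpenPartialHomeomorph_source,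
    hs.toOpenPartialHomeomorph_coe, ?_, i, hi⟩
  have h1 := (hs.toOpenPartialHomeomorph f).analyticAt_symm' (i := i)
    hs.mem_toOpenPartialHomeomorph_source
  rw [hs.toOpenPartialHomeomorph_coe] at h1
  exact h1 hf hi

end Jacobian

/-! ### Quotients by finite linear groups and isomorphisms between them. -/

section LinearQuotient

open Metric Filter
open scoped Matrix

variable {d : ℕ} {G G' : Subgroup (Matrix.GeneralLinearGroup (Fin d) ℂ)}

lemma linearMk_eq_iff {v w : Fin d → ℂ} :
    linearMk G v = linearMk G w ↔ ∃ g ∈ G, w = g.1 *ᵥ v :=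
  Quotient.eq (r := linearSetoid G)

lemma linearMk_mulVec {g : Matrix.GeneralLinearGroup (Fin d) ℂ} (hg : g ∈ G) (v : Fin d → ℂ) :
    linearMk G (g.1 *ᵥ v) = linearMk G v :=
  (linearMk_eq_iff.2 ⟨g, hg, rfl⟩).symm

lemma linearMk_surjective : Function.Surjective (linearMk G) := Quotient.exists_rep

lemma continuous_linearMk : Continuous (linearMk G) := continuous_quotient_mk'

lemma inv_mulVec_mulVec (g : Matrix.GeneralLinearGroup (Fin d) ℂ) (v : Fin d → ℂ) :
    (g⁻¹).1 *ᵥ (g.1 *ᵥ v) = v := by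
  rw [Matrix.mulVec_mulVec, ← Units.val_mul, inv_mul_cancel]; simp

lemma continuous_mulVec (A : Matrix (Fin d) (Fin d) ℂ) : Continuous (A.mulVec) :=
  (Matrix.mulVecLin A).continuous_of_finiteDimensional

lemma analyticAt_mulVec (A : Matrix (Fin d) (Fin d) ℂ) (v : Fin d → ℂ) :
    AnalyticAt ℂ (A.mulVec) v :=
  (LinearMap.toContinuousLinearMap (Matrix.mulVecLin A)).analyticAt v

lemma isOpenMap_linearMk : IsOpenMap (linearMk G) := by
  intro U hU
  have h1 : IsOpen (linearMk G ⁻¹' (linearMk G '' U)) := by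
    have h2 : linearMk G ⁻¹' (linearMk G '' U) = ⋃ g ∈ G, (fun v => g.1 *ᵥ v) ⁻¹' U := by
      ext v
      simp only [Set.mem_preimage, Set.mem_image, Set.mem_iUnion]
      constructor
      · rintro ⟨w, hw, hwv⟩
        obtain ⟨g, hg, rfl⟩ := linearMk_eq_iff.1 hwv
        exact ⟨g⁻¹, inv_mem hg, by rwa [inv_mulVec_mulVec]⟩
      · rintro ⟨g, hg, hw⟩
        exact ⟨_, hw, linearMk_mulVec hg v⟩
    rw [h2]
    exact isOpen_biUnion fun g _ => hU.preimage (continuous_mulVec g.1)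
  exact h1

lemma LinearQuotient.HolAt.congr {h h' : LinearQuotient G → ℂ} {x : LinearQuotient G}
    (hh : HolAt G h x) (hev : h' =ᶠ[𝓝 x] h) : HolAt G h' x := by
  rintro v rfl
  exact (hh v rfl).congr ((continuous_linearMk.continuousAt.eventually hev).mono
    fun w hw => hw.symm)

/-- The points with nontrivial stabilizer. -/
def fixedLocus (G : Subgroup (Matrix.GeneralLinearGroup (Fin d) ℂ)) : Set (Fin d → ℂ) :=
  {v | ∃ g ∈ G, g ≠ 1 ∧ g.1 *ᵥ v = v}

/-- The fixed space is not everything since `g ≠ 1`, and smallness excludes hyperplanes. This is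
where smallness becomes codimension at least 2. -/
lemma IsFiniteSmall.finrank_lt (hG : IsFiniteSmall G) {g : Matrix.GeneralLinearGroup (Fin d) ℂ}
    (hg : g ∈ G) (h1 : g ≠ 1) : Module.finrank ℂ
      (Module.End.eigenspace (Matrix.toLin' (g : Matrix (Fin d) (Fin d) ℂ)) 1) + 1 < d := by
  have h2 := hG.2 g hg
  set V := Module.End.eigenspace (Matrix.toLin' (g : Matrix (Fin d) (Fin d) ℂ)) 1
  have h3 : V ≠ ⊤ := by
    intro htop
    apply h1
    ext1
    apply (Matrix.toLin' (R := ℂ)).injective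
    ext1 x
    ext1
    have hx : (LinearMap.single ℂ (fun _ => ℂ) x 1) ∈ V := by rw [htop]; trivial
    have := Module.End.mem_eigenspace_iff.1 hx
    simpa using this
  have h4 := Submodule.finrank_lt h3
  simp only [Module.finrank_fin_fun] at h4
  omega

lemma IsFiniteSmall.dense_generic_lines (hG : IsFiniteSmall G) (u : Fin d → ℂ) :
    Dense {y | ∀ s : ℂ, y + s • u ∉ fixedLocus G} := by
  have := hG.1
  let V : {g : G // g ≠ 1} → Submodule ℂ (Fin d → ℂ) := fun g =>
    Module.End.eigenspace (Matrix.toLin' (g.1.1 : Matrix (Fin d) (Fin d) ℂ)) 1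
  refine (ToricHyp.dense_generic_lines V (fun g => ?_) u).mono fun y hy s hs => ?_
  · rw [Module.finrank_fin_fun]
    exact hG.finrank_lt g.1.2 fun h => g.2 (Subtype.ext h)
  · obtain ⟨g, hg, hg1, hgy⟩ := hs
    refine hy s (Set.mem_iUnion.2 ⟨⟨⟨g, hg⟩, fun h => hg1 (congrArg Subtype.val h)⟩, ?_⟩)
    rw [SetLike.mem_coe, Module.End.mem_eigenspace_iff]
    simpa using hgy

lemma IsFiniteSmall.dense_compl_fixedLocus (hG : IsFiniteSmall G) : Dense (fixedLocus G)ᶜ :=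
  (hG.dense_generic_lines 0).mono fun y hy => by simpa using hy 0

lemma IsFiniteSmall.frequently_notMem (hG : IsFiniteSmall G) (p : Fin d → ℂ) :
    ∃ᶠ x in 𝓝 p, x ∉ fixedLocus G :=
  mem_closure_iff_frequently.1 (hG.dense_compl_fixedLocus p)

/-- The zero set of one equation is empty or of codimension at most 1, so it cannot hide inside the
fixed locus. -/
lemma IsFiniteSmall.ne_zero (hG : IsFiniteSmall G) {J : (Fin d → ℂ) → ℂ} {p : Fin d → ℂ}
    (hJ : AnalyticAt ℂ J p) (hS : ∀ᶠ x in 𝓝 p, x ∉ fixedLocus G → J x ≠ 0) : J p ≠ 0 := by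
  obtain ⟨u, hu⟩ := exists_direction hJ
    (((hG.frequently_notMem p).and_eventually hS).mono fun x hx => hx.2 hx.1)
  exact ne_zero_of_generic_lines hJ hu (mem_closure_iff_frequently.1 (hG.dense_generic_lines u p)) hS

/-- This replaces the usual argument that the complement of a locus of codimension 2 is locally
simply connected. -/
lemma IsFiniteSmall.exists_pow_eq (hG : IsFiniteSmall G) {h : (Fin d → ℂ) → ℂ} {p : Fin d → ℂ}
    {k : ℕ} (hk : k ≠ 0) (hh : AnalyticAt ℂ h p) (h0 : ∃ᶠ x in 𝓝 p, h x ≠ 0)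
    (hS : ∀ᶠ x in 𝓝 p, x ∉ fixedLocus G →
      ∃ β : (Fin d → ℂ) → ℂ, AnalyticAt ℂ β x ∧ h =ᶠ[𝓝 x] β ^ k) :
    ∃ g : (Fin d → ℂ) → ℂ, AnalyticAt ℂ g p ∧ ∀ᶠ y in 𝓝 p, g y ^ k = h y := by
  obtain ⟨u, hu⟩ := exists_direction hh h0
  exact exists_pow_eq_of_generic_lines hk hh hu (hG.dense_generic_lines u) hS

/-- Near a point with trivial stabilizer, the quotient map has a holomorphic section. -/
lemma exists_section (hG : Finite G) {a : Fin d → ℂ} (ha : a ∉ fixedLocus G) :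
    ∃ (s : LinearQuotient G → Fin d → ℂ) (V : Set (Fin d → ℂ)), IsOpen V ∧ a ∈ V ∧
      ∀ v ∈ V, s (linearMk G v) = v ∧
        ∀ i, LinearQuotient.HolAt G (fun x => s x i) (linearMk G v) := by
  -- Two points close enough to `a` are never exchanged by a nontrivial element, so the quotient map
  -- is injective near `a`.
  have h1 : ∀ᶠ q : (Fin d → ℂ) × (Fin d → ℂ) in 𝓝 (a, a), ∀ g : G, g ≠ 1 →
      g.1.1 *ᵥ q.1 ≠ q.2 := by
    refine Filter.eventually_all.2 fun g => ?_
    by_cases hg : g = 1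
    · simp [hg]
    · have hga : g.1.1 *ᵥ a ≠ a := fun h => ha ⟨g.1, g.2, fun h' => hg (Subtype.ext h'), h⟩
      have hc : ContinuousAt (fun q : (Fin d → ℂ) × (Fin d → ℂ) => g.1.1 *ᵥ q.1 - q.2) (a, a) :=
        (((continuous_mulVec g.1.1).comp continuous_fst).sub continuous_snd).continuousAt
      refine (hc.eventually_ne (sub_ne_zero.2 hga)).mono fun q hq _ => sub_ne_zero.1 hq
  rw [nhds_prod_eq] at h1
  obtain ⟨W, hW, hWG⟩ := (eventually_prod_self_iff (r := fun v w => ∀ g : G, g ≠ 1 →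
    g.1.1 *ᵥ v ≠ w)).1 h1
  obtain ⟨V, hVW, hVo, haV⟩ := _root_.mem_nhds_iff.1 hW
  have hV : ∀ v ∈ V, ∀ w ∈ V, linearMk G v = linearMk G w → v = w := by
    intro v hv w hw hvw
    obtain ⟨g, hg, rfl⟩ := linearMk_eq_iff.1 hvw
    by_cases hg1 : (⟨g, hg⟩ : G) = 1
    · have : g = 1 := congrArg Subtype.val hg1
      simp [this]
    · exact absurd rfl (hWG _ (hVW hv) _ (hVW hw) ⟨g, hg⟩ hg1)
  classical
  let s : LinearQuotient G → Fin d → ℂ := fun x =>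
    if h : ∃ v ∈ V, linearMk G v = x then h.choose else 0
  have hs : ∀ v ∈ V, s (linearMk G v) = v := by
    intro v hv
    have h : ∃ w ∈ V, linearMk G w = linearMk G v := ⟨v, hv, rfl⟩
    simp only [s, dif_pos h]
    exact hV _ h.choose_spec.1 _ hv h.choose_spec.2
  refine ⟨s, V, hVo, haV, fun v hv => ⟨hs v hv, fun i w hw => ?_⟩⟩
  obtain ⟨g, hg, rfl⟩ := linearMk_eq_iff.1 hw
  have h2 : (fun w => s (linearMk G w) i) =ᶠ[𝓝 w] fun w => (g.1 *ᵥ w) i := by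
    filter_upwards [((continuous_mulVec g.1).continuousAt (x := w)).eventually (hVo.mem_nhds hv)]
      with x hx
    rw [← linearMk_mulVec hg x, hs _ hx]
  exact ((analyticAt_pi_iff.1 (analyticAt_mulVec g.1 w)) i).congr h2.symm

/-- A local homeomorphism between linear quotients that identifies the holomorphic functions. -/
def IsHolIso (θ : OpenPartialHomeomorph (LinearQuotient G) (LinearQuotient G')) : Prop :=
  ∀ x ∈ θ.source, ∀ q : LinearQuotient G' → ℂ,
    LinearQuotient.HolAt G' q (θ x) ↔ LinearQuotient.HolAt G (fun y => q (θ y)) x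

variable {θ : OpenPartialHomeomorph (LinearQuotient G) (LinearQuotient G')}

lemma IsHolIso.symm (hθ : IsHolIso θ) : IsHolIso θ.symm := by
  intro y hy q
  have h1 := hθ (θ.symm y) (θ.map_target hy) (fun x => q (θ.symm x))
  rw [θ.right_inv hy] at h1
  rw [h1]
  have h2 : (fun x => q (θ.symm (θ x))) =ᶠ[𝓝 (θ.symm y)] q := by
    filter_upwards [θ.open_source.mem_nhds (θ.map_target hy)] with x hx
    rw [θ.left_inv hx]
  exact ⟨fun h => h.congr h2, fun h => h.congr h2.symm⟩

/-- Lifting a germ isomorphism at a point where the target group acts freely. -/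
lemma IsHolIso.exists_lift (hθ : IsHolIso θ) (hG' : Finite G') {a b : Fin d → ℂ}
    (ha : linearMk G a ∈ θ.source) (hab : θ (linearMk G a) = linearMk G' b)
    (hb : b ∉ fixedLocus G') :
    ∃ β : (Fin d → ℂ) → (Fin d → ℂ), AnalyticAt ℂ β a ∧ β a = b ∧
      (∀ᶠ x in 𝓝 a, linearMk G' (β x) = θ (linearMk G x)) ∧
      (∀ᶠ y in 𝓝 b, ∀ x, θ (linearMk G x) = linearMk G' y → β x = y) ∧
      ∀ x x', linearMk G x = linearMk G x' → β x = β x' := by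
  obtain ⟨s, V, hVo, hbV, hV⟩ := exists_section hG' hb
  refine ⟨fun x => s (θ (linearMk G x)), ?_, ?_, ?_, ?_, fun x x' h => congrArg (fun y => s (θ y)) h⟩
  · rw [analyticAt_pi_iff]
    intro i
    have h1 := (hV b hbV).2 i
    rw [← hab, hθ _ ha] at h1
    exact h1 a rfl
  · change s (θ (linearMk G a)) = b
    rw [hab, (hV b hbV).1]
  · have h1 : linearMk G' '' V ∈ 𝓝 (θ (linearMk G a)) := by
      rw [hab]
      exact (isOpenMap_linearMk V hVo).mem_nhds ⟨b, hbV, rfl⟩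
    have h2 : ContinuousAt (fun x => θ (linearMk G x)) a :=
      ContinuousAt.comp (g := θ) (θ.continuousAt ha) continuous_linearMk.continuousAt
    filter_upwards [h2.preimage_mem_nhds h1] with x hx
    obtain ⟨v, hv, hvx⟩ := hx
    simp only at hvx
    rw [← hvx, (hV v hv).1]
  · filter_upwards [hVo.mem_nhds hbV] with y hy x hx
    rw [hx, (hV y hy).1]

/-- A germ isomorphism preserves the points with trivial stabilizer. -/
lemma IsHolIso.notMem_fixedLocus (hθ : IsHolIso θ) (hG : Finite G) (hG' : IsFiniteSmall G')
    {a b : Fin d → ℂ} (ha : linearMk G a ∈ θ.source) (hab : θ (linearMk G a) = linearMk G' b)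
    (haG : a ∉ fixedLocus G) : b ∉ fixedLocus G' := by
  have hb : linearMk G' b ∈ θ.symm.source := by rw [← hab]; exact θ.map_source ha
  have hba : θ.symm (linearMk G' b) = linearMk G a := by rw [← hab, θ.left_inv ha]
  obtain ⟨π, hπ, hπb, hπθ, -, hπG⟩ := hθ.symm.exists_lift hG hb hba haG
  have hsrc : ∀ᶠ y in 𝓝 b, linearMk G' y ∈ θ.target :=
    continuous_linearMk.continuousAt.eventually (θ.open_target.mem_nhds hb)
  -- Where `G'` acts freely, a local lift of `θ` inverts `π`; the Jacobian of `π` is therefore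
  -- nonzero off the fixed locus, hence at `b`.
  have hJ : jac π b ≠ 0 := by
    refine hG'.ne_zero (analyticAt_jac hπ) ?_
    filter_upwards [hπ.eventually_analyticAt, hπθ.eventually_nhds, hsrc.eventually_nhds]
      with y hy hyθ hys hyG
    have h1 : linearMk G (π y) ∈ θ.source := by
      rw [hyθ.self_of_nhds]; exact θ.map_target hys.self_of_nhds
    have h2 : θ (linearMk G (π y)) = linearMk G' y := by
      rw [hyθ.self_of_nhds, θ.right_inv hys.self_of_nhds]
    obtain ⟨β, hβ, -, -, hββ, -⟩ := hθ.exists_lift hG'.1 h1 h2 hyG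
    refine jac_ne_zero_of_leftInverse hy hβ ?_
    filter_upwards [hyθ, hys, hββ] with z hz hzs hzβ
    exact hzβ _ (by rw [hz, θ.right_inv hzs])
  obtain ⟨e, hbe, heπ, -⟩ := exists_local_inverse hπ hJ
  rintro ⟨g, hg, hg1, hgb⟩
  have h1 : ∀ᶠ y in 𝓝 b, y ∈ e.source := e.open_source.mem_nhds hbe
  have h2 : ∀ᶠ y in 𝓝 b, g.1 *ᵥ y ∈ e.source := by
    have := (continuous_mulVec g.1).continuousAt (x := b)
    rw [ContinuousAt, hgb] at this
    exact this.eventually h1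
  -- `π` is injective near `b` but constant on `G'`-orbits, so an element fixing `b` would fix every
  -- nearby point, even those with trivial stabilizer.
  obtain ⟨y, hyG, hy1, hy2⟩ := ((hG'.frequently_notMem b).and_eventually (h1.and h2)).exists
  refine hyG ⟨g, hg, hg1, e.injOn hy2 hy1 ?_⟩
  rw [heπ]
  exact hπG _ _ (linearMk_mulVec hg y)

end LinearQuotient

/-! ### Smoothness of germs under submersions and biholomorphisms. -/

section Smooth

open Filter

variable {ι κ : Type*} [Fintype ι] [Fintype κ]

/-- The inverse image of a smooth germ under a submersion is smooth. -/
lemma IsSmoothAt.of_submersion {S : Set (ι → ℂ)} {T : Set (κ → ℂ)} {ψ : (κ → ℂ) → (ι → ℂ)}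
    {p : κ → ℂ} (hψ : AnalyticAt ℂ ψ p) (hsurj : Function.Surjective (fderiv ℂ ψ p))
    (hS : IsSmoothAt S (ψ p)) (hT : ∀ᶠ z in 𝓝 p, z ∈ T ↔ ψ z ∈ S) : IsSmoothAt T p := by
  obtain ⟨r, H, hH, hHs, hHS⟩ := hS
  refine ⟨r, fun z => H (ψ z), hH.comp hψ, ?_, ?_⟩
  · have h1 : fderiv ℂ (fun z => H (ψ z)) p = (fderiv ℂ H (ψ p)).comp (fderiv ℂ ψ p) :=
      fderiv_comp p hH.differentiableAt hψ.differentiableAt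
    rw [h1]
    exact hHs.comp hsurj
  · filter_upwards [hT, hψ.continuousAt.eventually hHS] with z hz hzS
    rw [hz, hzS]

/-- Smoothness is invariant under biholomorphic germs. -/
lemma IsSmoothAt.image {S T : Set (ι → ℂ)} {ψ : (ι → ℂ) → (ι → ℂ)} {p : ι → ℂ}
    (hS : IsSmoothAt S p) (hψ : AnalyticAt ℂ ψ p) (hj : jac ψ p ≠ 0)
    (hST : ∀ᶠ z in 𝓝 p, z ∈ S ↔ ψ z ∈ T) : IsSmoothAt T (ψ p) := by
  obtain ⟨e, hpe, heψ, hes, -⟩ := exists_local_inverse hψ hj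
  have hsp : e.symm (ψ p) = p := by rw [← heψ, e.left_inv hpe]
  have hpt : ψ p ∈ e.target := by rw [← heψ]; exact e.map_source hpe
  refine IsSmoothAt.of_submersion (ψ := e.symm) (S := S) hes ?_ (by rwa [hsp]) ?_
  · have h1 : fderiv ℂ (fun y => e.symm (ψ y)) p = ContinuousLinearMap.id ℂ _ := by
      have h2 : (fun y => e.symm (ψ y)) =ᶠ[𝓝 p] fun y => y := by
        filter_upwards [e.open_source.mem_nhds hpe] with y hy
        rw [← heψ, e.left_inv hy]
      rw [h2.fderiv_eq]
      exact fderiv_id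
    have h2 : fderiv ℂ (fun y => e.symm (ψ y)) p = (fderiv ℂ e.symm (ψ p)).comp (fderiv ℂ ψ p) :=
      fderiv_comp p hes.differentiableAt hψ.differentiableAt
    intro v
    refine ⟨fderiv ℂ ψ p v, ?_⟩
    have h3 := DFunLike.congr_fun (h2.symm.trans h1) v
    simpa using h3
  · have h1 : Tendsto e.symm (𝓝 (ψ p)) (𝓝 p) := by
      have := hes.continuousAt.tendsto
      rwa [hsp] at this
    filter_upwards [h1.eventually hST, e.open_target.mem_nhds hpt] with z hz hzt
    rw [hz, ← heψ, e.right_inv hzt]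

end Smooth

/-! ### Lifting isomorphisms of quotient germs. -/

section Lift

open Metric Filter
open scoped Matrix

variable {d : ℕ} {G G' : Subgroup (Matrix.GeneralLinearGroup (Fin d) ℂ)}
  {θ : OpenPartialHomeomorph (LinearQuotient G) (LinearQuotient G')}

/-- The pullback to the source of the `k`-th power of a function with invariant `k`-th power. -/
lemma IsHolIso.exists_pullback (hθ : IsHolIso θ) {k : ℕ} {F : (Fin d → ℂ) → ℂ}
    (hF : ∀ x, AnalyticAt ℂ F x) (hFG : ∀ g ∈ G', ∀ v, F (g.1 *ᵥ v) ^ k = F v ^ k) :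
    ∃ h : (Fin d → ℂ) → ℂ, (∀ a, linearMk G a ∈ θ.source → AnalyticAt ℂ h a) ∧
      ∀ a b, θ (linearMk G a) = linearMk G' b → h a = F b ^ k := by
  let q : LinearQuotient G' → ℂ := Quotient.lift (s := linearSetoid G') (fun v => F v ^ k)
    (by rintro v w ⟨g, hg, rfl⟩; exact (hFG g hg v).symm)
  have hq : ∀ v, q (linearMk G' v) = F v ^ k := fun v => rfl
  refine ⟨fun a => q (θ (linearMk G a)), fun a ha => ?_, fun a b hab => ?_⟩
  · refine (hθ _ ha q).1 (fun v _ => ?_) a rfl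
    exact (hF v).pow k
  · change q (θ (linearMk G a)) = _
    rw [hab, hq]

/-- An isomorphism of germs of quotients by small groups, the second one diagonal, is induced by a
biholomorphic germ, up to roots of unity. -/
theorem IsHolIso.exists_biholomorphic (hθ : IsHolIso θ) (hG : IsFiniteSmall G)
    (hG' : IsFiniteSmall G') (h0 : linearMk G 0 ∈ θ.source)
    (h00 : θ (linearMk G 0) = linearMk G' 0) {k : ℕ} (hk : k ≠ 0)
    (hdiag : ∀ g ∈ G', ∀ v i, (g.1 *ᵥ v) i ^ k = v i ^ k) :
    ∃ Ψ : (Fin d → ℂ) → (Fin d → ℂ), AnalyticAt ℂ Ψ 0 ∧ Ψ 0 = 0 ∧ jac Ψ 0 ≠ 0 ∧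
      ∀ F : (Fin d → ℂ) → ℂ, (∀ x, AnalyticAt ℂ F x) →
        (∀ g ∈ G', ∀ v, F (g.1 *ᵥ v) ^ k = F v ^ k) →
        ∀ᶠ a in 𝓝 0, ∀ b, θ (linearMk G a) = linearMk G' b → F (Ψ a) ^ k = F b ^ k := by
  have hpos := Nat.pos_of_ne_zero hk
  have hsrc : ∀ᶠ a in 𝓝 (0 : Fin d → ℂ), linearMk G a ∈ θ.source :=
    continuous_linearMk.continuousAt.eventually (θ.open_source.mem_nhds h0)
  -- lifts at the points with trivial stabilizer
  have hlift : ∀ a, linearMk G a ∈ θ.source → a ∉ fixedLocus G →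
      ∃ β : (Fin d → ℂ) → (Fin d → ℂ), AnalyticAt ℂ β a ∧ jac β a ≠ 0 ∧
        ∀ᶠ x in 𝓝 a, θ (linearMk G x) = linearMk G' (β x) := by
    intro a ha haG
    obtain ⟨b, hb⟩ := linearMk_surjective (θ (linearMk G a))
    have hbG := hθ.notMem_fixedLocus hG.1 hG' ha hb.symm haG
    obtain ⟨β, hβ, hβa, hβθ, -, -⟩ := hθ.exists_lift hG'.1 ha hb.symm hbG
    have hbs : linearMk G' b ∈ θ.symm.source := by rw [hb]; exact θ.map_source ha
    obtain ⟨π, hπ, -, -, hπa, -⟩ := hθ.symm.exists_lift hG.1 hbs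
      (by rw [hb, θ.left_inv ha]) haG
    refine ⟨β, hβ, ?_, hβθ.mono fun x hx => hx.symm⟩
    refine jac_ne_zero_of_leftInverse hβ (by rwa [hβa]) ?_
    have hs : ∀ᶠ x in 𝓝 a, linearMk G x ∈ θ.source :=
      continuous_linearMk.continuousAt.eventually (θ.open_source.mem_nhds ha)
    filter_upwards [hβθ, hπa, hs] with x hx hxπ hxs
    exact hxπ _ (by rw [hx, θ.left_inv hxs])
  choose! h hha hh using fun i : Fin d => hθ.exists_pullback (k := k)
    (F := fun v => v i) (fun x => analyticAt_pi_iff.1 analyticAt_id i) (fun g hg v => hdiag g hg v i)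
  have hYex : ∀ i, ∃ Y : (Fin d → ℂ) → ℂ, AnalyticAt ℂ Y 0 ∧ ∀ᶠ a in 𝓝 0, Y a ^ k = h i a := by
    intro i
    refine hG.exists_pow_eq hk (hha i 0 h0) ?_ ?_
    -- If `h i` vanished identically near 0, a coordinate of a local lift would too, giving its
    -- Jacobian matrix a zero row.
    · intro hev
      obtain ⟨a, haG, hev, ha⟩ := ((hG.frequently_notMem 0).and_eventually
        (hev.eventually_nhds.and hsrc)).exists
      obtain ⟨β, hβ, hβj, hβθ⟩ := hlift a ha haG
      apply hβj
      have h1 : (fun x => β x i) =ᶠ[𝓝 a] fun _ => 0 := by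
        filter_upwards [hev, hβθ] with x hx hxβ
        have h2 := hh i x _ hxβ
        rw [not_not.1 hx] at h2
        exact eq_zero_of_pow_eq_zero h2.symm
      have h2 : ∀ v, fderiv ℂ β a v i = 0 := by
        intro v
        have h3 : fderiv ℂ (fun x => β x i) a v = fderiv ℂ β a v i := by
          have := hasFDerivAt_pi'.1 hβ.differentiableAt.hasFDerivAt i
          rw [this.fderiv]
          rfl
        rw [← h3, h1.fderiv_eq]
        simp
      rw [jac, ← LinearMap.det_toMatrix']
      refine Matrix.det_eq_zero_of_row_eq_zero i fun j => ?_
      rw [LinearMap.toMatrix'_apply]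
      exact h2 _
    · filter_upwards [hsrc] with a ha haG
      obtain ⟨β, hβ, -, hβθ⟩ := hlift a ha haG
      exact ⟨fun x => β x i, analyticAt_pi_iff.1 hβ i, hβθ.mono fun x hx => hh i x _ hx⟩
  choose Y hYa hY using hYex
  -- At points with trivial stabilizer the roots `Y` agree with the local lift `β` up to a root of
  -- unity in each coordinate.
  have hYroot : ∀ᶠ a in 𝓝 (0 : Fin d → ℂ), a ∉ fixedLocus G → ∃ (β : (Fin d → ℂ) → (Fin d → ℂ))
      (ζ : Fin d → ℂ), AnalyticAt ℂ β a ∧ jac β a ≠ 0 ∧ (∀ i, ζ i ^ k = 1) ∧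
        (∀ᶠ x in 𝓝 a, θ (linearMk G x) = linearMk G' (β x)) ∧
        ∀ᶠ x in 𝓝 a, ∀ i, Y i x = ζ i * β x i := by
    filter_upwards [hsrc, (eventually_all.2 hY).eventually_nhds,
      eventually_all.2 fun i => (hYa i).eventually_analyticAt] with a ha haY haYa haG
    obtain ⟨β, hβ, hβj, hβθ⟩ := hlift a ha haG
    have hroots : ∀ i, ∃ ζ : ℂ, ζ ^ k = 1 ∧ ∀ᶠ x in 𝓝 a, Y i x = ζ * β x i := fun i => by
      refine exists_root_of_unity_mul hk (haYa i) (analyticAt_pi_iff.1 hβ i) ?_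
      filter_upwards [haY, hβθ] with x hx hxβ
      rw [hx i, hh i x _ hxβ]
    choose ζ hζ hYζ using hroots
    exact ⟨β, ζ, hβ, hβj, hζ, hβθ, eventually_all.2 hYζ⟩
  let D : (Fin d → ℂ) → (Fin d → ℂ) →L[ℂ] (Fin d → ℂ) := fun ζ =>
    LinearMap.toContinuousLinearMap (Matrix.toLin' (Matrix.diagonal ζ))
  have hD : ∀ ζ v i, D ζ v i = ζ i * v i := fun ζ v i => by
    simp [D, Matrix.mulVec_diagonal]
  have hDdet : ∀ ζ : Fin d → ℂ, LinearMap.det (D ζ : (Fin d → ℂ) →ₗ[ℂ] (Fin d → ℂ)) =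
      ∏ i, ζ i := fun ζ => by
    simp [D, Matrix.det_diagonal]
  have hjacD : ∀ (ζ : Fin d → ℂ) (β : (Fin d → ℂ) → (Fin d → ℂ)) a, AnalyticAt ℂ β a →
      jac (fun x => D ζ (β x)) a = (∏ i, ζ i) * jac β a := by
    intro ζ β a hβ
    have h1 : fderiv ℂ (fun x => D ζ (β x)) a = (D ζ).comp (fderiv ℂ β a) :=
      ((D ζ).hasFDerivAt.comp a hβ.differentiableAt.hasFDerivAt).fderiv
    rw [jac, h1, ← hDdet, jac, ← LinearMap.det_comp]
    rfl
  have hne : ∀ ζ : ℂ, ζ ^ k = 1 → ζ ≠ 0 := by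
    rintro ζ hζ rfl
    rw [zero_pow hk] at hζ
    exact zero_ne_one hζ
  let Ψ₀ : (Fin d → ℂ) → (Fin d → ℂ) := fun a i => Y i a
  have hΨ₀a : AnalyticAt ℂ Ψ₀ 0 := analyticAt_pi_iff.2 hYa
  have hΨ₀0 : Ψ₀ 0 = 0 := by
    ext i
    have h1 := (hY i).self_of_nhds
    rw [hh i 0 0 h00] at h1
    exact eq_zero_of_pow_eq_zero (h1.trans (by simp [hk]))
  have hΨ₀j : jac Ψ₀ 0 ≠ 0 := by
    refine hG.ne_zero (analyticAt_jac hΨ₀a) ?_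
    filter_upwards [hYroot] with a haY haG
    obtain ⟨β, ζ, hβ, hβj, hζ, -, hYβ⟩ := haY haG
    have h1 : Ψ₀ =ᶠ[𝓝 a] fun x => D ζ (β x) := hYβ.mono fun x hx => by
      ext i
      exact (hx i).trans (hD ζ (β x) i).symm
    have h2 : jac Ψ₀ a = jac (fun x => D ζ (β x)) a := by
      rw [jac, jac, h1.fderiv_eq]
    rw [h2, hjacD _ _ _ hβ]
    exact mul_ne_zero (Finset.prod_ne_zero_iff.2 fun i _ => hne _ (hζ i)) hβj
  obtain ⟨ε, hε, hball⟩ := Metric.eventually_nhds_iff_ball.1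
    (hYroot.and (hsrc.and hΨ₀a.eventually_analyticAt))
  obtain ⟨a, haG, ha⟩ := ((hG.frequently_notMem 0).and_eventually
    (ball_mem_nhds (0 : Fin d → ℂ) hε)).exists
  obtain ⟨β, ζ, hβ, -, hζ, hβθ, hYβ⟩ := (hball a ha).1 haG
  -- The roots of unity are removed at the single point `a`, so that the corrected map is the lift
  -- `β` near `a`. The identity theorem on the ball then propagates every relation between `k`-th
  -- powers to a neighbourhood of 0.
  let ξ : Fin d → ℂ := fun i => (ζ i)⁻¹
  have hDa : ∀ {x}, AnalyticAt ℂ Ψ₀ x → AnalyticAt ℂ (fun x => D ξ (Ψ₀ x)) x := fun hx =>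
    ((D ξ).analyticAt _).comp hx
  refine ⟨fun x => D ξ (Ψ₀ x), hDa hΨ₀a, by simp [hΨ₀0], ?_, fun F hF hFG => ?_⟩
  · rw [hjacD _ _ _ hΨ₀a]
    exact mul_ne_zero (Finset.prod_ne_zero_iff.2 fun i _ => inv_ne_zero (hne _ (hζ i))) hΨ₀j
  · obtain ⟨q, hqa, hq⟩ := hθ.exists_pullback hF hFG
    have h1 : AnalyticOnNhd ℂ (fun x => F (D ξ (Ψ₀ x)) ^ k) (ball 0 ε) := fun x hx =>
      ((hF _).comp (hDa (hball x hx).2.2)).pow k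
    have h2 : AnalyticOnNhd ℂ q (ball 0 ε) := fun x hx => hqa x (hball x hx).2.1
    have h3 : (fun x => F (D ξ (Ψ₀ x)) ^ k) =ᶠ[𝓝 a] q := by
      filter_upwards [hβθ, hYβ] with x hxθ hxβ
      have h4 : D ξ (Ψ₀ x) = β x := by
        ext i
        rw [hD]
        change (ζ i)⁻¹ * Y i x = β x i
        rw [hxβ i, ← mul_assoc, inv_mul_cancel₀ (hne _ (hζ i)), one_mul]
      rw [h4, hq x _ hxθ]
    have h5 := h1.eqOn_of_preconnected_of_eventuallyEq h2 (convex_ball _ _).isPreconnected ha h3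
    filter_upwards [ball_mem_nhds (0 : Fin d → ℂ) hε] with x hx b hb
    exact (h5 hx).trans (hq x b hb)

end Lift

/-! ### Cones of full dimension in a complete fan. -/

section FullCones

variable {N : Type*} [AddCommGroup N]

lemma IsIntegralGenerators.linearIndependent_real {s : Finset N} (hs : IsIntegralGenerators s) :
    LinearIndependent ℝ (fun e : s => (1 : ℝ) ⊗ₜ[ℤ] (e : N)) :=
  Module.Flat.linearIndependent_one_tmul
    (LinearIndependent.comp hs.1 (fun e : s => (⟨e.1, e.2⟩ : (s : Set N)))
      fun _ _ h => Subtype.ext (congrArg Subtype.val h))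

lemma sum_eq_sum_attach (s : Finset N) (μ : N → ℝ) :
    ∑ e ∈ s, μ e • ((1 : ℝ) ⊗ₜ[ℤ] e) = ∑ e : s, μ e • ((1 : ℝ) ⊗ₜ[ℤ] (e : N)) :=
  (Finset.sum_coe_sort s fun e => μ e • ((1 : ℝ) ⊗ₜ[ℤ] e)).symm

lemma cone_subset_span (s : Finset N) :
    cone s ⊆ Submodule.span ℝ (Set.range fun e : s => (1 : ℝ) ⊗ₜ[ℤ] (e : N)) := by
  rintro x ⟨μ, -, rfl⟩
  exact Submodule.sum_mem _ fun e he =>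
    Submodule.smul_mem _ _ (Submodule.subset_span ⟨⟨e, he⟩, rfl⟩)

variable [Module.Free ℤ N] [Module.Finite ℤ N]

/-- In a complete simplicial fan every cone is a face of a cone of full dimension. -/
lemma Fan.exists_full_cone (F : Fan N) {s : Finset N} (hs : s ∈ F.cones) :
    ∃ τ ∈ F.cones, s ⊆ τ ∧ τ.card = Module.finrank ℤ N := by
  classical
  have hfin : Finite F.cones := F.finite_cones
  let V := ℝ ⊗[ℤ] N
  have hV : Module.finrank ℝ V = Module.finrank ℤ N := Module.finrank_baseChange
  let W : F.cones → Submodule ℝ V := fun t =>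
    Submodule.span ℝ (Set.range fun e : t.1 => (1 : ℝ) ⊗ₜ[ℤ] (e : N))
  have hcard : ∀ t : F.cones, Module.finrank ℝ (W t) = t.1.card := fun t => by
    have := finrank_span_eq_card (F.generators t.1 t.2).linearIndependent_real
    rw [this, Fintype.card_coe]
  -- A real vector space is not a finite union of proper subspaces, so some `y` avoids the spans of
  -- all cones of lower dimension.
  obtain ⟨y, hy⟩ : ∃ y : V, ∀ t : F.cones, y ∈ W t → t.1.card = Module.finrank ℤ N := by
    by_contra! hcon
    have hcov : ⋃ t : {t : F.cones // t.1.card ≠ Module.finrank ℤ N}, (W t.1 : Set V) =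
        Set.univ := by
      refine Set.eq_univ_of_forall fun y => ?_
      obtain ⟨t, hyt, ht⟩ := hcon y
      exact Set.mem_iUnion.2 ⟨⟨t, ht⟩, hyt⟩
    obtain ⟨t, ht⟩ := Subspace.exists_eq_top_of_iUnion_eq_univ hcov
    apply t.2
    rw [← hcard, ht, finrank_top, hV]
  -- `x` is in the relative interior of the cone of `s`. By pigeonhole one cone `τ` contains the
  -- perturbations x + y/(n+1) for infinitely many n; two of them put `y` in its span, so `τ` has
  -- full dimension.
  let x : V := ∑ e ∈ s, (1 : ℝ) ⊗ₜ[ℤ] e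
  have hmem : ∀ n : ℕ, ∃ t : F.cones, x + ((n : ℝ) + 1)⁻¹ • y ∈ cone t.1 := by
    intro n
    have h1 : x + ((n : ℝ) + 1)⁻¹ • y ∈ ⋃ t ∈ F.cones, cone t := by
      rw [F.complete]; trivial
    simp only [Set.mem_iUnion] at h1
    obtain ⟨t, ht, h1⟩ := h1
    exact ⟨⟨t, ht⟩, h1⟩
  choose T hT using hmem
  obtain ⟨τ, hτ⟩ := Finite.exists_infinite_fiber T
  have hinf : (T ⁻¹' {τ}).Infinite := Set.infinite_coe_iff.1 hτ
  have hTτ : ∀ n ∈ T ⁻¹' {τ}, x + ((n : ℝ) + 1)⁻¹ • y ∈ cone τ.1 := by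
    intro n hn
    have := hT n
    rwa [show T n = τ from hn] at this
  have hyτ : y ∈ W τ := by
    obtain ⟨n, hn⟩ := hinf.nonempty
    obtain ⟨m, hm, hnm⟩ := hinf.exists_gt n
    have h1 := (W τ).sub_mem (cone_subset_span _ (hTτ n hn)) (cone_subset_span _ (hTτ m hm))
    have h2 : x + ((n : ℝ) + 1)⁻¹ • y - (x + ((m : ℝ) + 1)⁻¹ • y) =
        (((n : ℝ) + 1)⁻¹ - ((m : ℝ) + 1)⁻¹) • y := by module
    rw [h2] at h1
    refine ((W τ).smul_mem_iff ?_).1 h1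
    have hnm' : (n : ℝ) < m := by exact_mod_cast hnm
    have : ((m : ℝ) + 1)⁻¹ < ((n : ℝ) + 1)⁻¹ := by
      apply inv_strictAnti₀ (by positivity); linarith
    exact (sub_pos.2 this).ne'
  have hτd := hy τ hyτ
  refine ⟨τ.1, τ.2, ?_, hτd⟩
  -- coordinates with respect to the generators of `τ`
  have hli := (F.generators τ.1 τ.2).linearIndependent_real
  have : FiniteDimensional ℝ V := inferInstanceAs (Module.Finite ℝ (ℝ ⊗[ℤ] N))
  let b : Module.Basis τ.1 ℝ V := Module.Basis.mk hli (by
    have h1 : W τ = ⊤ := Submodule.eq_top_of_finrank_eq (by rw [hcard, hτd, hV])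
    exact h1.ge)
  have hb : ∀ e, b e = (1 : ℝ) ⊗ₜ[ℤ] (e : N) := fun e => by simp [b]
  have hrepr : ∀ z ∈ cone τ.1, ∀ e, 0 ≤ b.repr z e := by
    rintro z ⟨μ, hμ, rfl⟩ e
    have h1 : ∑ e ∈ τ.1, μ e • ((1 : ℝ) ⊗ₜ[ℤ] e) = ∑ e : τ.1, μ e • b e := by
      rw [sum_eq_sum_attach]
      simp only [hb]
    rw [h1, b.repr_sum_self]
    exact hμ e e.2
  -- The coordinates of the perturbations are nonnegative and converge to those of `x`.
  have hx0 : ∀ e, 0 ≤ b.repr x e := by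
    intro e
    by_contra! hneg
    obtain ⟨n₀, hn₀⟩ := exists_nat_gt (b.repr y e / -b.repr x e)
    obtain ⟨n, hn, hnn⟩ := hinf.exists_gt n₀
    have h1 := hrepr _ (hTτ n hn) e
    rw [map_add, map_smul, Finsupp.add_apply, Finsupp.smul_apply, smul_eq_mul] at h1
    have h2 : (n₀ : ℝ) < n := by exact_mod_cast hnn
    have h3 : b.repr y e < n * -b.repr x e := by
      rw [← div_lt_iff₀ (neg_pos.2 hneg)]; linarith
    have h4 : (0 : ℝ) < (n : ℝ) + 1 := by positivity
    have h5 : ((n : ℝ) + 1) * b.repr x e + b.repr y e ≥ 0 := by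
      have := mul_nonneg h4.le h1
      rwa [mul_add, ← mul_assoc, mul_inv_cancel₀ h4.ne', one_mul] at this
    nlinarith
  have hxτ : x ∈ cone τ.1 := by
    refine ⟨fun e => if h : e ∈ τ.1 then b.repr x ⟨e, h⟩ else 0, fun e he => ?_, ?_⟩
    · simp only [dif_pos he]
      exact hx0 _
    · rw [sum_eq_sum_attach]
      conv_lhs => rw [← b.sum_repr x]
      exact Finset.sum_congr rfl fun e _ => by simp [hb]
  have hxs : x ∈ cone s := ⟨fun _ => 1, fun _ _ => zero_le_one, by simp [x]⟩
  -- The common face `u` contains the relative interior point `x`. A generator of `s` outside `τ`,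
  -- hence outside `u`, would have coefficient 0 as well as 1 in `x`.
  obtain ⟨u, hus, huτ, hu⟩ := F.inter_face s hs τ.1 τ.2
  obtain ⟨μ, -, hμ⟩ : x ∈ cone u := by rw [← hu]; exact ⟨hxs, hxτ⟩
  intro e he
  by_contra heτ
  have heu : e ∉ u := fun h => heτ (huτ h)
  have h1 : ∑ e : s, (if (e : N) ∈ u then μ e else 0) • ((1 : ℝ) ⊗ₜ[ℤ] (e : N)) =
      ∑ e : s, (1 : ℝ) • ((1 : ℝ) ⊗ₜ[ℤ] (e : N)) := by
    rw [← sum_eq_sum_attach s fun e => if e ∈ u then μ e else 0, ← sum_eq_sum_attach s fun _ => 1]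
    simp only [one_smul]
    change _ = x
    rw [hμ, ← Finset.sum_subset hus (fun e _ heu => by simp [heu])]
    exact Finset.sum_congr rfl fun e he => by simp [he]
  have h2 := Fintype.linearIndependent_iff.1 (F.generators s hs).linearIndependent_real
    (fun e => (if (e : N) ∈ u then μ e else 0) - 1) (by
      simp only [sub_smul, Finset.sum_sub_distrib]
      rw [h1, sub_self]) ⟨e, he⟩
  simp [heu] at h2

end FullCones

/-! ### Lattice coordinates with respect to a full-dimensional cone. -/

section Slices

variable {N : Type*} [AddCommGroup N] [Module.Free ℤ N]

lemma exists_eq_nsmul_of_dvd_dual {e : N} {b : ℕ} (h : ∀ m : Module.Dual ℤ N, (b : ℤ) ∣ m e) :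
    ∃ v : N, b • v = e := by
  let B := Module.Free.chooseBasis ℤ N
  choose q hq using fun i => h (B.coord i)
  have hsupp : ∀ i, i ∉ (B.repr e).support → (b : ℤ) * q i = 0 := by
    intro i hi
    rw [← hq, Module.Basis.coord_apply]
    simpa using hi
  refine ⟨∑ i ∈ (B.repr e).support, q i • B i, ?_⟩
  conv_rhs => rw [← B.linearCombination_repr e, Finsupp.linearCombination_apply, Finsupp.sum]
  rw [Finset.smul_sum]
  refine Finset.sum_congr rfl fun i _ => ?_
  rw [← natCast_zsmul, smul_smul, ← hq, Module.Basis.coord_apply]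

/-- Divisibility of all pairings makes `e` divisible by `b` in the lattice, against primitivity.
This will rule out pseudo-reflections in the stabilizers. -/
lemma IsIntegralGenerators.eq_one_of_dvd {s : Finset N} (hs : IsIntegralGenerators s) {e : N}
    (he : e ∈ s) {b : ℕ} (hb : 0 < b) (h : ∀ m : Module.Dual ℤ N, (b : ℤ) ∣ m e) : b = 1 := by
  obtain ⟨v, hv⟩ := exists_eq_nsmul_of_dvd_dual h
  exact Nat.dvd_one.1 (hs.2 e he 1 b hb ⟨v, by rw [hv, one_smul]⟩)

variable [Module.Finite ℤ N]

/-- A multiple of each lattice vector is an integral combination of the generators of a given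
cone of full dimension. -/
lemma IsIntegralGenerators.exists_coords {s : Finset N} (hs : IsIntegralGenerators s)
    (hcard : s.card = Module.finrank ℤ N) : ∃ (k : ℕ) (κ : s → Module.Dual ℤ N), k ≠ 0 ∧
      (∀ v, (k : ℤ) • v = ∑ e, κ e v • (e : N)) ∧
      (∀ e : s, κ e (e : N) = k) ∧ ∀ e e' : s, e ≠ e' → κ e (e' : N) = 0 := by
  classical
  have hli : LinearIndependent ℤ (fun e : s => (e : N)) :=
    LinearIndependent.comp hs.1 (fun e : s => (⟨e.1, e.2⟩ : (s : Set N)))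
      fun _ _ h => Subtype.ext (congrArg Subtype.val h)
  let P := Submodule.span ℤ (Set.range fun e : s => (e : N))
  let B : Module.Basis s ℤ P := Module.Basis.span hli
  have hB : ∀ e, (B e : N) = e := fun e => congrArg Subtype.val (Module.Basis.span_apply hli e)
  have hrank : Module.finrank ℤ P = Module.finrank ℤ N := by
    rw [Module.finrank_eq_card_basis B, Fintype.card_coe, hcard]
  have hfin := P.finiteQuotientOfFreeOfRankEq hrank
  -- The index of the sublattice spanned by the generators; multiplying by it makes rational
  -- coordinates integral.
  let k := Nat.card (N ⧸ P)
  have hkP : ∀ v : N, (k : ℤ) • v ∈ P := fun v => by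
    rw [← Submodule.Quotient.mk_eq_zero, Submodule.Quotient.mk_smul, natCast_zsmul]
    exact card_nsmul_eq_zero'
  let mulk : N →ₗ[ℤ] P := LinearMap.codRestrict P ((k : ℤ) • LinearMap.id) hkP
  have hκ : ∀ e e' : s, B.coord e (mulk (e' : N)) = if e' = e then (k : ℤ) else 0 := by
    intro e e'
    have h1 : mulk (e' : N) = (k : ℤ) • B e' := by
      apply Subtype.ext
      rw [Submodule.coe_smul, hB]
      rfl
    rw [h1, map_smul, Module.Basis.coord_apply, Module.Basis.repr_self, Finsupp.single_apply]
    simp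
  refine ⟨k, fun e => (B.coord e).comp mulk, Nat.card_pos.ne', fun v => ?_, fun e => ?_,
    fun e e' he => ?_⟩
  · have h1 := congrArg Subtype.val (B.sum_repr (mulk v))
    rw [Submodule.coe_sum] at h1
    simp only [Submodule.coe_smul, hB] at h1
    exact h1.symm
  · rw [LinearMap.comp_apply, hκ, if_pos rfl]
  · rw [LinearMap.comp_apply, hκ, if_neg he.symm]

end Slices

/-! ### Slices, the torus action and semi-invariance. -/

section SliceDef

variable {N : Type*} [AddCommGroup N] {F : Fan N}

@[simp] lemma alpha_apply (m : Module.Dual ℤ N) (i : Ray F) : alpha F m i = m i.gen := rfl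

lemma mem_groupD {c : Ray F → ℂˣ} :
    c ∈ groupD F ↔ ∀ m : Module.Dual ℤ N, ∏ i, c i ^ m i.gen = 1 := Iff.rfl

variable (F) in
/-- The data of the slice `{zᵢ = 1, eᵢ ∉ σ}` attached to a cone `σ` of full dimension:
an enumeration of the rays of `σ`, and one-parameter subgroups of `𝐃(Σ)` that move the other
coordinates independently. -/
structure Slice (d : ℕ) where
  cone : Finset N
  cone_mem : cone ∈ F.cones
  idx : Fin d → Ray F
  idx_injective : Function.Injective idx
  mem_cone_iff : ∀ i : Ray F, i.gen ∈ cone ↔ i ∈ Set.range idx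
  k : ℕ
  k_ne_zero : k ≠ 0
  wt : Ray F → Ray F → ℤ
  sum_wt : ∀ j, ∀ m : Module.Dual ℤ N, ∑ i, wt i j * m i.gen = 0
  wt_self : ∀ i, i ∉ Set.range idx → wt i i = k
  wt_of_ne : ∀ i j, i ∉ Set.range idx → i ≠ j → wt i j = 0
  wt_of_mem : ∀ i j, j ∈ Set.range idx → wt i j = 0
  pow_eq_one : ∀ u ∈ groupD F, (∀ i, i ∉ Set.range idx → u i = 1) → ∀ i, u i ^ k = 1
  primitive : ∀ a, ∀ b : ℕ, 0 < b → (∀ m : Module.Dual ℤ N, (b : ℤ) ∣ m (idx a).gen) → b = 1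

lemma Fan.exists_slice [Module.Free ℤ N] [Module.Finite ℤ N] (F : Fan N) {d : ℕ}
    (hd : Module.finrank ℤ N = d) {σ : Finset N} (hσ : σ ∈ F.cones) (hcard : σ.card = d) :
    ∃ S : Slice F d, S.cone = σ := by
  classical
  obtain ⟨k, κ, hk, hκ, hκ1, hκ0⟩ := (F.generators σ hσ).exists_coords (hcard.trans hd.symm)
  let e : σ ≃ Fin d := σ.equivFinOfCardEq hcard
  let idx : Fin d → Ray F := fun a =>
    ⟨e.symm a, F.face_mem σ hσ _ (by simp)⟩
  have hgen : ∀ a, (idx a).gen = e.symm a := fun a => rfl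
  have hinj : Function.Injective idx := fun a b hab =>
    e.symm.injective (Subtype.ext (congrArg Ray.gen hab))
  have hmem : ∀ i : Ray F, i.gen ∈ σ ↔ i ∈ Set.range idx := by
    intro i
    constructor
    · intro hi
      exact ⟨e ⟨i.gen, hi⟩, Subtype.ext (by simp [idx, Ray.gen])⟩
    · rintro ⟨a, rfl⟩
      exact (e.symm a).2
  -- For e_j outside σ, column j holds the coefficients of the relation k e_j - ∑ κ_e(e_j) e = 0; a
  -- relation among the e_i is exactly a one-parameter subgroup of 𝐃(Σ).
  let wt : Ray F → Ray F → ℤ := fun i j =>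
    if j.gen ∈ σ then 0 else
      (if h : i.gen ∈ σ then -κ ⟨i.gen, h⟩ j.gen else 0) + if i = j then (k : ℤ) else 0
  refine ⟨⟨σ, hσ, idx, hinj, hmem, k, hk, wt, fun j m => ?_, fun i hi => ?_, fun i j hi hij => ?_,
    fun i j hj => ?_, fun u hu hu1 i => ?_, fun a b hb hdvd => ?_⟩, rfl⟩
  · by_cases hj : j.gen ∈ σ
    · simp [wt, hj]
    · have h1 : ∑ i : Ray F, (if h : i.gen ∈ σ then -κ ⟨i.gen, h⟩ j.gen else 0) * m i.gen =
          ∑ a : Fin d, -κ (e.symm a) j.gen * m (e.symm a : N) := by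
        refine (Fintype.sum_of_injective idx hinj _ _ (fun i hi => ?_) fun a => ?_).symm
        · rw [dif_neg (fun h => hi ((hmem i).1 h)), zero_mul]
        · have h2 : (idx a).gen ∈ σ := (e.symm a).2
          rw [dif_pos h2]
          rfl
      have h2 : ∑ a : Fin d, -κ (e.symm a) j.gen * m (e.symm a : N) =
          -((k : ℤ) * m j.gen) := by
        rw [e.symm.sum_comp fun x : σ => -κ x j.gen * m (x : N)]
        have h3 := congrArg m (hκ j.gen)
        rw [map_smul, map_sum, smul_eq_mul] at h3
        rw [h3, ← Finset.sum_neg_distrib]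
        exact Finset.sum_congr rfl fun x _ => by rw [map_smul, smul_eq_mul, neg_mul]
      simp only [wt, if_neg hj, add_mul, Finset.sum_add_distrib]
      rw [h1, h2]
      simp
  · have hi' : i.gen ∉ σ := fun h => hi ((hmem i).1 h)
    simp [wt, hi']
  · have hi' : i.gen ∉ σ := fun h => hi ((hmem i).1 h)
    simp [wt, hi', hij]
  · simp [wt, (hmem j).2 hj]
  · by_cases hi : i ∈ Set.range idx
    · obtain ⟨a, rfl⟩ := hi
      -- This functional is `k` on one generator of σ and 0 on the others, and `u` is trivial off σ,
      -- so only the `k`-th power of one entry remains.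
      have h1 := mem_groupD.1 hu (κ (e.symm a))
      rw [Finset.prod_eq_single (idx a)] at h1
      · rw [hgen, hκ1, zpow_natCast] at h1
        exact h1
      · intro i _ hi
        by_cases hir : i ∈ Set.range idx
        · obtain ⟨b, rfl⟩ := hir
          rw [hgen, hκ0 _ _ fun h => hi (by rw [e.symm.injective h]), zpow_zero]
        · rw [hu1 i hir, one_zpow]
      · simp
    · rw [hu1 i hi, one_pow]
  · exact (F.generators σ hσ).eq_one_of_dvd (e.symm a).2 hb hdvd

/-- The action of the torus on the affine space. -/
def torusAct (c : Ray F → ℂˣ) (z : Ray F → ℂ) : Ray F → ℂ := fun i => (c i : ℂ) * z i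

lemma torusAct_mul (c c' : Ray F → ℂˣ) (z : Ray F → ℂ) :
    torusAct (c * c') z = torusAct c (torusAct c' z) := by
  ext i; simp [torusAct, mul_assoc]

@[simp] lemma torusAct_one (z : Ray F → ℂ) : torusAct 1 z = z := by
  ext i; simp [torusAct]

@[simp] lemma torusAct_inv_torusAct (c : Ray F → ℂˣ) (z : Ray F → ℂ) :
    torusAct c⁻¹ (torusAct c z) = z := by
  rw [← torusAct_mul, inv_mul_cancel, torusAct_one]

@[simp] lemma torusAct_torusAct_inv (c : Ray F → ℂˣ) (z : Ray F → ℂ) :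
    torusAct c (torusAct c⁻¹ z) = z := by
  rw [← torusAct_mul, mul_inv_cancel, torusAct_one]

/-- Multiplication by a vector as a continuous linear map. -/
def diagCLM {ι : Type*} [Fintype ι] (c : ι → ℂ) : (ι → ℂ) →L[ℂ] (ι → ℂ) :=
  ContinuousLinearMap.pi fun i => c i • ContinuousLinearMap.proj i

lemma analyticAt_torusAct (c : Ray F → ℂˣ) (z : Ray F → ℂ) : AnalyticAt ℂ (torusAct c) z :=
  (diagCLM fun i => (c i : ℂ)).analyticAt z

lemma mem_exceptionalSet_iff {z : Ray F → ℂ} :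
    z ∈ exceptionalSet F ↔ ∀ s ∈ F.cones, ∃ i : Ray F, i.gen ∉ s ∧ z i = 0 := by
  have h1 : ∀ s, MvPolynomial.eval z (zHat F s) = 0 ↔ ∃ i : Ray F, i.gen ∉ s ∧ z i = 0 := by
    intro s
    simp [zHat, Finset.prod_eq_zero_iff]
  constructor
  · intro h s hs
    exact (h1 s).1 (h _ (Ideal.subset_span ⟨s, hs, rfl⟩))
  · intro h b hb
    have h2 : irrelevantIdeal F ≤ RingHom.ker (MvPolynomial.eval z) := by
      rw [irrelevantIdeal, Ideal.span_le]
      rintro _ ⟨s, hs, rfl⟩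
      exact (h1 s).2 (h s hs)
    exact h2 hb

lemma mem_stableSet_iff {z : Ray F → ℂ} :
    z ∈ stableSet F ↔ ∃ s ∈ F.cones, ∀ i : Ray F, i.gen ∉ s → z i ≠ 0 := by
  rw [stableSet, Set.mem_compl_iff, mem_exceptionalSet_iff]
  push Not
  rfl

lemma toricMk_eq_iff {z w : stableSet F} :
    toricMk F z = toricMk F w ↔ ∃ c ∈ groupD F, w.1 = torusAct c z.1 := by
  refine (Quotient.eq (r := orbitSetoid F)).trans ?_
  exact ⟨fun ⟨c, hc, h⟩ => ⟨c, hc, funext h⟩, fun ⟨c, hc, h⟩ => ⟨c, hc, fun i => congrFun h i⟩⟩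

lemma toricMk_surjective : Function.Surjective (toricMk F) := Quotient.exists_rep

lemma continuous_toricMk : Continuous (toricMk F) := continuous_quotient_mk'

/-- A homogeneous polynomial is semi-invariant. -/
lemma IsDHomogeneous.exists_character {f : MvPolynomial (Ray F) ℂ} {β : ClassGp F}
    (hf : IsDHomogeneous F f β) : ∃ n : Ray F → ℕ, ∀ c ∈ groupD F, ∀ z,
      MvPolynomial.eval (torusAct c z) f = (∏ i, (c i : ℂ) ^ n i) * MvPolynomial.eval z f := by
  classical
  by_cases h0 : f = 0
  · exact ⟨0, by simp [h0]⟩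
  obtain ⟨n, hn⟩ := MvPolynomial.support_nonempty.2 h0
  refine ⟨n, fun c hc z => ?_⟩
  rw [MvPolynomial.eval_eq', MvPolynomial.eval_eq', Finset.mul_sum]
  refine Finset.sum_congr rfl fun m hm => ?_
  have hwt : ∀ m : Ray F →₀ ℕ, Finsupp.weight (varDegree F) m =
      Submodule.Quotient.mk (fun i => (m i : ℤ)) := by
    intro m
    rw [Finsupp.weight_apply, Finsupp.sum_fintype _ _ (by simp)]
    have h1 : (fun i => (m i : ℤ)) = ∑ i, (m i) • (Pi.single i 1 : Ray F → ℤ) := by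
      ext j
      simp [Finset.sum_apply, Pi.single_apply]
    rw [h1, ← Submodule.mkQ_apply, map_sum]
    refine Finset.sum_congr rfl fun i _ => ?_
    rw [map_nsmul, Submodule.mkQ_apply, varDegree]
  -- Exponents of equal degree differ by an element of α(M), where elements of 𝐃(Σ) are trivial; all
  -- monomials of `f` are thus scaled alike.
  have h1 : (Submodule.Quotient.mk (fun i => (m i : ℤ)) : ClassGp F) =
      Submodule.Quotient.mk (fun i => (n i : ℤ)) := by
    rw [← hwt, ← hwt, hf (MvPolynomial.mem_support_iff.1 hm), hf (MvPolynomial.mem_support_iff.1 hn)]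
  rw [Submodule.Quotient.eq] at h1
  obtain ⟨μ, hμ⟩ := h1
  have h2 : ∏ i, c i ^ m i = ∏ i, c i ^ n i := by
    have h3 := mem_groupD.1 hc μ
    have h4 : ∀ i, c i ^ μ i.gen = c i ^ m i / c i ^ n i := by
      intro i
      have h5 := congrFun hμ i
      rw [alpha_apply] at h5
      rw [h5]
      simp [zpow_sub, div_eq_mul_inv]
    simp only [h4, Finset.prod_div_distrib] at h3
    exact div_eq_one.1 h3
  have h3 : ∏ i, (c i : ℂ) ^ m i = ∏ i, (c i : ℂ) ^ n i := by
    have := congrArg (Units.val) h2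
    simpa using this
  simp only [torusAct, mul_pow, Finset.prod_mul_distrib]
  rw [h3]
  ring

lemma IsDHomogeneous.eval_torusAct_eq_zero_iff {f : MvPolynomial (Ray F) ℂ} {β : ClassGp F}
    (hf : IsDHomogeneous F f β) {c : Ray F → ℂˣ} (hc : c ∈ groupD F) (z : Ray F → ℂ) :
    MvPolynomial.eval (torusAct c z) f = 0 ↔ MvPolynomial.eval z f = 0 := by
  obtain ⟨n, hn⟩ := hf.exists_character
  rw [hn c hc, mul_eq_zero, or_iff_right]
  exact Finset.prod_ne_zero_iff.2 fun i _ => pow_ne_zero _ (c i).ne_zero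

end SliceDef

/-! ### Projection to the slice along the orbits. -/

section SliceMaps

open Filter

variable {N : Type*} [AddCommGroup N] {F : Fan N} {d : ℕ}

namespace Slice

variable (S : Slice F d)

/-- The point of the slice with given coordinates. -/
def sl (v : Fin d → ℂ) : Ray F → ℂ := Function.extend S.idx v 1

/-- The directions along the slice. -/
def lin : (Fin d → ℂ) →L[ℂ] (Ray F → ℂ) :=
  LinearMap.toContinuousLinearMap (Function.ExtendByZero.linearMap ℂ S.idx)

@[simp] lemma sl_idx (v : Fin d → ℂ) (a : Fin d) : S.sl v (S.idx a) = v a :=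
  S.idx_injective.extend_apply _ _ _

lemma sl_of_notMem (v : Fin d → ℂ) {i : Ray F} (hi : i ∉ Set.range S.idx) : S.sl v i = 1 :=
  Function.extend_apply' _ _ _ hi

@[simp] lemma lin_idx (v : Fin d → ℂ) (a : Fin d) : S.lin v (S.idx a) = v a :=
  S.idx_injective.extend_apply _ _ _

lemma lin_of_notMem (v : Fin d → ℂ) {i : Ray F} (hi : i ∉ Set.range S.idx) : S.lin v i = 0 :=
  Function.extend_apply' _ _ _ hi

lemma sl_eq (v : Fin d → ℂ) : S.sl v = S.sl 0 + S.lin v := by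
  ext i
  by_cases hi : i ∈ Set.range S.idx
  · obtain ⟨a, rfl⟩ := hi
    simp
  · simp [S.sl_of_notMem _ hi, S.lin_of_notMem _ hi]

lemma hasFDerivAt_sl (v : Fin d → ℂ) : HasFDerivAt S.sl S.lin v := by
  rw [show S.sl = fun v => S.sl 0 + S.lin v from funext S.sl_eq]
  exact S.lin.hasFDerivAt.const_add _

lemma analyticAt_sl (v : Fin d → ℂ) : AnalyticAt ℂ S.sl v := by
  rw [show S.sl = fun v => S.sl 0 + S.lin v from funext S.sl_eq]
  exact analyticAt_const.add (S.lin.analyticAt v)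

lemma continuous_sl : Continuous S.sl :=
  continuous_iff_continuousAt.2 fun v => (S.analyticAt_sl v).continuousAt

lemma sl_mem_stableSet (v : Fin d → ℂ) : S.sl v ∈ stableSet F :=
  mem_stableSet_iff.2 ⟨S.cone, S.cone_mem, fun i hi => by
    rw [S.sl_of_notMem v fun h => hi ((S.mem_cone_iff i).2 h)]
    exact one_ne_zero⟩

/-- The character values of the element of `𝐃(Σ)` that moves `w` to the slice. -/
def coeff (w : Ray F → ℂ) (i : Ray F) : ℂ := ∏ j, w j ^ (-(S.wt i j : ℂ) / S.k)

lemma cpow_wt_of_mem (w : Ray F → ℂ) (i : Ray F) {j : Ray F} (hj : j ∈ Set.range S.idx) :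
    w j ^ (-(S.wt i j : ℂ) / S.k) = 1 := by
  rw [S.wt_of_mem i j hj]; simp

lemma coeff_of_notMem (w : Ray F → ℂ) {i : Ray F} (hi : i ∉ Set.range S.idx) :
    S.coeff w i = (w i)⁻¹ := by
  have hk : (S.k : ℂ) ≠ 0 := by exact_mod_cast S.k_ne_zero
  rw [coeff, Finset.prod_eq_single i]
  · rw [S.wt_self i hi, Int.cast_natCast, neg_div, div_self hk, Complex.cpow_neg_one]
  · intro j _ hji
    rw [S.wt_of_ne i j hi hji.symm]; simp
  · simp

lemma coeff_sl (v : Fin d → ℂ) (i : Ray F) : S.coeff (S.sl v) i = 1 := by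
  refine Finset.prod_eq_one fun j _ => ?_
  by_cases hj : j ∈ Set.range S.idx
  · exact S.cpow_wt_of_mem _ i hj
  · rw [S.sl_of_notMem v hj, Complex.one_cpow]

/-- Each factor of the product over j is an exponential exp(-log w_j · wt i j / k) for a fixed
choice of logarithm, so membership in 𝐃(Σ) follows from the relations `sum_wt`, even on the branch
cut. -/
lemma exists_coeff_eq {w : Ray F → ℂ} (hw : ∀ j, j ∉ Set.range S.idx → w j ≠ 0) :
    ∃ u ∈ groupD F, ∀ i, (u i : ℂ) = S.coeff w i := by
  have h0 : ∀ i, S.coeff w i ≠ 0 := fun i => by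
    refine Finset.prod_ne_zero_iff.2 fun j _ => ?_
    by_cases hj : j ∈ Set.range S.idx
    · rw [S.cpow_wt_of_mem _ i hj]; exact one_ne_zero
    · rw [Complex.cpow_def_of_ne_zero (hw j hj)]; exact Complex.exp_ne_zero _
  refine ⟨fun i => Units.mk0 _ (h0 i), mem_groupD.2 fun m => ?_, fun i => rfl⟩
  ext
  push_cast
  simp only [Units.val_mk0, coeff]
  simp only [← Finset.prod_zpow]
  rw [Finset.prod_comm]
  refine Finset.prod_eq_one fun j _ => ?_
  by_cases hj : j ∈ Set.range S.idx
  · exact Finset.prod_eq_one fun i _ => by rw [S.cpow_wt_of_mem _ i hj, one_zpow]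
  · have h1 : ∀ i, (w j ^ (-(S.wt i j : ℂ) / S.k)) ^ m i.gen =
        Complex.exp ((-Complex.log (w j) / S.k) * (S.wt i j * m i.gen : ℤ)) := by
      intro i
      rw [Complex.cpow_def_of_ne_zero (hw j hj), ← Complex.exp_int_mul]
      congr 1
      push_cast
      ring
    simp only [h1]
    rw [← Complex.exp_sum, ← Finset.mul_sum, ← Int.cast_sum, S.sum_wt]
    simp

/-- The projection to the slice along the orbits. -/
def proj (w : Ray F → ℂ) : Fin d → ℂ := fun a => S.coeff w (S.idx a) * w (S.idx a)

@[simp] lemma proj_sl (v : Fin d → ℂ) : S.proj (S.sl v) = v := by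
  ext a
  simp [proj, S.coeff_sl]

lemma exists_torusAct_eq_sl {w : Ray F → ℂ} (hw : ∀ j, j ∉ Set.range S.idx → w j ≠ 0) :
    ∃ u ∈ groupD F, w = torusAct u (S.sl (S.proj w)) := by
  obtain ⟨u, hu, huw⟩ := S.exists_coeff_eq hw
  refine ⟨u⁻¹, inv_mem hu, ?_⟩
  have h1 : torusAct u w = S.sl (S.proj w) := by
    ext i
    by_cases hi : i ∈ Set.range S.idx
    · obtain ⟨a, rfl⟩ := hi
      rw [S.sl_idx, torusAct, huw]
      rfl
    · rw [S.sl_of_notMem _ hi, torusAct, huw, S.coeff_of_notMem _ hi, inv_mul_cancel₀ (hw i hi)]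
  rw [← h1, torusAct_inv_torusAct]

lemma analyticAt_proj (v : Fin d → ℂ) : AnalyticAt ℂ S.proj (S.sl v) := by
  have h0 : ∀ i : Ray F, AnalyticAt ℂ (fun w : Ray F → ℂ => w i) (S.sl v) := fun i =>
    analyticAt_pi_iff.1 analyticAt_id i
  refine analyticAt_pi_iff.2 fun a => AnalyticAt.mul ?_ (h0 _)
  refine Finset.analyticAt_fun_prod _ fun j _ => ?_
  by_cases hj : j ∈ Set.range S.idx
  · simp only [S.cpow_wt_of_mem _ _ hj]
    exact analyticAt_const
  · refine (h0 j).cpow analyticAt_const ?_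
    rw [S.sl_of_notMem v hj]
    exact Complex.one_mem_slitPlane

/-- Near a point of the orbit of the slice there is a holomorphic projection to the slice along the
orbits. -/
lemma exists_local_proj {c : Ray F → ℂˣ} (hc : c ∈ groupD F) (v : Fin d → ℂ) :
    ∃ μ : (Ray F → ℂ) → (Fin d → ℂ), AnalyticAt ℂ μ (torusAct c (S.sl v)) ∧
      (∀ v', μ (torusAct c (S.sl v')) = v') ∧
      Function.Surjective (fderiv ℂ μ (torusAct c (S.sl v))) ∧
      ∀ᶠ w in 𝓝 (torusAct c (S.sl v)), ∃ u ∈ groupD F, w = torusAct u (S.sl (μ w)) := by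
  -- Translating by `c⁻¹` moves the base point to the slice, where the coordinates raised to
  -- fractional powers are 1, away from the branch cut.
  have hμa : AnalyticAt ℂ (fun w => S.proj (torusAct c⁻¹ w)) (torusAct c (S.sl v)) := by
    refine AnalyticAt.comp_of_eq (g := S.proj) (f := torusAct c⁻¹) (S.analyticAt_proj v)
      (analyticAt_torusAct _ _) (torusAct_inv_torusAct _ _)
  have hμ : ∀ v', S.proj (torusAct c⁻¹ (torusAct c (S.sl v'))) = v' := fun v' => by simp
  refine ⟨fun w => S.proj (torusAct c⁻¹ w), hμa, hμ, ?_, ?_⟩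
  · have h1 : HasFDerivAt (fun v' => torusAct c (S.sl v'))
        ((diagCLM fun i => (c i : ℂ)).comp S.lin) v :=
      (diagCLM fun i => (c i : ℂ)).hasFDerivAt.comp v (S.hasFDerivAt_sl v)
    have h2 := hμa.differentiableAt.hasFDerivAt.comp v h1
    have h3 : HasFDerivAt (fun v' => S.proj (torusAct c⁻¹ (torusAct c (S.sl v'))))
        (ContinuousLinearMap.id ℂ (Fin d → ℂ)) v := by
      simp only [hμ]
      exact hasFDerivAt_id v
    have h4 := h2.unique h3
    intro y
    exact ⟨_, by simpa using DFunLike.congr_fun h4 y⟩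
  · have h1 : ∀ᶠ w in 𝓝 (torusAct c (S.sl v)), ∀ j, j ∉ Set.range S.idx → w j ≠ 0 := by
      refine eventually_all.2 fun j => ?_
      by_cases hj : j ∈ Set.range S.idx
      · simp [hj]
      · have h2 : ContinuousAt (fun w : Ray F → ℂ => w j) (torusAct c (S.sl v)) :=
          (continuous_apply j).continuousAt
        refine (h2.eventually_ne ?_).mono fun w hw _ => hw
        rw [torusAct, S.sl_of_notMem v hj, mul_one]
        exact (c j).ne_zero
    filter_upwards [h1] with w hw
    obtain ⟨u, hu, huw⟩ := S.exists_torusAct_eq_sl (w := torusAct c⁻¹ w)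
      fun j hj => mul_ne_zero (Units.ne_zero _) (hw j hj)
    refine ⟨c * u, mul_mem hc hu, ?_⟩
    rw [torusAct_mul, ← huw, torusAct_torusAct_inv]

end Slice

/-- Every stable point lies in the orbit of a point of some slice. -/
lemma exists_slice_rep [Module.Free ℤ N] [Module.Finite ℤ N] (hd : Module.finrank ℤ N = d)
    {z : Ray F → ℂ} (hz : z ∈ stableSet F) :
    ∃ (S : Slice F d) (c : Ray F → ℂˣ) (v : Fin d → ℂ), c ∈ groupD F ∧ z = torusAct c (S.sl v) := by
  obtain ⟨s, hs, hsz⟩ := mem_stableSet_iff.1 hz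
  obtain ⟨τ, hτ, hsτ, hcard⟩ := F.exists_full_cone hs
  obtain ⟨S, rfl⟩ := F.exists_slice hd hτ (hcard.trans hd)
  obtain ⟨u, hu, h⟩ := S.exists_torusAct_eq_sl (w := z) fun j hj =>
    hsz j fun hjs => hj ((S.mem_cone_iff j).1 (hsτ hjs))
  exact ⟨S, u, S.proj z, hu, h⟩

end SliceMaps

/-! ### Stabilizers and the local models of the toric variety. -/

section Charts

open Filter Metric
open scoped Matrix

variable {N : Type*} [AddCommGroup N] {F : Fan N} {d : ℕ}

namespace Slice

variable (S : Slice F d) (t : Fin d → ℂ)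

/-- The action of the torus on the coordinates of the slice. -/
def diagHom : (Ray F → ℂˣ) →* Matrix.GeneralLinearGroup (Fin d) ℂ where
  toFun u :=
    { val := Matrix.diagonal fun a => (u (S.idx a) : ℂ)
      inv := Matrix.diagonal fun a => ((u (S.idx a))⁻¹ : ℂˣ)
      val_inv := by simp [Matrix.diagonal_mul_diagonal]
      inv_val := by simp [Matrix.diagonal_mul_diagonal] }
  map_one' := by ext1; simp
  map_mul' u v := by ext1; simp [Matrix.diagonal_mul_diagonal]

@[simp] lemma diagHom_mulVec (u : Ray F → ℂˣ) (v : Fin d → ℂ) :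
    (S.diagHom u).1 *ᵥ v = fun a => (u (S.idx a) : ℂ) * v a := by
  ext a
  simp [diagHom, Matrix.mulVec_diagonal]

/-- The stabilizer in `𝐃(Σ)` of a point of the slice. -/
def stabD : Subgroup (Ray F → ℂˣ) where
  carrier := {u | u ∈ groupD F ∧ (∀ i, i ∉ Set.range S.idx → u i = 1) ∧
    ∀ a, (u (S.idx a) : ℂ) * t a = t a}
  one_mem' := ⟨one_mem _, by simp, by simp⟩
  mul_mem' := by
    rintro u v ⟨hu, hu1, hut⟩ ⟨hv, hv1, hvt⟩
    refine ⟨mul_mem hu hv, fun i hi => ?_, fun a => ?_⟩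
    · rw [Pi.mul_apply, hu1 i hi, hv1 i hi, one_mul]
    · rw [Pi.mul_apply, Units.val_mul, mul_assoc, hvt, hut]
  inv_mem' := by
    rintro u ⟨hu, hu1, hut⟩
    refine ⟨inv_mem hu, fun i hi => ?_, fun a => ?_⟩
    · rw [Pi.inv_apply, hu1 i hi, inv_one]
    · conv_lhs => rw [← hut a]
      simp

/-- The stabilizer of a point of the slice as a linear group. -/
def stab : Subgroup (Matrix.GeneralLinearGroup (Fin d) ℂ) := (S.stabD t).map S.diagHom

lemma finite_stabD : Finite (S.stabD t) := by
  have h1 : (Set.pi Set.univ fun _ : Ray F => {x : ℂˣ | x ^ S.k = 1}).Finite := by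
    have : NeZero S.k := ⟨S.k_ne_zero⟩
    have h2 : Finite (rootsOfUnity S.k ℂ) := inferInstance
    exact Set.Finite.pi fun _ => Set.toFinite ((rootsOfUnity S.k ℂ : Subgroup ℂˣ) : Set ℂˣ)
  refine h1.subset fun u hu => ?_
  obtain ⟨hu, hu1, -⟩ := hu
  exact fun i _ => S.pow_eq_one u hu hu1 i

lemma stab_pow {g : Matrix.GeneralLinearGroup (Fin d) ℂ} (hg : g ∈ S.stab t) (v : Fin d → ℂ)
    (a : Fin d) : (g.1 *ᵥ v) a ^ S.k = v a ^ S.k := by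
  obtain ⟨u, ⟨hu, hu1, -⟩, rfl⟩ := hg
  rw [diagHom_mulVec, mul_pow, ← Units.val_pow_eq_pow_val, S.pow_eq_one u hu hu1, Units.val_one,
    one_mul]

/-- A pseudo-reflection would come from `u` in 𝐃(Σ) with a single nontrivial entry, at some e_a. The
order of this entry divides ⟨m, e_a⟩ for every m, so primitivity makes it 1. -/
lemma isFiniteSmall_stab : IsFiniteSmall (S.stab t) := by
  classical
  have := S.finite_stabD t
  refine ⟨?_, ?_⟩
  · have h1 : ((S.stabD t : Set (Ray F → ℂˣ))).Finite := Set.toFinite _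
    exact (h1.image S.diagHom).to_subtype
  rintro g ⟨u, ⟨hu, hu1, -⟩, rfl⟩ hrank
  let w : Fin d → ℂ := fun a => (u (S.idx a) : ℂ) - 1
  have h1 : Module.End.eigenspace (Matrix.toLin' (S.diagHom u).1) 1 =
      LinearMap.ker (Matrix.diagonal w).mulVecLin := by
    ext v
    rw [Module.End.mem_eigenspace_iff, LinearMap.mem_ker, Matrix.toLin'_apply, diagHom_mulVec,
      one_smul, Matrix.mulVecLin_apply, ← sub_eq_zero]
    have h2 : Matrix.diagonal w *ᵥ v = (fun a => (u (S.idx a) : ℂ) * v a) - v := by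
      ext a
      simp only [Matrix.mulVec_diagonal, w, Pi.sub_apply]
      ring
    rw [h2]
  have h2 := LinearMap.finrank_range_add_finrank_ker (Matrix.diagonal w).mulVecLin
  rw [← h1, Module.finrank_fin_fun] at h2
  have h3 : Fintype.card {a // w a ≠ 0} = 1 := by
    rw [← Matrix.rank_diagonal, Matrix.rank]
    omega
  obtain ⟨⟨a, ha⟩, hua⟩ := Fintype.card_eq_one_iff.1 h3
  have hu2 : ∀ i, i ≠ S.idx a → u i = 1 := by
    intro i hi
    by_cases hir : i ∈ Set.range S.idx
    · obtain ⟨b, rfl⟩ := hir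
      by_contra hb
      have hwb : w b ≠ 0 := fun h => hb (Units.ext (sub_eq_zero.1 h))
      exact hi (congrArg S.idx (congrArg Subtype.val (hua ⟨b, hwb⟩)))
    · exact hu1 i hir
  have h4 : ∀ m : Module.Dual ℤ N, u (S.idx a) ^ m (S.idx a).gen = 1 := by
    intro m
    have h5 := mem_groupD.1 hu m
    rwa [Finset.prod_eq_single (S.idx a) (fun i _ hi => by rw [hu2 i hi, one_zpow])
      (by simp)] at h5
  have h5 : 0 < orderOf (u (S.idx a)) := orderOf_pos_iff.2
    (isOfFinOrder_iff_pow_eq_one.2 ⟨S.k, Nat.pos_of_ne_zero S.k_ne_zero, S.pow_eq_one u hu hu1 _⟩)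
  have h6 := S.primitive a _ h5 fun m => orderOf_dvd_iff_zpow_eq_one.2 (h4 m)
  apply ha
  rw [orderOf_eq_one_iff] at h6
  simp [w, h6]

/-- The map from the slice, centred at the point `t`, to the toric variety. -/
def toToric (v : Fin d → ℂ) : ToricVariety F := toricMk F ⟨S.sl (t + v), S.sl_mem_stableSet _⟩

lemma toToric_eq_iff {v : Fin d → ℂ} {z : stableSet F} :
    toricMk F z = S.toToric t v ↔ ∃ c ∈ groupD F, z.1 = torusAct c (S.sl (t + v)) := by
  rw [eq_comm, toToric, toricMk_eq_iff]

lemma continuous_toToric : Continuous (S.toToric t) :=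
  continuous_toricMk.comp ((S.continuous_sl.comp (continuous_const.add continuous_id)).subtype_mk _)

/-- Near any point over the image, the local projection supplies a slice point in the same orbit,
depending continuously on the point. -/
lemma isOpenMap_toToric : IsOpenMap (S.toToric t) := by
  intro W hW
  have h1 : IsOpen (toricMk F ⁻¹' (S.toToric t '' W)) := by
    rw [isOpen_iff_mem_nhds]
    rintro z ⟨v, hv, hvz⟩
    obtain ⟨c, hc, hzc⟩ := (S.toToric_eq_iff t).1 hvz.symm
    obtain ⟨μ, hμ, hμv, -, hμu⟩ := S.exists_local_proj hc (t + v)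
    rw [← hzc] at hμ hμu
    have h2 : ∀ᶠ w in 𝓝 z.1, μ w - t ∈ W := by
      have h3 : ContinuousAt (fun w => μ w - t) z.1 := hμ.continuousAt.sub continuousAt_const
      refine h3.preimage_mem_nhds (hW.mem_nhds ?_)
      rwa [hzc, hμv, add_sub_cancel_left]
    have h3 : Tendsto (Subtype.val : stableSet F → _) (𝓝 z) (𝓝 z.1) :=
      continuous_subtype_val.continuousAt
    filter_upwards [h3.eventually h2, h3.eventually hμu] with w hw hwu
    obtain ⟨u, hu, hwu⟩ := hwu
    refine ⟨μ w.1 - t, hw, ((S.toToric_eq_iff t).2 ⟨u, hu, ?_⟩).symm⟩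
    rw [add_sub_cancel]
    exact hwu
  exact h1

lemma toToric_stab {g : Matrix.GeneralLinearGroup (Fin d) ℂ} (hg : g ∈ S.stab t)
    (v : Fin d → ℂ) : S.toToric t (g.1 *ᵥ v) = S.toToric t v := by
  obtain ⟨u, ⟨hu, hu1, hut⟩, rfl⟩ := hg
  refine (S.toToric_eq_iff t).2 ⟨u, hu, ?_⟩
  ext i
  by_cases hi : i ∈ Set.range S.idx
  · obtain ⟨a, rfl⟩ := hi
    simp [torusAct, mul_add, hut a]
  · simp [torusAct, S.sl_of_notMem _ hi, hu1 i hi]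

/-- The map induced on the quotient by the stabilizer. -/
def chart : LinearQuotient (S.stab t) → ToricVariety F :=
  Quotient.lift (s := linearSetoid (S.stab t)) (S.toToric t) (by
    rintro v w ⟨g, hg, rfl⟩
    exact (S.toToric_stab t hg v).symm)

@[simp] lemma chart_linearMk (v : Fin d → ℂ) :
    S.chart t (linearMk (S.stab t) v) = S.toToric t v := rfl

/-- An element of 𝐃(Σ) joining two slice points is 1 off σ, so only finitely many occur. Those that
move t cannot join points close to t. -/
lemma eventually_injective : ∃ ε > 0, ∀ v ∈ ball (0 : Fin d → ℂ) ε, ∀ w ∈ ball (0 : Fin d → ℂ) ε,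
    S.toToric t v = S.toToric t w → linearMk (S.stab t) v = linearMk (S.stab t) w := by
  -- At the point 0 the fixing condition is void, so `stabD 0` consists of all elements of 𝐃(Σ) that
  -- are 1 off σ.
  have := S.finite_stabD 0
  have h1 : ∀ᶠ q : (Fin d → ℂ) × (Fin d → ℂ) in 𝓝 (0, 0), ∀ u : S.stabD 0,
      (∀ a, (u.1 (S.idx a) : ℂ) * (t + q.1) a = (t + q.2) a) →
        ∀ a, (u.1 (S.idx a) : ℂ) * t a = t a := by
    refine eventually_all.2 fun u => ?_
    by_cases h : ∀ a, (u.1 (S.idx a) : ℂ) * t a = t a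
    · exact Eventually.of_forall fun _ _ => h
    · push Not at h
      obtain ⟨a, ha⟩ := h
      have h2 : ContinuousAt (fun q : (Fin d → ℂ) × (Fin d → ℂ) =>
          (u.1 (S.idx a) : ℂ) * (t a + q.1 a) - (t a + q.2 a)) (0, 0) := by fun_prop
      refine (h2.eventually_ne ?_).mono fun q hq hq' => absurd (sub_eq_zero.2 (hq' a)) hq
      simpa [sub_eq_zero] using ha
  rw [nhds_prod_eq] at h1
  obtain ⟨W, hW, hWu⟩ := (eventually_prod_self_iff (r := fun v w => ∀ u : S.stabD 0,
      (∀ a, (u.1 (S.idx a) : ℂ) * (t + v) a = (t + w) a) →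
        ∀ a, (u.1 (S.idx a) : ℂ) * t a = t a)).1 h1
  obtain ⟨ε, hε, hεW⟩ := Metric.mem_nhds_iff.1 hW
  refine ⟨ε, hε, fun v hv w hw hvw => ?_⟩
  obtain ⟨u, hu, huv⟩ := (S.toToric_eq_iff t).1 hvw.symm
  have hu1 : ∀ i, i ∉ Set.range S.idx → u i = 1 := fun i hi => by
    have h2 := congrFun huv i
    simp only [torusAct] at h2
    rw [S.sl_of_notMem _ hi, S.sl_of_notMem _ hi, mul_one] at h2
    exact Units.ext h2.symm
  have hua : ∀ a, (u (S.idx a) : ℂ) * (t + v) a = (t + w) a := fun a => by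
    have h2 := congrFun huv (S.idx a)
    simp only [torusAct] at h2
    rw [S.sl_idx, S.sl_idx] at h2
    exact h2.symm
  have hut := hWu v (hεW hv) w (hεW hw) ⟨u, hu, hu1, by simp⟩ hua
  refine linearMk_eq_iff.2 ⟨S.diagHom u, ⟨u, ⟨hu, hu1, hut⟩, rfl⟩, ?_⟩
  rw [diagHom_mulVec]
  ext a
  have h2 := hua a
  simp only [Pi.add_apply, mul_add, hut a] at h2
  exact (add_left_cancel h2).symm

/-- The quotient of the slice by the stabilizer is a local model of the toric variety. -/
lemma exists_isGermIso : ∃ φ : OpenPartialHomeomorph (LinearQuotient (S.stab t)) (ToricVariety F),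
    IsGermIso F (S.stab t) (S.toToric t 0) φ ∧ ⇑φ = S.chart t := by
  obtain ⟨ε, hε, hinj⟩ := S.eventually_injective t
  let U : Set (LinearQuotient (S.stab t)) := linearMk (S.stab t) '' ball 0 ε
  have hcont : Continuous (S.chart t) :=
    (S.continuous_toToric t).quotient_lift _
  have hopen : IsOpenMap (S.chart t) := by
    intro V hV
    have h1 : S.chart t '' V = S.toToric t '' (linearMk (S.stab t) ⁻¹' V) := by
      ext p
      constructor
      · rintro ⟨x, hx, rfl⟩
        obtain ⟨v, rfl⟩ := linearMk_surjective x
        exact ⟨v, hx, rfl⟩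
      · rintro ⟨v, hv, rfl⟩
        exact ⟨_, hv, rfl⟩
    rw [h1]
    exact S.isOpenMap_toToric t _ (hV.preimage continuous_linearMk)
  have hinjU : Set.InjOn (S.chart t) U := by
    rintro _ ⟨v, hv, rfl⟩ _ ⟨w, hw, rfl⟩ hvw
    exact hinj v hv w hw hvw
  have : Nonempty (LinearQuotient (S.stab t)) := ⟨linearMk _ 0⟩
  let φ := OpenPartialHomeomorph.ofContinuousOpen (hinjU.toPartialEquiv _ U) hcont.continuousOn
    hopen (isOpenMap_linearMk _ isOpen_ball)
  refine ⟨φ, ⟨⟨0, mem_ball_self hε, rfl⟩, rfl, fun x _ h => ?_⟩, rfl⟩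
  obtain ⟨v, rfl⟩ := linearMk_surjective x
  change ToricVariety.HolAt F h (S.toToric t v) ↔
    LinearQuotient.HolAt (S.stab t) (fun y => h (S.chart t y)) _
  constructor
  · intro hh v' hv'
    obtain ⟨H, hH, hHh⟩ := hh ⟨S.sl (t + v'), S.sl_mem_stableSet _⟩
      (show S.toToric t v' = S.toToric t v from congrArg (S.chart t) hv')
    have h1 : AnalyticAt ℂ (fun w => H (S.sl (t + w))) v' :=
      AnalyticAt.comp_of_eq (g := H) (f := fun w => S.sl (t + w)) hH
        ((S.analyticAt_sl (t + v')).comp_of_eq (analyticAt_const.add analyticAt_id) rfl) rfl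
    refine h1.congr ?_
    have h2 : Continuous fun w => (⟨S.sl (t + w), S.sl_mem_stableSet _⟩ : stableSet F) :=
      (S.continuous_sl.comp (continuous_const.add continuous_id)).subtype_mk _
    exact h2.continuousAt.eventually hHh
  -- A function holomorphic on the slice is extended to a neighbourhood of `z` by composing with the
  -- local projection, which stays in the same orbit.
  · intro hh z hz
    obtain ⟨c, hc, hzc⟩ := (S.toToric_eq_iff t).1 hz
    obtain ⟨μ, hμ, hμv, -, hμu⟩ := S.exists_local_proj hc (t + v)
    rw [← hzc] at hμ hμu
    refine ⟨fun w => h (S.toToric t (μ w - t)), ?_, ?_⟩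
    · refine AnalyticAt.comp_of_eq (g := fun y => h (S.toToric t y)) (f := fun w => μ w - t)
        (hh v rfl) (hμ.sub analyticAt_const) ?_
      rw [hzc, hμv, add_sub_cancel_left]
    · have h3 : Tendsto (Subtype.val : stableSet F → _) (𝓝 z) (𝓝 z.1) :=
        continuous_subtype_val.continuousAt
      filter_upwards [h3.eventually hμu] with w hw
      obtain ⟨u, hu, hwu⟩ := hw
      rw [(S.toToric_eq_iff t).2 ⟨u, hu, by rw [add_sub_cancel]; exact hwu⟩]

end Slice

lemma isVManifold [Module.Free ℤ N] [Module.Finite ℤ N] (hd : Module.finrank ℤ N = d) :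
    IsVManifold F d := by
  intro p
  obtain ⟨z, rfl⟩ := toricMk_surjective p
  obtain ⟨S, c, t, hc, hz⟩ := exists_slice_rep hd z.2
  obtain ⟨φ, hφ, -⟩ := S.exists_isGermIso t
  refine ⟨S.stab t, S.isFiniteSmall_stab t, φ, ?_⟩
  rwa [(S.toToric_eq_iff t (v := 0)).2 ⟨c, hc, by rwa [add_zero]⟩]

end Charts

/-! ### Quasi-smooth hypersurfaces and V-submanifolds. -/

section QuasiSmooth

open Filter
open scoped Matrix

variable {N : Type*} [AddCommGroup N] {F : Fan N} {d : ℕ}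

lemma analyticAt_eval {ι : Type*} [Fintype ι] (f : MvPolynomial ι ℂ) (z : ι → ℂ) :
    AnalyticAt ℂ (fun z : ι → ℂ => MvPolynomial.eval z f) z :=
  AnalyticOnNhd.eval_mvPolynomial f z trivial

namespace Slice

variable (S : Slice F d)

/-- Modulo the directions of the slice, every direction is tangent to the orbits. -/
lemma exists_fderiv_eq {E' : Type*} [NormedAddCommGroup E'] [NormedSpace ℂ E']
    {g : (Ray F → ℂ) → E'} {v : Fin d → ℂ} (hg : DifferentiableAt ℂ g (S.sl v))
    (h0 : ∀ᶠ z in 𝓝 (S.sl v), (∃ u ∈ groupD F, z = torusAct u (S.sl v)) → g z = 0)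
    (w : Ray F → ℂ) : ∃ y, fderiv ℂ g (S.sl v) w = fderiv ℂ g (S.sl v) (S.lin y) := by
  have hk : (S.k : ℂ) ≠ 0 := by exact_mod_cast S.k_ne_zero
  -- The velocity at the slice point of the one-parameter subgroup with weights `wt · j`. It is
  -- tangent to the orbit, where `g` vanishes.
  let X : Ray F → Ray F → ℂ := fun j i => S.wt i j * S.sl v i
  have hX : ∀ j, fderiv ℂ g (S.sl v) (X j) = 0 := by
    intro j
    let γ : ℂ → Ray F → ℂ := fun s i => Complex.exp (s * S.wt i j) * S.sl v i
    have hγ0 : γ 0 = S.sl v := by ext i; simp [γ]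
    have hγ : HasDerivAt γ (X j) 0 := by
      refine hasDerivAt_pi.2 fun i => ?_
      have h1 : HasDerivAt (fun s : ℂ => s * (S.wt i j : ℂ)) (S.wt i j : ℂ) 0 := by
        simpa using (hasDerivAt_id (0 : ℂ)).mul_const (S.wt i j : ℂ)
      refine (h1.cexp.mul_const (S.sl v i)).congr_deriv ?_
      simp [X]
    have h1 : HasDerivAt (fun s => g (γ s)) (fderiv ℂ g (S.sl v) (X j)) 0 := by
      have h2 : HasFDerivAt g (fderiv ℂ g (S.sl v)) (γ 0) := by
        rw [hγ0]; exact hg.hasFDerivAt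
      exact h2.comp_hasDerivAt 0 hγ
    have h2 : (fun s => g (γ s)) =ᶠ[𝓝 0] fun _ => 0 := by
      have h3 : Tendsto γ (𝓝 0) (𝓝 (S.sl v)) := by
        have := hγ.continuousAt.tendsto
        rwa [hγ0] at this
      refine (h3.eventually h0).mono fun s hs => hs ?_
      refine ⟨fun i => Units.mk0 (Complex.exp (s * S.wt i j)) (Complex.exp_ne_zero _),
        mem_groupD.2 fun m => ?_, rfl⟩
      ext
      push_cast
      simp only [Units.val_mk0]
      have h4 : ∀ i, Complex.exp (s * S.wt i j) ^ m i.gen =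
          Complex.exp (s * (S.wt i j * m i.gen : ℤ)) := fun i => by
        rw [← Complex.exp_int_mul]
        congr 1
        push_cast
        ring
      simp only [h4]
      rw [← Complex.exp_sum, ← Finset.mul_sum, ← Int.cast_sum, S.sum_wt]
      simp
    exact h1.unique ((hasDerivAt_const (0 : ℂ) (0 : E')).congr_of_eventuallyEq h2)
  -- Off σ the vector `X j` has only the entry `k` at place j, so these multiples cancel all
  -- coordinates of `w` off the slice.
  let w' : Ray F → ℂ := w - ∑ j, (w j / S.k) • X j
  refine ⟨fun a => w' (S.idx a), ?_⟩
  have h1 : S.lin (fun a => w' (S.idx a)) = w' := by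
    ext i
    by_cases hi : i ∈ Set.range S.idx
    · obtain ⟨a, rfl⟩ := hi
      simp
    · rw [S.lin_of_notMem _ hi]
      have h2 : ∑ j, (w j / S.k) * (S.wt i j * S.sl v i) = w i := by
        rw [Finset.sum_eq_single i]
        · rw [S.wt_self i hi, S.sl_of_notMem v hi, Int.cast_natCast, mul_one, div_mul_cancel₀ _ hk]
        · intro j _ hj
          rw [S.wt_of_ne i j hi hj.symm]; simp
        · simp
      simp only [w', Pi.sub_apply, Finset.sum_apply, Pi.smul_apply, smul_eq_mul, X]
      rw [h2, sub_self]
  rw [h1]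
  simp only [w', map_sub, map_sum, map_smul, hX, smul_zero, Finset.sum_const_zero, sub_zero]

variable {f : MvPolynomial (Ray F) ℂ} {β : ClassGp F}

/-- If the slice of `𝐕(f)` is smooth then so is `𝐕(f)`. -/
lemma isSmoothAt_zeroSet (hf : IsDHomogeneous F f β) {c : Ray F → ℂˣ} (hc : c ∈ groupD F)
    {v : Fin d → ℂ} (h : IsSmoothAt {v | MvPolynomial.eval (S.sl v) f = 0} v) :
    IsSmoothAt (zeroSet F f) (torusAct c (S.sl v)) := by
  obtain ⟨μ, hμ, hμv, hμs, hμu⟩ := S.exists_local_proj hc v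
  refine IsSmoothAt.of_submersion hμ hμs (by rwa [hμv]) ?_
  filter_upwards [hμu] with w hw
  obtain ⟨u, hu, hwu⟩ := hw
  change MvPolynomial.eval w f = 0 ↔ MvPolynomial.eval (S.sl (μ w)) f = 0
  conv_lhs => rw [hwu]
  exact hf.eval_torusAct_eq_zero_iff hu _

/-- If `𝐕(f)` is smooth then so is its slice. -/
lemma isSmoothAt_slice (hf : IsDHomogeneous F f β) {v : Fin d → ℂ}
    (hv : MvPolynomial.eval (S.sl v) f = 0) (h : IsSmoothAt (zeroSet F f) (S.sl v)) :
    IsSmoothAt {v | MvPolynomial.eval (S.sl v) f = 0} v := by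
  obtain ⟨r, H, hH, hHs, hHf⟩ := h
  have hsl := S.analyticAt_sl v
  refine ⟨r, fun v => H (S.sl v), hH.comp hsl, ?_, hsl.continuousAt.eventually hHf⟩
  have h1 : fderiv ℂ (fun v => H (S.sl v)) v = (fderiv ℂ H (S.sl v)).comp S.lin :=
    (hH.differentiableAt.hasFDerivAt.comp v (S.hasFDerivAt_sl v)).fderiv
  rw [h1]
  intro x
  -- The defining map `H` vanishes along the orbit, so its differential is still surjective on slice
  -- directions.
  obtain ⟨w, rfl⟩ := hHs x
  obtain ⟨y, hy⟩ := S.exists_fderiv_eq hH.differentiableAt (by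
    filter_upwards [hHf] with z hz
    rintro ⟨u, hu, rfl⟩
    exact hz.1 ((hf.eval_torusAct_eq_zero_iff hu _).2 hv)) w
  exact ⟨y, hy.symm⟩

end Slice

lemma isSmoothAt_add_left_iff {T : Set (Fin d → ℂ)} {t : Fin d → ℂ} :
    IsSmoothAt {v | t + v ∈ T} 0 ↔ IsSmoothAt T t := by
  have h1 : ∀ s x : Fin d → ℂ, AnalyticAt ℂ (fun v => s + v) x := fun s x =>
    analyticAt_const.add analyticAt_id
  have h2 : ∀ s x : Fin d → ℂ, Function.Surjective (fderiv ℂ (fun v => s + v) x) := fun s x => by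
    rw [fderiv_const_add, fderiv_fun_id]
    exact Function.surjective_id
  constructor
  · intro h
    refine IsSmoothAt.of_submersion (h1 (-t) t) (h2 _ _) (by simpa using h) ?_
    simp
  · intro h
    refine IsSmoothAt.of_submersion (h1 t 0) (h2 _ _) (by simpa using h) ?_
    simp

lemma toricMk_mem_hypersurface_iff {f : MvPolynomial (Ray F) ℂ} {β : ClassGp F}
    (hf : IsDHomogeneous F f β) {z : stableSet F} :
    toricMk F z ∈ hypersurface F f ↔ MvPolynomial.eval z.1 f = 0 := by
  constructor
  · rintro ⟨w, hw, hwz⟩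
    obtain ⟨c, hc, hzc⟩ := toricMk_eq_iff.1 hwz
    rw [hzc, hf.eval_torusAct_eq_zero_iff hc]
    exact hw
  · intro h
    exact ⟨z, h, rfl⟩

lemma IsGermIso.isHolIso {G G' : Subgroup (Matrix.GeneralLinearGroup (Fin d) ℂ)}
    {p p' : ToricVariety F} {φ : OpenPartialHomeomorph (LinearQuotient G) (ToricVariety F)}
    {φ' : OpenPartialHomeomorph (LinearQuotient G') (ToricVariety F)} (hφ : IsGermIso F G p φ)
    (hφ' : IsGermIso F G' p' φ') : IsHolIso (φ.trans φ'.symm) := by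
  intro x hx q
  obtain ⟨hx1, hx2⟩ : x ∈ φ.source ∧ φ x ∈ φ'.target := by simpa using hx
  let h : ToricVariety F → ℂ := fun p => q (φ'.symm p)
  have h1 := hφ.2.2 x hx1 h
  have h2 := hφ'.2.2 (φ'.symm (φ x)) (φ'.map_target hx2) h
  rw [φ'.right_inv hx2] at h2
  have h3 : (fun y => h (φ' y)) =ᶠ[𝓝 (φ'.symm (φ x))] q := by
    filter_upwards [φ'.open_source.mem_nhds (φ'.map_target hx2)] with y hy
    change q (φ'.symm (φ' y)) = q y
    rw [φ'.left_inv hy]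
  refine Iff.trans ⟨fun hq => hq.congr h3, fun hq => hq.congr h3.symm⟩ (h2.symm.trans h1)

variable [Module.Free ℤ N] [Module.Finite ℤ N] {f : MvPolynomial (Ray F) ℂ} {β : ClassGp F}

lemma IsQuasiSmooth.isVSubmanifold (hd : Module.finrank ℤ N = d) (hf : IsDHomogeneous F f β)
    (hq : IsQuasiSmooth F f) : IsVSubmanifold F d (hypersurface F f) := by
  refine ⟨isVManifold hd, ?_⟩
  rintro _ ⟨z, hz, rfl⟩
  obtain ⟨S, c, t, hc, hzc⟩ := exists_slice_rep hd z.2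
  obtain ⟨φ, hφ, hφc⟩ := S.exists_isGermIso t
  have hp : toricMk F z = S.toToric t 0 :=
    (S.toToric_eq_iff t).2 ⟨c, hc, by rwa [add_zero]⟩
  refine ⟨S.stab t, S.isFiniteSmall_stab t, φ, by rwa [hp], ?_⟩
  have ht : MvPolynomial.eval (S.sl t) f = 0 := by
    have : MvPolynomial.eval z.1 f = 0 := hz
    rwa [hzc, hf.eval_torusAct_eq_zero_iff hc] at this
  have h1 := S.isSmoothAt_slice hf ht (hq _ ht (S.sl_mem_stableSet t))
  obtain ⟨r, H, hH, hHs, hHf⟩ := isSmoothAt_add_left_iff.2 h1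
  refine ⟨r, H, hH, hHs, ?_⟩
  filter_upwards [hHf, continuous_linearMk.continuousAt.eventually
    (φ.open_source.mem_nhds hφ.1)] with v hv hvs
  rw [← hv]
  rw [and_iff_right (show linearMk (S.stab t) v ∈ φ.source from hvs), hφc, S.chart_linearMk,
    Slice.toToric, toricMk_mem_hypersurface_iff hf]

/-- The smooth local model is arbitrary, so it is transported to the slice model by a biholomorphic
lift; only the zero set of the `k`-th power of `f` has to correspond. -/
lemma IsVSubmanifold.isQuasiSmooth (hd : Module.finrank ℤ N = d) (hf : IsDHomogeneous F f β)
    (hX : IsVSubmanifold F d (hypersurface F f)) : IsQuasiSmooth F f := by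
  intro z hz hzs
  obtain ⟨S, c, t, hc, rfl⟩ := exists_slice_rep hd hzs
  refine S.isSmoothAt_zeroSet hf hc (isSmoothAt_add_left_iff.1 ?_)
  have ht : MvPolynomial.eval (S.sl t) f = 0 := (hf.eval_torusAct_eq_zero_iff hc _).1 hz
  have hpX : S.toToric t 0 ∈ hypersurface F f := by
    rw [Slice.toToric, toricMk_mem_hypersurface_iff hf]
    simpa using ht
  obtain ⟨G, hG, φ, hφ, hsm⟩ := hX.2 _ hpX
  obtain ⟨φ', hφ', hφc⟩ := S.exists_isGermIso t
  have h0 : linearMk G 0 ∈ (φ.trans φ'.symm).source := by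
    have h1 : S.toToric t 0 ∈ φ'.target := by
      rw [← hφ'.2.1]; exact φ'.map_source hφ'.1
    simp [hφ.1, hφ.2.1, h1]
  have h00 : (φ.trans φ'.symm) (linearMk G 0) = linearMk (S.stab t) 0 := by
    change φ'.symm (φ (linearMk G 0)) = _
    rw [hφ.2.1, ← hφ'.2.1, φ'.left_inv hφ'.1]
  obtain ⟨Ψ, hΨ, hΨ0, hΨj, hΨF⟩ := (hφ.isHolIso hφ').exists_biholomorphic hG
    (S.isFiniteSmall_stab t) h0 h00 S.k_ne_zero fun g hg v i => S.stab_pow t hg v i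
  have hΨf := hΨF (fun v => MvPolynomial.eval (S.sl (t + v)) f)
    (fun v => AnalyticAt.comp_of_eq (g := fun z => MvPolynomial.eval z f)
      (f := fun v => S.sl (t + v)) (analyticAt_eval f _)
      ((S.analyticAt_sl (t + v)).comp_of_eq (analyticAt_const.add analyticAt_id) rfl) rfl) (by
      rintro _ ⟨u, ⟨hu, hu1, hut⟩, rfl⟩ v
      obtain ⟨n, hn⟩ := hf.exists_character
      have h1 : S.sl (t + (S.diagHom u).1 *ᵥ v) = torusAct u (S.sl (t + v)) := by
        ext i
        by_cases hi : i ∈ Set.range S.idx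
        · obtain ⟨a, rfl⟩ := hi
          simp [torusAct, mul_add, hut a]
        · simp [torusAct, S.sl_of_notMem _ hi, hu1 i hi]
      -- The character of `f` takes values in the `k`-th roots of unity on the stabilizer, so f^k is
      -- invariant.
      have h2 : (∏ i, (u i : ℂ) ^ n i) ^ S.k = 1 := by
        rw [← Finset.prod_pow]
        refine Finset.prod_eq_one fun i _ => ?_
        rw [← pow_mul, mul_comm, pow_mul, ← Units.val_pow_eq_pow_val, S.pow_eq_one u hu hu1]
        simp
      rw [h1, hn u hu, mul_pow, h2, one_mul])
  have h2 := hsm.image hΨ hΨj (T := {v | t + v ∈ {v | MvPolynomial.eval (S.sl v) f = 0}}) (by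
    filter_upwards [hΨf, continuous_linearMk.continuousAt.eventually
      ((φ.trans φ'.symm).open_source.mem_nhds h0)] with a ha has
    obtain ⟨has1, has2⟩ : linearMk G a ∈ φ.source ∧ φ (linearMk G a) ∈ φ'.target := by
      have has' : linearMk G a ∈ (φ.trans φ'.symm).source := has
      simpa using has'
    obtain ⟨b, hb⟩ := linearMk_surjective (φ'.symm (φ (linearMk G a)))
    have h3 := ha b hb.symm
    have h4 : φ (linearMk G a) = S.toToric t b := by
      rw [← S.chart_linearMk, ← hφc, hb, φ'.right_inv has2]
    change _ ∧ φ (linearMk G a) ∈ _ ↔ MvPolynomial.eval (S.sl (t + Ψ a)) f = 0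
    rw [and_iff_right has1, h4, Slice.toToric, toricMk_mem_hypersurface_iff hf,
      ← pow_eq_zero_iff S.k_ne_zero, ← h3, pow_eq_zero_iff S.k_ne_zero])
  rwa [hΨ0] at h2

end QuasiSmooth

/-! ### Squarefree polynomials and their derivatives. -/

section Squarefree

open Polynomial

/-- Gauss's lemma: the primitive part of a factor p with p² dividing `g` over the fraction field has
its square dividing `g` over `R`. -/
lemma squarefree_map_fractionRing {R K : Type*} [CommRing R] [IsDomain R]
    [UniqueFactorizationMonoid R] [Field K] [Algebra R K] [IsFractionRing R K] {g : R[X]}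
    (hg : Squarefree g) : Squarefree (g.map (algebraMap R K)) := by
  classical
  let _ : NormalizedGCDMonoid R := Classical.choice inferInstance
  have hinj : Function.Injective (algebraMap R K) := IsFractionRing.injective R K
  have hg0 : g.map (algebraMap R K) ≠ 0 := (Polynomial.map_ne_zero_iff hinj).mpr hg.ne_zero
  intro p hp
  have hp0 : p ≠ 0 := by
    rintro rfl
    exact hg0 (zero_dvd_iff.mp (by simpa using hp))
  obtain ⟨b, hb, hP⟩ := IsLocalization.integerNormalization_spec (nonZeroDivisors R) p
  set P := IsLocalization.integerNormalization (nonZeroDivisors R) p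
  have hP0 : P ≠ 0 := IsFractionRing.integerNormalization_eq_zero_iff.not.mpr hp0
  have hb0 : algebraMap R K b ≠ 0 :=
    (map_ne_zero_iff _ hinj).mpr (nonZeroDivisors.ne_zero hb)
  have hc0 : algebraMap R K P.content ≠ 0 :=
    (map_ne_zero_iff _ hinj).mpr (content_eq_zero_iff.not.mpr hP0)
  set q := P.primPart
  have hpq : p = C ((algebraMap R K b)⁻¹ * algebraMap R K P.content) * q.map (algebraMap R K) := by
    have h1 : P.map (algebraMap R K) = C (algebraMap R K P.content) * q.map (algebraMap R K) := by
      conv_lhs => rw [P.eq_C_content_mul_primPart]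
      simp [q]
    rw [C_mul, mul_assoc, ← h1, hP, ← algebraMap_smul K b p, smul_eq_C_mul, ← mul_assoc, ← C_mul,
      inv_mul_cancel₀ hb0, C_1, one_mul]
  have hu : IsUnit (C ((algebraMap R K b)⁻¹ * algebraMap R K P.content)) :=
    isUnit_C.mpr (mul_ne_zero (inv_ne_zero hb0) hc0).isUnit
  have hqp : q.map (algebraMap R K) ∣ p := ⟨_, by rw [hpq, mul_comm]⟩
  have hprim : (q * q).IsPrimitive := P.isPrimitive_primPart.mul P.isPrimitive_primPart
  have hdvd : q * q ∣ g := hprim.dvd_of_fraction_map_dvd_fraction_map (K := K) (by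
    rw [Polynomial.map_mul]
    exact (mul_dvd_mul hqp hqp).trans hp)
  rw [hpq]
  exact hu.mul ((hg q hdvd).map (mapRingHom (algebraMap R K)))

/-- In characteristic 0 squarefree means separable over the fraction field; clearing denominators in
the Bézout identity gives `D`, a substitute for the discriminant. -/
lemma exists_bezout_derivative {R : Type*} [CommRing R] [IsDomain R]
    [UniqueFactorizationMonoid R] [CharZero R] {g : R[X]} (hg : Squarefree g) :
    ∃ (a b : R[X]) (D : R), D ≠ 0 ∧ a * g + b * derivative g = C D := by
  let K := FractionRing R
  have hinj : Function.Injective (algebraMap R K) := IsFractionRing.injective R K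
  have : CharZero K := charZero_of_injective_algebraMap hinj
  obtain ⟨a, b, hab⟩ := PerfectField.separable_iff_squarefree.mpr
    (squarefree_map_fractionRing (K := K) hg)
  obtain ⟨u, hu, ha⟩ := IsLocalization.integerNormalization_spec (nonZeroDivisors R) a
  obtain ⟨v, hv, hb⟩ := IsLocalization.integerNormalization_spec (nonZeroDivisors R) b
  refine ⟨C v * IsLocalization.integerNormalization (nonZeroDivisors R) a,
    C u * IsLocalization.integerNormalization (nonZeroDivisors R) b, u * v,
    mul_ne_zero (nonZeroDivisors.ne_zero hu) (nonZeroDivisors.ne_zero hv), ?_⟩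
  apply Polynomial.map_injective _ hinj
  rw [Polynomial.derivative_map] at hab
  rw [← algebraMap_smul K, smul_eq_C_mul] at ha hb
  simp only [Polynomial.map_add, Polynomial.map_mul, Polynomial.map_C, ha, hb, map_mul]
  linear_combination (C (algebraMap R K u) * C (algebraMap R K v)) * hab

open MvPolynomial in
/-- A squarefree polynomial and its partial derivative in one variable have a nonzero common
combination that does not involve this variable. -/
lemma exists_combination_pderiv {ι : Type*} [Finite ι] {f : MvPolynomial ι ℂ}
    (hf : Squarefree f) (i : ι) : ∃ A B R : MvPolynomial ι ℂ, R ≠ 0 ∧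
      R = A * f + B * pderiv i f ∧ ∀ y z : ι → ℂ, (∀ j, j ≠ i → y j = z j) →
        eval y R = eval z R := by
  classical
  -- Polynomials in the variable `i` over the ring of the remaining variables; the partial
  -- derivative becomes the ordinary one.
  let e : MvPolynomial ι ℂ ≃ₐ[ℂ] Polynomial (MvPolynomial {j // j ≠ i} ℂ) :=
    (renameEquiv ℂ (Equiv.optionSubtypeNe i).symm).trans (optionEquivLeft ℂ {j // j ≠ i})
  have hei : e (X i) = Polynomial.X := by simp [e]
  have hej (j : ι) (hj : j ≠ i) : e (X j) = Polynomial.C (X ⟨j, hj⟩) := by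
    simp [e, Equiv.optionSubtypeNe_symm_of_ne hj]
  have heC (c : ℂ) : e (MvPolynomial.C c) = Polynomial.C (MvPolynomial.C c) := by simp [e]
  have hder (p : MvPolynomial ι ℂ) : e (pderiv i p) = derivative (e p) := by
    induction p using MvPolynomial.induction_on with
    | C c => simp [heC]
    | add p q hp hq => simp [hp, hq]
    | mul_X p j hp =>
      rw [Derivation.leibniz, map_add, smul_eq_mul, smul_eq_mul, map_mul, map_mul, map_mul, hp,
        Polynomial.derivative_mul]
      rcases eq_or_ne j i with rfl | hj
      · simp [hei]; ring
      · simp [hej j hj, pderiv_X_of_ne hj]; ring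
  have hsq : Squarefree (e f) := by
    intro x hx
    have := hf (e.symm x) (by
      rw [← map_mul]
      obtain ⟨w, hw⟩ := hx
      exact ⟨e.symm w, by rw [← map_mul, ← hw, e.symm_apply_apply]⟩)
    simpa using this.map e
  obtain ⟨a, b, D, hD, h⟩ := exists_bezout_derivative hsq
  have hsymm (D : MvPolynomial {j // j ≠ i} ℂ) :
      e.symm (Polynomial.C D) = rename Subtype.val D := by
    rw [AlgEquiv.symm_apply_eq]
    induction D using MvPolynomial.induction_on with
    | C c => simp [heC]
    | add p q hp hq => simp [hp, hq]
    | mul_X p j hp => simp [hp, hej j j.2]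
  refine ⟨e.symm a, e.symm b, rename Subtype.val D,
    (map_ne_zero_iff _ (rename_injective _ Subtype.val_injective)).mpr hD, ?_, ?_⟩
  · rw [← hsymm, ← h, map_add, map_mul, map_mul, e.symm_apply_apply, ← hder, e.symm_apply_apply]
  · intro y z hyz
    rw [eval_rename, eval_rename]
    congr 2
    ext j
    exact hyz j j.2

end Squarefree

/-! ### The Jacobian criterion for squarefree polynomials. -/

section Smooth

open MvPolynomial

variable {ι : Type*} [Fintype ι]

lemma hasFDerivAt_eval (f : MvPolynomial ι ℂ) (z : ι → ℂ) :
    HasFDerivAt (fun z => eval z f)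
      (∑ i, eval z (pderiv i f) • ContinuousLinearMap.proj (R := ℂ) (φ := fun _ : ι => ℂ) i) z := by
  classical
  induction f using MvPolynomial.induction_on with
  | C c =>
    simp only [eval_C]
    refine (hasFDerivAt_const c z).congr_fderiv ?_
    ext w
    simp
  | add p q hp hq =>
    simp only [map_add]
    refine (hp.fun_add hq).congr_fderiv ?_
    ext w
    simp [add_mul, Finset.sum_add_distrib]
  | mul_X p j hp =>
    simp only [map_mul, eval_X]
    refine (hp.fun_mul (hasFDerivAt_apply (𝕜 := ℂ) j z)).congr_fderiv ?_
    ext w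
    simp only [_root_.add_apply, _root_.smul_apply,
      ContinuousLinearMap.proj_apply, _root_.sum_apply, smul_eq_mul,
      Derivation.leibniz, map_add, map_mul, eval_X, add_mul, Finset.sum_add_distrib,
      Finset.mul_sum, pderiv_X, Pi.single_apply]
    simp [apply_ite, mul_assoc]

lemma fderiv_eval_apply (f : MvPolynomial ι ℂ) (z w : ι → ℂ) :
    fderiv ℂ (fun z => eval z f) z w = ∑ i, w i * eval z (pderiv i f) := by
  rw [(hasFDerivAt_eval f z).fderiv]
  simp [mul_comm]

lemma hasDerivAt_eval_add_smul_single [DecidableEq ι] (f : MvPolynomial ι ℂ) (y : ι → ℂ) (i : ι)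
    (s : ℂ) : HasDerivAt (fun s : ℂ => eval (y + s • (Pi.single i 1 : ι → ℂ)) f)
      (eval (y + s • (Pi.single i 1 : ι → ℂ)) (pderiv i f)) s := by
  have h1 : HasDerivAt (fun s : ℂ => y + s • (Pi.single i 1 : ι → ℂ)) (Pi.single i 1) s := by
    simpa using ((hasDerivAt_id s).smul_const (Pi.single i 1 : ι → ℂ)).const_add y
  refine ((hasFDerivAt_eval f _).comp_hasDerivAt s h1).congr_deriv ?_
  simp [Pi.single_apply]

lemma eq_zero_of_eventually_eval_eq_zero {f : MvPolynomial ι ℂ} {t : ι → ℂ}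
    (h : ∀ᶠ z in 𝓝 t, eval z f = 0) : f = 0 := by
  have h1 : AnalyticOnNhd ℂ (fun z => eval z f) Set.univ := fun z _ => analyticAt_eval f z
  have h2 := h1.eq_of_eventuallyEq (g := 0) (fun z _ => analyticAt_const) h
  exact MvPolynomial.funext fun z => by simpa using congrFun h2 z

lemma isSmoothAt_of_pderiv_ne_zero {f : MvPolynomial ι ℂ} {t : ι → ℂ} {i : ι}
    (h : eval t (pderiv i f) ≠ 0) : IsSmoothAt {z | eval z f = 0} t := by
  classical
  refine ⟨1, fun z _ => eval z f, ?_, ?_, ?_⟩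
  · exact analyticAt_pi_iff.mpr fun _ => analyticAt_eval f t
  · intro y
    refine ⟨Pi.single i (y 0 / eval t (pderiv i f)), ?_⟩
    have h1 : HasFDerivAt (fun z (_ : Fin 1) => eval z f)
        (ContinuousLinearMap.pi fun _ => fderiv ℂ (fun z => eval z f) t) t :=
      hasFDerivAt_pi.mpr fun _ => (analyticAt_eval f t).differentiableAt.hasFDerivAt
    rw [h1.fderiv]
    ext j
    rw [Subsingleton.elim j 0]
    simp [fderiv_eval_apply, Pi.single_apply, h]
  · filter_upwards with z
    simp [funext_iff]

/-- A function on a disc with exactly one zero, which is simple, is bounded below by a multiple of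
the distance to this zero that depends only on the bound on the circle. -/
lemma mul_norm_sub_le_of_forall_sphere {q : ℂ → ℂ} {r m : ℝ} (hr : 0 < r) (hm : 0 < m)
    (hq : Differentiable ℂ q) {a : ℂ} (ha : ‖a‖ ≤ r) (hqa : q a = 0) (hda : deriv q a ≠ 0)
    (h0 : ∀ s, ‖s‖ ≤ r → q s = 0 → s = a) (hs : ∀ s ∈ Metric.sphere (0 : ℂ) r, m ≤ ‖q s‖)
    {s : ℂ} (hsr : ‖s‖ ≤ r) : m / (2 * r) * ‖s - a‖ ≤ ‖q s‖ := by
  have hmul (s : ℂ) : ‖q s‖ = ‖dslope q a s‖ * ‖s - a‖ := by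
    rw [← norm_mul, mul_comm, ← smul_eq_mul, sub_smul_dslope, hqa, sub_zero]
  have hdiff : DifferentiableOn ℂ (dslope q a) (Metric.closedBall 0 r) :=
    ((Complex.differentiableOn_dslope (Filter.univ_mem : Set.univ ∈ 𝓝 a)).mpr
      hq.differentiableOn).mono (Set.subset_univ _)
  have hne : ∀ s ∈ Metric.closedBall (0 : ℂ) r, dslope q a s ≠ 0 := by
    intro s hs h
    rcases eq_or_ne s a with rfl | hsa
    · exact hda (by rwa [dslope_same] at h)
    · exact hsa (h0 s (by simpa using hs) (by simpa [h] using hmul s))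
  have hsph : ∀ s ∈ Metric.sphere (0 : ℂ) r, m / (2 * r) ≤ ‖dslope q a s‖ := by
    intro s hs'
    have h1 : ‖s - a‖ ≤ 2 * r := by
      have h2 : ‖s‖ = r := by simpa using hs'
      linarith [norm_sub_le s a]
    rw [div_le_iff₀ (by positivity)]
    calc m ≤ ‖q s‖ := hs s hs'
      _ = ‖dslope q a s‖ * ‖s - a‖ := hmul s
      _ ≤ ‖dslope q a s‖ * (2 * r) := by gcongr
  rw [hmul]
  gcongr
  exact le_norm_of_forall_sphere hr (by positivity) hdiff hne hsph s (by simpa using hsr)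

/-- A smooth analytic germ has a coordinate direction along whose lines it has at most one
point, unless it is everything. -/
lemma IsSmoothAt.exists_single [DecidableEq ι] {S : Set (ι → ℂ)} {t : ι → ℂ} (hS : IsSmoothAt S t)
    (hne : ¬ ∀ᶠ z in 𝓝 t, z ∈ S) : ∃ i : ι, ∃ W ∈ 𝓝 t, ∀ (y : ι → ℂ) (s s' : ℂ),
      y + s • (Pi.single i 1 : ι → ℂ) ∈ W ∩ S → y + s' • (Pi.single i 1 : ι → ℂ) ∈ W ∩ S →
        s = s' := by
  obtain ⟨r, H, hH, hsurj, hev⟩ := hS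
  rcases r with _ | r
  · exact absurd (hev.mono fun z hz => hz.mpr (Subsingleton.elim _ _)) hne
  set D := fderiv ℂ H t
  obtain ⟨i, hi⟩ : ∃ i, D (Pi.single i 1) 0 ≠ 0 := by
    by_contra! h
    obtain ⟨w, hw⟩ := hsurj (Pi.single 0 1)
    have h1 : D w 0 = 0 := by
      rw [pi_eq_sum_univ' w, map_sum, Finset.sum_apply]
      exact Finset.sum_eq_zero fun j _ => by simp [h]
    simp [hw] at h1
  set u : ι → ℂ := Pi.single i 1
  have hu : 0 < ‖D u‖ := norm_pos_iff.mpr fun h0 => hi (by rw [h0]; rfl)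
  have hu1 : ‖u‖ = 1 := by simp [u, Pi.norm_single]
  -- With error constant half of ‖D u‖, strict differentiability makes `H` injective along lines of
  -- direction `u`.
  have hst := hH.hasStrictFDerivAt.isLittleO.def (half_pos hu)
  rw [nhds_prod_eq] at hst
  obtain ⟨W, hW, hWW⟩ := Filter.mem_prod_same_iff.mp hst
  refine ⟨i, W ∩ {z | z ∈ S ↔ H z = 0}, Filter.inter_mem hW hev, fun y s s' hs hs' => ?_⟩
  have h1 := hWW (Set.mk_mem_prod hs.1.1 hs'.1.1)
  have h2 : H (y + s • u) = 0 := hs.1.2.mp hs.2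
  have h3 : H (y + s' • u) = 0 := hs'.1.2.mp hs'.2
  have h4 : y + s • u - (y + s' • u) = (s - s') • u := by module
  change ‖H (y + s • u) - H (y + s' • u) - D (y + s • u - (y + s' • u))‖ ≤
    ‖D u‖ / 2 * ‖y + s • u - (y + s' • u)‖ at h1
  rw [h2, h3, h4, map_smul, sub_zero, zero_sub, norm_neg, norm_smul, norm_smul, hu1, mul_one] at h1
  by_contra hss
  have h5 : 0 < ‖s - s'‖ := norm_pos_iff.mpr (sub_ne_zero.mpr hss)
  nlinarith [mul_pos h5 hu]

/-- Smoothness is a property of the set, and squarefreeness prevents `f` from vanishing to higher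
order. On generic parallel lines near `t` the unique zero is simple, and `f` is bounded below by a
uniform multiple of the distance to it. In the limit the zero at `t` is simple too. -/
lemma exists_pderiv_ne_zero_of_isSmoothAt {f : MvPolynomial ι ℂ} (hf : Squarefree f)
    {t : ι → ℂ} (ht : eval t f = 0) (hs : IsSmoothAt {z | eval z f = 0} t) :
    ∃ i, eval t (pderiv i f) ≠ 0 := by
  classical
  obtain ⟨i, W, hW, hinj⟩ := hs.exists_single fun h =>
    hf.ne_zero (eq_zero_of_eventually_eval_eq_zero h)
  refine ⟨i, fun hd => ?_⟩
  obtain ⟨A, B, R, hR, hRe, hRi⟩ := exists_combination_pderiv hf i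
  set u : ι → ℂ := Pi.single i 1
  have hline : Filter.Tendsto (fun s : ℂ => t + s • u) (𝓝 0) (𝓝 t) := by
    have : Continuous (fun s : ℂ => t + s • u) := by fun_prop
    simpa using this.tendsto 0
  have hfreq : ∃ᶠ s in 𝓝 (0 : ℂ), eval (t + s • u) f ≠ 0 := by
    have h1 : ∃ᶠ s in 𝓝 (0 : ℂ), s ≠ 0 :=
      (Filter.frequently_mem_iff_neBot (s := {s : ℂ | s ≠ 0})).mpr
        (inferInstanceAs (𝓝[≠] (0 : ℂ)).NeBot)
    refine (h1.and_eventually (hline.eventually hW)).mono fun s hs h0 => hs.1 ?_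
    exact hinj t s 0 ⟨hs.2, h0⟩ ⟨by simpa using mem_of_mem_nhds hW, by simpa using ht⟩
  obtain ⟨r, hr, hrne, hrW⟩ := exists_radius (analyticAt_eval f t) hfreq hW
  obtain ⟨m, hm, hsph⟩ := exists_forall_sphere_le (J := fun z => eval z f) (p := t) (u := u) (r := r)
    (fun s _ => (analyticAt_eval f _).continuousAt)
    (fun s hs => hrne s (by simp at hs; exact hs.le) (by
      rintro rfl
      simp at hs
      exact hr.ne hs))
  have hsmall : ∀ᶠ y in 𝓝 t, ‖eval y f‖ < m := by
    refine (analyticAt_eval f t).continuousAt.norm.eventually_lt_const ?_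
    simpa [ht] using hm
  have hRfreq : ∃ᶠ y in 𝓝 t, eval y R ≠ 0 := fun h =>
    hR (eq_zero_of_eventually_eval_eq_zero (h.mono fun y hy => not_not.mp hy))
  -- The position a of the zero is eliminated using c‖a‖ ≤ ‖f(y)‖, with c = m/(2r), so the bound is
  -- closed in `y` and passes to `t`, even if `R` vanishes there.
  have hbound : ∃ᶠ y in 𝓝 t, ∀ s : ℂ, ‖s‖ ≤ r →
      m / (2 * r) * ‖s‖ ≤ ‖eval (y + s • u) f‖ + ‖eval y f‖ := by
    refine (hRfreq.and_eventually (hrW.and (hsph.and hsmall))).mono ?_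
    rintro y ⟨hRy, hyW, hysph, hysmall⟩ s hsr
    have hq : Differentiable ℂ fun s : ℂ => eval (y + s • u) f := fun s =>
      (hasDerivAt_eval_add_smul_single f y i s).differentiableAt
    obtain ⟨a, har, ha⟩ : ∃ a : ℂ, ‖a‖ ≤ r ∧ eval (y + a • u) f = 0 := by
      by_contra! h
      have := le_norm_of_forall_sphere hr hm hq.differentiableOn
        (fun s hs => h s (by simpa using hs)) hysph 0 (by simpa using hr.le)
      simp only [zero_smul, add_zero] at this
      exact this.not_gt hysmall
    have hda : deriv (fun s : ℂ => eval (y + s • u) f) a ≠ 0 := by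
      rw [(hasDerivAt_eval_add_smul_single f y i a).deriv]
      intro h0
      apply hRy
      -- A multiple zero on the line would make the combination `R` vanish at it, hence at `y`,
      -- since `R` is constant along the line.
      rw [hRi y (y + a • u) fun j hj => by simp [u, hj], hRe]
      simp [ha, u, h0]
    have key (s : ℂ) (hs : ‖s‖ ≤ r) : m / (2 * r) * ‖s - a‖ ≤ ‖eval (y + s • u) f‖ :=
      mul_norm_sub_le_of_forall_sphere hr hm hq har ha hda
        (fun s hs h0 => hinj y s a ⟨hyW s hs, h0⟩ ⟨hyW a har, ha⟩) hysph hs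
    have h1 := key s hsr
    have h2 := key 0 (by simpa using hr.le)
    simp only [zero_smul, add_zero, zero_sub, norm_neg] at h2
    have h3 : ‖s‖ ≤ ‖s - a‖ + ‖a‖ := by simpa using norm_add_le (s - a) a
    have h4 : 0 ≤ m / (2 * r) := by positivity
    nlinarith
  have hlim (s : ℂ) (hs : ‖s‖ ≤ r) : m / (2 * r) * ‖s‖ ≤ ‖eval (t + s • u) f‖ := by
    have hcf : Continuous fun z => eval z f :=
      continuous_iff_continuousAt.mpr fun z => (analyticAt_eval f z).continuousAt
    have hcl : IsClosed {y | m / (2 * r) * ‖s‖ ≤ ‖eval (y + s • u) f‖ + ‖eval y f‖} :=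
      isClosed_le continuous_const
        ((hcf.comp (continuous_add_const _)).norm.add hcf.norm)
    have := hcl.mem_of_frequently_of_tendsto (hbound.mono fun y hy => hy s hs) Filter.tendsto_id
    simpa [ht] using this
  have hder := hasDerivAt_eval_add_smul_single f t i 0
  rw [zero_smul, add_zero, hd, hasDerivAt_iff_isLittleO_nhds_zero] at hder
  have hc : 0 < m / (2 * r) := by positivity
  have h1 := hder.def (half_pos hc)
  -- A zero derivative would give ‖f(t + s u)‖ ≤ (c/2)‖s‖ for small s, against the lower bound c‖s‖.
  have h2 : ∀ᶠ s in 𝓝[≠] (0 : ℂ), False := by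
    filter_upwards [h1.filter_mono nhdsWithin_le_nhds,
      nhdsWithin_le_nhds (Metric.closedBall_mem_nhds (0 : ℂ) hr), self_mem_nhdsWithin]
      with s hs1 hs2 hs3
    have hs4 := hlim s (by simpa using hs2)
    simp only [zero_add, zero_smul, add_zero, ht, smul_zero, sub_zero] at hs1
    have hs5 : 0 < ‖s‖ := norm_pos_iff.mpr hs3
    have hs6 : ‖eval (t + s • u) f‖ ≤ m / (2 * r) / 2 * ‖s‖ := hs1
    nlinarith [mul_pos hc hs5]
  exact h2.exists.choose_spec

end Smooth

/-! ### The smoothness criterion on a slice. -/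

section Toric

variable {N : Type*} [AddCommGroup N] {F : Fan N} {d : ℕ} {f : MvPolynomial (Ray F) ℂ}
  {β : ClassGp F}

/-- By homogeneity, the partial derivatives along a full-dimensional cone determine all of them
at the points of the slice. -/
lemma Slice.exists_pderiv_ne_zero (S : Slice F d) (hf : IsDHomogeneous F f β) {v : Fin d → ℂ}
    (hv : MvPolynomial.eval (S.sl v) f = 0) {i : Ray F}
    (hi : MvPolynomial.eval (S.sl v) (MvPolynomial.pderiv i f) ≠ 0) :
    ∃ j, j.gen ∈ S.cone ∧ MvPolynomial.eval (S.sl v) (MvPolynomial.pderiv j f) ≠ 0 := by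
  classical
  by_contra! h
  obtain ⟨y, hy⟩ := S.exists_fderiv_eq (g := fun z => MvPolynomial.eval z f)
    (analyticAt_eval f _).differentiableAt (Filter.Eventually.of_forall (by
      rintro z ⟨u, hu, rfl⟩
      exact (hf.eval_torusAct_eq_zero_iff hu _).mpr hv)) (Pi.single i 1)
  rw [fderiv_eval_apply, fderiv_eval_apply] at hy
  apply hi
  have h0 : ∑ j, S.lin y j * MvPolynomial.eval (S.sl v) (MvPolynomial.pderiv j f) = 0 := by
    refine Finset.sum_eq_zero fun j _ => ?_
    by_cases hj : j.gen ∈ S.cone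
    · rw [h j hj, mul_zero]
    · rw [S.lin_of_notMem _ ((S.mem_cone_iff j).not.mp hj), zero_mul]
  simpa [h0, Pi.single_apply] using hy

lemma isSmoothAt_zeroSet_iff [Module.Free ℤ N] [Module.Finite ℤ N]
    (hd : Module.finrank ℤ N = d) (hf : IsDHomogeneous F f β) (hsq : Squarefree f)
    {σ : Finset N} (hσ : σ ∈ F.cones) (hcard : σ.card = d) {t : Ray F → ℂ} (ht : t ∈ zeroSet F f)
    (h1 : ∀ i, i.gen ∉ σ → t i = 1) :
    IsSmoothAt (zeroSet F f) t ↔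
      ∃ i, i.gen ∈ σ ∧ MvPolynomial.eval t (MvPolynomial.pderiv i f) ≠ 0 := by
  refine ⟨fun hs => ?_, fun ⟨i, _, hi⟩ => isSmoothAt_of_pderiv_ne_zero hi⟩
  obtain ⟨S, rfl⟩ := F.exists_slice hd hσ hcard
  have htS : t = S.sl fun a => t (S.idx a) := by
    ext i
    by_cases hi : i.gen ∈ S.cone
    · obtain ⟨a, rfl⟩ := (S.mem_cone_iff i).mp hi
      rw [S.sl_idx]
    · rw [h1 i hi, S.sl_of_notMem _ ((S.mem_cone_iff i).not.mp hi)]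
  obtain ⟨i, hi⟩ := exists_pderiv_ne_zero_of_isSmoothAt hsq ht hs
  rw [htS] at hi ⊢
  exact S.exists_pderiv_ne_zero hf (htS ▸ ht) hi

end Toric

end ToricHyp

end

theorem mainTheorem7 {N : Type*} [AddCommGroup N] [Module.Free ℤ N] [Module.Finite ℤ N]
    (d : ℕ) (hd : Module.finrank ℤ N = d) (F : ToricHyp.Fan N)
    (f : MvPolynomial (ToricHyp.Ray F) ℂ) (β : ToricHyp.ClassGp F)
    (hf : ToricHyp.IsDHomogeneous F f β) :
    (ToricHyp.IsQuasiSmooth F f ↔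
      ToricHyp.IsVSubmanifold F d (ToricHyp.hypersurface F f)) ∧
    (Squarefree f →
      ∀ σ ∈ F.cones, σ.card = d → ∀ t ∈ ToricHyp.zeroSet F f, (∀ i, i.gen ∉ σ → t i = 1) →
        (ToricHyp.IsSmoothAt (ToricHyp.zeroSet F f) t ↔
          ∃ i, i.gen ∈ σ ∧ MvPolynomial.eval t (MvPolynomial.pderiv i f) ≠ 0)) := by
  exact ⟨⟨fun h => h.isVSubmanifold hd hf, fun h => h.isQuasiSmooth hd hf⟩,
    fun hsq _ hσ hcard _ ht h1 => ToricHyp.isSmoothAt_zeroSet_iff hd hf hsq hσ hcard ht h1⟩
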